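/- **Setting.** Fix a discount rate $r>0$. Let $F^0,F^1:[0,\infty)\to[-\infty,\infty)$ be concave and upper semi-continuous with $F^0\le F^1$, with unique peaks $u^0>0$ and $u^1\ge 0$ respectively (that is, $F^j(u)<F^j(u^j)$ for every $u\neq u^j$), such that $u^1<u^0$ and $F^0$ is finite on $(0,u^0]$. A supergradient of $F^j$ at a point $u$ of the closure of $\{F^j>-\infty\}$ is an $\eta\in[-\infty,\infty]$ with $F^j(u')\le F^j(u)+\eta(u'-u)$ for every $u'\ne u$ in $[0,\infty)$ (where $-\infty+\infty$ on the right-hand side is read as $\infty$). Let $u^\star$ be the greatest $u\in[0,u^0)$ at which $F^0$ and $F^1$ share a supergradient, and assume that, if $u^\star>0$, then $u^\star$ is a strict local maximum of $F^1-F^0$. A *mechanism* is a pair $(x,X^1)$ of a Lebesgue-measurable $x:[0,\infty)\to[0,\infty)$ and a function $X^1:[0,\infty)\to[0,\infty]$. It is *incentive-compatible (IC)* iff for every $t\ge 0$, $$X^1_t\ \ge\ r\int_t^{t+d}e^{-r(s-t)}x_s\,ds+e^{-rd}X^1_{t+d}\ \text{ for all } d>0,\qquad X^1_t\ \ge\ r\int_t^\infty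 e^{-r(s-t)}x_s\,ds .$$ For a probability distribution (CDF) $G$ of a time $\tau\in[0,\infty)$, its payoff is $$\Pi_G(x,X^1)=\mathbf E_{\tau\sim G}\Big(r\int_0^\tau e^{-rt}F^0(x_t)\,dt+e^{-r\tau}F^1(X^1_\tau)\Big)\in[-\infty,\infty),\qquad F^1(\infty):=-\infty .$$ An IC mechanism is *undominated* iff no IC mechanism has a weakly higher payoff under every distribution and a strictly higher payoff under some distribution. An IC mechanism is *optimal for $G$* iff it maximises $\Pi_G$ among IC mechanisms and is undominated. A *version* of $(x,X^1)$ is a mechanism $(\tilde x,X^1)$ with $\tilde x=x$ Lebesgue-almost everywhere. **Theorem 3.** Let $G$ be a distribution on $[0,\infty)$ with $G(0)=0$ and unbounded support. Then any mechanism $(x,X^1)$ that is optimal for $G$ has a version $(\tilde x,X^1)$ in which $\tilde x$ is (weakly) decreasing, with $$\lim_{t\downarrow 0}\tilde x_t=u^0\qquad\text{and}\qquad \lim_{t\to\infty}\tilde x_t=u^\star .$$ -/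

import Mathlib

open Set Filter Topology MeasureTheory
open scoped ENNReal

noncomputable section

/-- The Lebesgue integral of an extended-real-valued function: integral of the positive part minus
integral of the negative part. Below it is only applied to functions that are bounded above by an
integrable function, so the positive part always has a finite integral. -/
def eintegral {α : Type*} [MeasurableSpace α] (μ : Measure α) (f : α → EReal) : EReal :=
  ((∫⁻ a, (f a).toENNReal ∂μ : ℝ≥0∞) : EReal) - ((∫⁻ a, (-f a).toENNReal ∂μ : ℝ≥0∞) : EReal)

/-- A utility possibility frontier `F : [0,∞) → [-∞,∞)` (only the values of `F` on `[0,∞)` matter):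
concave, upper semi-continuous, with unique peak `p`. -/
structure IsFrontier (F : ℝ → EReal) (p : ℝ) : Prop where
  ne_top : ∀ u, 0 ≤ u → F u ≠ ⊤
  concave : ∀ u v a b : ℝ, 0 ≤ u → 0 ≤ v → 0 ≤ a → 0 ≤ b → a + b = 1 →
    (a : EReal) * F u + (b : EReal) * F v ≤ F (a * u + b * v)
  usc : UpperSemicontinuousOn F (Ici 0)
  peak_nonneg : 0 ≤ p
  peak : ∀ u, 0 ≤ u → u ≠ p → F u < F p

/-- `η ∈ [-∞,∞]` is a supergradient of `F` at a point `u` of the closure of the effective domain: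
`F u' ≤ F u + η (u' - u)` for all `u' ≠ u` in `[0,∞)`. The inequality is written with `F u`
subtracted, so that a `u` with `F u = -∞` admits the supergradient `∞` if it is the left end of the
effective domain, as usual (`-∞ + ∞` counts as `∞` on the right-hand side). -/
def IsSupergradient (F : ℝ → EReal) (u : ℝ) (η : EReal) : Prop :=
  u ∈ closure {v : ℝ | 0 ≤ v ∧ F v ≠ ⊥} ∧
    ∀ u', 0 ≤ u' → u' ≠ u → F u' - F u ≤ η * ((u' - u : ℝ) : EReal)

/-- `F⁰` and `F¹` have equal slopes at `u`: they share a supergradient there. -/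
def EqualSlopes (F₀ F₁ : ℝ → EReal) (u : ℝ) : Prop :=
  ∃ η : EReal, IsSupergradient F₀ u η ∧ IsSupergradient F₁ u η

/-- The model assumptions on the old frontier `F₀` (peak `u₀`) and the new frontier `F₁`
(peak `u₁`), where `us` is the rightmost utility to the left of `u₀` at which the frontiers have
equal slopes. The strict-local-maximum assumption has content only if `us > 0`; it holds
automatically if `us = 0` (where `F₁ - F₀` may be undefined). -/
structure IsTechnology (F₀ F₁ : ℝ → EReal) (u₀ u₁ us : ℝ) : Prop where
  old : IsFrontier F₀ u₀
  new : IsFrontier F₁ u₁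
  old_finite : ∀ u, 0 < u → u ≤ u₀ → F₀ u ≠ ⊥
  old_le_new : ∀ u, 0 ≤ u → F₀ u ≤ F₁ u
  conflict : u₁ < u₀
  ustar : IsGreatest {u : ℝ | 0 ≤ u ∧ u < u₀ ∧ EqualSlopes F₀ F₁ u} us
  strict_max : 0 < us → ∀ᶠ u in 𝓝[≠] us, F₁ u - F₀ u < F₁ us - F₀ us

/-- A mechanism: a Lebesgue-measurable pre-disclosure flow `[0,∞) → [0,∞)` and a disclosure reward
`[0,∞) → [0,∞]` (values at negative times are irrelevant). -/
structure Mechanism where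
  flow : ℝ → ℝ
  reward : ℝ → ℝ≥0∞
  flow_nonneg : ∀ t, 0 ≤ t → 0 ≤ flow t
  flow_meas : AEMeasurable flow (volume.restrict (Ici 0))

namespace Mechanism

/-- The value `r ∫_S e^{-r(s-t)} x⁰_s ds`, discounted to time `t`, of the flow over the times `S`. -/
def flowValue (r : ℝ) (m : Mechanism) (t : ℝ) (S : Set ℝ) : ℝ≥0∞ :=
  ∫⁻ s in S, ENNReal.ofReal (r * Real.exp (-r * (s - t)) * m.flow s)

/-- Incentive-compatibility: at every time, prompt disclosure is weakly better than disclosure with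
any delay `d > 0` and than never disclosing. -/
def IC (r : ℝ) (m : Mechanism) : Prop :=
  ∀ t, 0 ≤ t →
    (∀ d, 0 < d →
      m.flowValue r t (Ioo t (t + d)) + ENNReal.ofReal (Real.exp (-r * d)) * m.reward (t + d)
        ≤ m.reward t) ∧
    m.flowValue r t (Ioi t) ≤ m.reward t

/-- The principal's payoff if the breakthrough occurs at (and is disclosed at) time `τ`:
`r ∫₀^τ e^{-rt} F⁰(x⁰_t) dt + e^{-rτ} F¹(X¹_τ)`, with the convention `F¹(∞) = -∞`. -/
def payoffAt (F₀ F₁ : ℝ → EReal) (r : ℝ) (m : Mechanism) (τ : ℝ) : EReal :=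
  eintegral (volume.restrict (Ioo 0 τ))
      (fun t => ((r * Real.exp (-r * t) : ℝ) : EReal) * F₀ (m.flow t)) +
    ((Real.exp (-r * τ) : ℝ) : EReal) *
      (if m.reward τ = ∞ then ⊥ else F₁ (m.reward τ).toReal)

/-- The principal's expected payoff when the breakthrough time has law `G`. -/
def payoff (F₀ F₁ : ℝ → EReal) (r : ℝ) (G : Measure ℝ) (m : Mechanism) : EReal :=
  eintegral G (m.payoffAt F₀ F₁ r)

end Mechanism

/-- The law of a breakthrough time: a probability measure carried by `[0,∞)`. -/
structure IsTimeLaw (G : Measure ℝ) : Prop where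
  prob : IsProbabilityMeasure G
  nonneg : G (Iio 0) = 0

namespace Mechanism

/-- `m` dominates `m'`: weakly better under every law, strictly better under some law. -/
def Dominates (F₀ F₁ : ℝ → EReal) (r : ℝ) (m m' : Mechanism) : Prop :=
  (∀ G, IsTimeLaw G → m'.payoff F₀ F₁ r G ≤ m.payoff F₀ F₁ r G) ∧
    ∃ G, IsTimeLaw G ∧ m'.payoff F₀ F₁ r G < m.payoff F₀ F₁ r G

/-- An incentive-compatible mechanism that no incentive-compatible mechanism dominates. -/
def Undominated (F₀ F₁ : ℝ → EReal) (r : ℝ) (m : Mechanism) : Prop :=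
  m.IC r ∧ ∀ m' : Mechanism, m'.IC r → ¬ m'.Dominates F₀ F₁ r m

/-- `m` is optimal for `G`: it maximises the principal's payoff under `G` among incentive-compatible
mechanisms, and it is undominated. -/
def Optimal (F₀ F₁ : ℝ → EReal) (r : ℝ) (G : Measure ℝ) (m : Mechanism) : Prop :=
  m.IC r ∧ (∀ m' : Mechanism, m'.IC r → m'.payoff F₀ F₁ r G ≤ m.payoff F₀ F₁ r G) ∧
    m.Undominated F₀ F₁ r

/-- `m'` is a version of `m`: same rewards, and flows that agree at almost every time. -/
def IsVersion (m' m : Mechanism) : Prop :=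
  m'.flow =ᵐ[volume.restrict (Ici 0)] m.flow ∧ ∀ t, 0 ≤ t → m'.reward t = m.reward t

end Mechanism

end

/-!
Normalised by `r`, discounting is a probability law `μ` on `[0, ∞)` (exponential of rate `r`), and
a breakthrough at `τ` pays `∫ t in Iic τ, F⁰ (x t) ∂μ + μ (Ioi τ) * F¹ (X τ)`.

Capping the flow at `u⁰` keeps a mechanism incentive-compatible and can only raise the payoff, and
so does moving the rewards toward `u¹` as far as incentives allow. In an undominated mechanism the
discounted rent, that is, the reward in excess of the continuation value, is therefore so rigid that
it is itself the tail integral of an increment to the flow. Paying this increment out would be an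
improvement, so rewards equal continuation values and the flow alone matters.

Moving flow from one time to another, toward a level `l` at both, changes the flow payoff at the
slope of `F⁰` at `l`, and the payoff from the reward at the slope of `F¹` there. Above `u⋆` the
frontier `F⁰` is the steeper one, so a flow that rises across a level could be profitably shifted;
hence it is almost everywhere decreasing and stays above `u⋆`.

If the flow stayed below some `l < u⁰`, raising it to `l` until `ε` would gain on breakthroughs after
`ε` and lose only on earlier ones, whose probability vanishes with `ε` because `G 0 = 0`. If its limit
exceeded `u⋆`, moving flow from after `S` to before `T` would gain on breakthroughs in `(T, S]` and
lose only after `S`; for large `S` this is profitable because the support of `G` is unbounded.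
-/

/-- `s` is a supergradient at `u` of the restriction of `f` to `I`: a real-valued counterpart of
`IsSupergradient`, in which the effective domain `I` is explicit. -/
def SupergradOn (f : ℝ → ℝ) (I : Set ℝ) (u s : ℝ) : Prop :=
  ∀ v ∈ I, f v ≤ f u + s * (v - u)

namespace SupergradOn

variable {f : ℝ → ℝ} {I : Set ℝ} {m s u v x y : ℝ}

theorem exists_of_mem_interior (hf : ConcaveOn ℝ I f) (hu : u ∈ interior I) :
    ∃ s, SupergradOn f I u s := by
  refine ⟨-derivWithin (-f) (Ioi u) u, fun v hv => ?_⟩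
  rcases lt_trichotomy v u with h | rfl | h
  · have h1 := (hf.neg.slope_le_leftDeriv_of_mem_interior hv hu h).trans
      (hf.neg.leftDeriv_le_rightDeriv_of_mem_interior hu)
    rw [slope_def_field, div_le_iff₀ (sub_pos.2 h)] at h1
    simp only [Pi.neg_apply] at h1
    linarith
  · simp
  · have h1 := hf.neg.rightDeriv_le_slope_of_mem_interior hu hv h
    rw [slope_def_field, le_div_iff₀ (sub_pos.2 h)] at h1
    simp only [Pi.neg_apply] at h1
    linarith

theorem add_mul_sub_le (hf : ConcaveOn ℝ I f) (hs : SupergradOn f I m s) (hm : m ∈ I)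
    (hx : x ∈ I) (hy : y ∈ uIcc x m) : f x + s * (y - x) ≤ f y := by
  rw [← segment_eq_uIcc] at hy
  obtain ⟨a, b, ha, hb, hab, rfl⟩ := hy
  have hconc := hf.2 hx hm ha hb hab
  have hgrad := mul_le_mul_of_nonneg_left (hs x hx) hb
  obtain rfl : a = 1 - b := by linarith
  simp only [smul_eq_mul] at hconc ⊢
  linarith

theorem sub_le_mul_sub (hf : ConcaveOn ℝ I f) (hs : SupergradOn f I m s) (hm : m ∈ I) (hv : v ∈ I)
    (hmu : m ≤ u) (huv : u ≤ v) : f v - f u ≤ s * (v - u) := by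
  have := hs.add_mul_sub_le hf hm hv (mem_uIcc.2 (Or.inr ⟨hmu, huv⟩))
  linarith

theorem mul_sub_le_sub (hf : ConcaveOn ℝ I f) (hs : SupergradOn f I m s) (hm : m ∈ I) (hu : u ∈ I)
    (huv : u ≤ v) (hvm : v ≤ m) : s * (v - u) ≤ f v - f u := by
  have := hs.add_mul_sub_le hf hm hu (mem_uIcc.2 (Or.inl ⟨huv, hvm⟩))
  linarith

end SupergradOn

section Integration

variable {μ : Measure ℝ}

theorem integrable_of_forall_mem_Icc {α : Type*} [MeasurableSpace α] {μ : Measure α}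
    [IsFiniteMeasure μ] {f : α → ℝ} {a b : ℝ} (hf : Measurable f) (h : ∀ t, f t ∈ Icc a b) :
    Integrable f μ :=
  .of_mem_Icc a b hf.aemeasurable (ae_of_all _ h)

/-- By Lebesgue differentiation along the intervals centred at a point. -/
theorem ae_nonneg_of_setIntegral_Ioc_nonneg [IsFiniteMeasure μ] [NullSingletonClass μ] {w : ℝ → ℝ}
    (hw : Integrable w μ) (h : ∀ a b, 0 ≤ a → a ≤ b → 0 ≤ ∫ t in Ioc a b, w t ∂μ) :
    ∀ᵐ t ∂μ, 0 < t → 0 ≤ w t := by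
  filter_upwards [(Besicovitch.vitaliFamily μ).ae_tendsto_average hw.locallyIntegrable]
    with t hlim ht
  refine ge_of_tendsto (hlim.comp (Besicovitch.tendsto_filterAt μ t)) ?_
  filter_upwards [Ioo_mem_nhdsGT ht] with ε hε
  rw [Function.comp_apply, setAverage_eq, Real.closedBall_eq_Icc, integral_Icc_eq_integral_Ioc]
  exact smul_nonneg (by positivity) (h _ _ (by linarith [hε.2]) (by linarith [hε.1]))

theorem ae_eq_of_forall_setIntegral_Iic_eq {f g : ℝ → ℝ}
    (hf : ∀ n : ℕ, IntegrableOn f (Iic n) μ) (hg : ∀ n : ℕ, IntegrableOn g (Iic n) μ)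
    (hle : f ≤ᵐ[μ] g) (h : ∀ n : ℕ, ∫ t in Iic (n : ℝ), f t ∂μ = ∫ t in Iic (n : ℝ), g t ∂μ) :
    f =ᵐ[μ] g := by
  have hn : ∀ n : ℕ, ∀ᵐ t : ℝ ∂μ, t ∈ Iic (n : ℝ) → f t = g t := fun n =>
    (ae_restrict_iff' measurableSet_Iic).1
      ((integral_eq_iff_of_ae_le (hf n) (hg n) (ae_restrict_of_ae hle)).1 (h n))
  filter_upwards [ae_all_iff.2 hn] with t ht
  obtain ⟨n, hn⟩ := exists_nat_ge t
  exact ht n hn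

end Integration

/-- A discounting law: a nonatomic probability law on `(0, ∞)` that charges every interval. Time is
measured by such a law throughout the analysis of flows; in the application it has density
`r e^{-rt}`. -/
class IsDiscountMeasure (μ : Measure ℝ) : Prop extends
    IsProbabilityMeasure μ, NullSingletonClass μ where
  measure_Iic_zero : μ (Iic 0) = 0
  measure_Ioc_pos : ∀ a b, 0 ≤ a → a < b → 0 < μ (Ioc a b)

/-- The value of the flow `x` after time `t`, discounted to time `0`. -/
noncomputable def tailValue (μ : Measure ℝ) (x : ℝ → ℝ) (t : ℝ) : ℝ := ∫ s in Ioi t, x s ∂μ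

/-- The continuation value of the flow `x`: its value after time `t`, discounted to time `t`. -/
noncomputable def contValue (μ : Measure ℝ) (x : ℝ → ℝ) (t : ℝ) : ℝ :=
  tailValue μ x t / μ.real (Ioi t)

section TailValue

variable {μ : Measure ℝ} {x y : ℝ → ℝ} {a b : ℝ}

theorem tailValue_const (c t : ℝ) : tailValue μ (fun _ => c) t = μ.real (Ioi t) * c := by
  simp [tailValue]

theorem setIntegral_Iic_add_tailValue (hx : Integrable x μ) (t : ℝ) :
    (∫ s in Iic t, x s ∂μ) + tailValue μ x t = ∫ s, x s ∂μ := by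
  simpa only [tailValue, compl_Iic] using integral_add_compl (measurableSet_Iic (a := t)) hx

theorem tailValue_sub_tailValue (hx : Integrable x μ) (hab : a ≤ b) :
    tailValue μ x a - tailValue μ x b = ∫ s in Ioc a b, x s ∂μ := by
  unfold tailValue
  rw [← Ioc_union_Ioi_eq_Ioi hab, setIntegral_union (Ioc_disjoint_Ioi le_rfl) measurableSet_Ioi
    hx.integrableOn hx.integrableOn]
  ring

theorem measureReal_Ioc_eq_sub [IsFiniteMeasure μ] (hab : a ≤ b) :
    μ.real (Ioc a b) = μ.real (Ioi a) - μ.real (Ioi b) := by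
  simpa [tailValue] using
    (tailValue_sub_tailValue (μ := μ) (integrable_const (1 : ℝ)) hab).symm

theorem tailValue_mono_of_ae {t : ℝ} (hx : Integrable x μ) (hy : Integrable y μ)
    (h : ∀ᵐ s ∂μ, t < s → x s ≤ y s) : tailValue μ x t ≤ tailValue μ y t :=
  setIntegral_mono_on_ae hx.integrableOn hy.integrableOn measurableSet_Ioi h

theorem continuous_tailValue [NullSingletonClass μ] (hx : Integrable x μ) :
    Continuous (tailValue μ x) := by
  have h : tailValue μ x = fun t => tailValue μ x 0 - ∫ s in (0 : ℝ)..t, x s ∂μ := by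
    funext t
    rcases le_total 0 t with ht | ht
    · rw [intervalIntegral.integral_of_le ht, ← tailValue_sub_tailValue hx ht]; ring
    · rw [intervalIntegral.integral_of_ge ht, ← tailValue_sub_tailValue hx ht]; ring
  rw [h]
  exact continuous_const.sub
    (intervalIntegral.continuous_primitive (fun a b => hx.intervalIntegrable) 0)

theorem continuous_measureReal_Ioi [IsFiniteMeasure μ] [NullSingletonClass μ] :
    Continuous fun t => μ.real (Ioi t) :=
  (continuous_tailValue (μ := μ) (integrable_const 1)).congr fun t => by
    rw [tailValue_const, mul_one]

theorem contValue_congr_Ioi (h : ∀ t ∈ Ioi a, y t = x t) :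
    contValue μ y a = contValue μ x a := by
  rw [contValue, contValue, tailValue, tailValue, setIntegral_congr_fun measurableSet_Ioi h]

theorem tailValue_add (hx : Integrable x μ) (hy : Integrable y μ) (t : ℝ) :
    tailValue μ (fun s => x s + y s) t = tailValue μ x t + tailValue μ y t :=
  integral_add hx.integrableOn hy.integrableOn

theorem tailValue_sub (hx : Integrable x μ) (hy : Integrable y μ) (t : ℝ) :
    tailValue μ (fun s => x s - y s) t = tailValue μ x t - tailValue μ y t :=
  integral_sub hx.integrableOn hy.integrableOn

theorem tailValue_mem_Icc (hx : Integrable x μ) (h0 : ∀ s, 0 ≤ x s) (t : ℝ) :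
    tailValue μ x t ∈ Icc 0 (∫ s, x s ∂μ) :=
  ⟨integral_nonneg h0, setIntegral_le_integral hx (ae_of_all _ h0)⟩

theorem tailValue_eq_zero {t : ℝ} (h0 : ∀ s, t < s → x s = 0) : tailValue μ x t = 0 :=
  setIntegral_eq_zero_of_forall_eq_zero h0

theorem tailValue_eq_integral {t : ℝ} (h0 : ∀ s, s ≤ t → x s = 0) :
    tailValue μ x t = ∫ s, x s ∂μ :=
  setIntegral_eq_integral_of_forall_compl_eq_zero fun s hs => h0 s (not_lt.1 hs)

theorem tendsto_tailValue_atTop (hx : Integrable x μ) : Tendsto (tailValue μ x) atTop (𝓝 0) := by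
  have hlim := ((aecover_Iic (μ := μ) tendsto_id).integral_tendsto_of_countably_generated
    hx).const_sub (∫ t, x t ∂μ)
  rw [sub_self] at hlim
  exact hlim.congr fun t => sub_eq_of_eq_add' (setIntegral_Iic_add_tailValue hx t).symm

theorem contValue_add (hx : Integrable x μ) (hy : Integrable y μ) (t : ℝ) :
    contValue μ (fun s => x s + y s) t = contValue μ x t + contValue μ y t := by
  rw [contValue, tailValue_add hx hy, add_div, contValue, contValue]

theorem contValue_const_mul (a : ℝ) (x : ℝ → ℝ) (t : ℝ) :
    contValue μ (fun s => a * x s) t = a * contValue μ x t := by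
  rw [contValue, contValue, tailValue, integral_const_mul, mul_div_assoc, tailValue]

theorem contValue_add_const_mul (hx : Integrable x μ) (hy : Integrable y μ) (a t : ℝ) :
    contValue μ (fun s => x s + a * y s) t = contValue μ x t + a * contValue μ y t := by
  rw [contValue_add hx (hy.const_mul a), contValue_const_mul]

theorem contValue_neg (x : ℝ → ℝ) (t : ℝ) : contValue μ (fun s => -x s) t = -contValue μ x t := by
  rw [contValue, contValue, tailValue, integral_neg, neg_div, tailValue]

theorem contValue_mono_of_ae {t : ℝ} (hx : Integrable x μ) (hy : Integrable y μ)
    (h : ∀ᵐ s ∂μ, t < s → x s ≤ y s) : contValue μ x t ≤ contValue μ y t :=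
  div_le_div_of_nonneg_right (tailValue_mono_of_ae hx hy h) measureReal_nonneg

end TailValue

section ContValue

variable {μ : Measure ℝ} [IsDiscountMeasure μ] {x y : ℝ → ℝ}

theorem ae_pos_of_isDiscountMeasure : ∀ᵐ t ∂μ, 0 < t := by
  rw [ae_iff]
  simpa [Iic] using IsDiscountMeasure.measure_Iic_zero (μ := μ)

theorem measureReal_Ioi_pos (t : ℝ) : 0 < μ.real (Ioi t) := by
  refine ENNReal.toReal_pos (ne_of_gt ?_) (measure_ne_top _ _)
  exact (IsDiscountMeasure.measure_Ioc_pos (max t 0) (max t 0 + 1) (le_max_right _ _)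
    (by linarith)).trans_le (measure_mono fun s hs => (le_max_left t 0).trans_lt hs.1)

theorem integral_eq_tailValue_zero : ∫ s, x s ∂μ = tailValue μ x 0 := by
  rw [tailValue, Measure.restrict_eq_self_of_ae_mem (s := Ioi (0 : ℝ)) ae_pos_of_isDiscountMeasure]

theorem measureReal_Ioi_zero : μ.real (Ioi 0) = 1 := by
  simpa [tailValue] using (integral_eq_tailValue_zero (μ := μ) (x := fun _ => (1 : ℝ))).symm

theorem measureReal_Ioi_mul_contValue (t : ℝ) :
    μ.real (Ioi t) * contValue μ x t = tailValue μ x t :=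
  mul_div_cancel₀ _ (measureReal_Ioi_pos t).ne'

theorem integral_eq_contValue_zero : ∫ s, x s ∂μ = contValue μ x 0 := by
  rw [integral_eq_tailValue_zero, ← measureReal_Ioi_mul_contValue, measureReal_Ioi_zero, one_mul]

theorem contValue_eq_of_tailValue_eq {c t : ℝ} (h : tailValue μ x t = μ.real (Ioi t) * c) :
    contValue μ x t = c := by
  rw [contValue, h, mul_div_cancel_left₀ _ (measureReal_Ioi_pos t).ne']

theorem contValue_const (c t : ℝ) : contValue μ (fun _ => c) t = c :=
  contValue_eq_of_tailValue_eq (tailValue_const c t)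

theorem continuous_contValue (hx : Integrable x μ) : Continuous (contValue μ x) :=
  (continuous_tailValue hx).div continuous_measureReal_Ioi fun t => (measureReal_Ioi_pos t).ne'

theorem contValue_mem_Icc {a b : ℝ} (hx : Measurable x) (h : ∀ t, x t ∈ Icc a b) (t : ℝ) :
    contValue μ x t ∈ Icc a b := by
  have hxi : Integrable x μ := integrable_of_forall_mem_Icc hx h
  have h1 := tailValue_mono_of_ae (t := t) (integrable_const a) hxi
    (ae_of_all _ fun s _ => (h s).1)
  have h2 := tailValue_mono_of_ae (t := t) hxi (integrable_const b)
    (ae_of_all _ fun s _ => (h s).2)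
  rw [tailValue_const, ← measureReal_Ioi_mul_contValue] at h1 h2
  exact ⟨le_of_mul_le_mul_left h1 (measureReal_Ioi_pos t),
    le_of_mul_le_mul_left h2 (measureReal_Ioi_pos t)⟩

theorem setIntegral_Iic_eq_sub (hx : Integrable x μ) (τ : ℝ) :
    ∫ t in Iic τ, x t ∂μ = contValue μ x 0 - μ.real (Ioi τ) * contValue μ x τ := by
  rw [measureReal_Ioi_mul_contValue, ← integral_eq_contValue_zero]
  exact eq_sub_of_add_eq (setIntegral_Iic_add_tailValue hx τ)

theorem setIntegral_Iic_sub_eq (hx : Integrable x μ) (hy : Integrable y μ)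
    (hxy : ∫ t, y t ∂μ = ∫ t, x t ∂μ) (τ : ℝ) :
    ∫ t in Iic τ, (y t - x t) ∂μ = μ.real (Ioi τ) * (contValue μ x τ - contValue μ y τ) := by
  rw [integral_eq_contValue_zero, integral_eq_contValue_zero] at hxy
  rw [integral_sub hy.integrableOn hx.integrableOn, setIntegral_Iic_eq_sub hx,
    setIntegral_Iic_eq_sub hy, hxy]
  ring

theorem contValue_le_ae_of_antitoneOn {l u : ℝ} (hx : Measurable x) (h : ∀ t, x t ∈ Icc l u)
    (hX : AntitoneOn (contValue μ x) (Ici 0)) : ∀ᵐ t ∂μ, contValue μ x t ≤ x t := by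
  have hxi : Integrable x μ := integrable_of_forall_mem_Icc hx h
  have hXi : Integrable (contValue μ x) μ :=
    integrable_of_forall_mem_Icc (continuous_contValue hxi).measurable (contValue_mem_Icc hx h)
  have hmean : ∀ a b, 0 ≤ a → a ≤ b → 0 ≤ ∫ t in Ioc a b, (x t - contValue μ x t) ∂μ := by
    intro a b ha hab
    have hXle : ∫ t in Ioc a b, contValue μ x t ∂μ ≤ ∫ _ in Ioc a b, contValue μ x a ∂μ :=
      setIntegral_mono_on hXi.integrableOn (integrable_const _).integrableOn measurableSet_Ioc
        (fun _ ht => hX ha (ha.trans ht.1.le) ht.1.le)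
    rw [setIntegral_const, smul_eq_mul, measureReal_Ioc_eq_sub hab] at hXle
    have hxeq := tailValue_sub_tailValue hxi hab
    rw [← measureReal_Ioi_mul_contValue, ← measureReal_Ioi_mul_contValue] at hxeq
    have hb := mul_le_mul_of_nonneg_left (hX ha (ha.trans hab) hab)
      (measureReal_Ioi_pos (μ := μ) b).le
    rw [integral_sub hxi.integrableOn hXi.integrableOn]
    linarith
  filter_upwards [ae_nonneg_of_setIntegral_Ioc_nonneg (hxi.sub hXi) hmean,
    ae_pos_of_isDiscountMeasure (μ := μ)] with t ht ht0 using sub_nonneg.1 (ht ht0)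

theorem contValue_congr_Ioc {a b : ℝ} (hx : Integrable x μ) (hy : Integrable y μ) (hab : a ≤ b)
    (h : ∀ t ∈ Ioc a b, y t = x t) (hb : contValue μ y b = contValue μ x b) :
    contValue μ y a = contValue μ x a := by
  refine contValue_eq_of_tailValue_eq ?_
  have hdiff := tailValue_sub_tailValue hy hab
  rw [setIntegral_congr_fun measurableSet_Ioc h, ← tailValue_sub_tailValue hx hab,
    ← measureReal_Ioi_mul_contValue b, ← measureReal_Ioi_mul_contValue b, hb] at hdiff
  rw [measureReal_Ioi_mul_contValue]
  linarith

theorem contValue_piecewise_Ioi {u T : ℝ} (hx : Integrable x μ) (hT : contValue μ x T = u) :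
    contValue μ ((Ioi T).piecewise (fun _ => u) x) =
      (Ioi T).piecewise (fun _ => u) (contValue μ x) := by
  have hy : Integrable ((Ioi T).piecewise (fun _ => u) x) μ :=
    .piecewise measurableSet_Ioi (integrable_const u).integrableOn hx.integrableOn
  have hge : ∀ τ, T ≤ τ → contValue μ ((Ioi T).piecewise (fun _ => u) x) τ = u := fun τ hτ =>
    (contValue_congr_Ioi fun t ht => piecewise_eq_of_mem (Ioi T) _ _ (hτ.trans_lt ht)).trans
      (contValue_const u τ)
  funext τ
  rcases lt_or_ge T τ with hτ | hτ
  · rw [hge τ hτ.le, piecewise_eq_of_mem (Ioi T) _ _ hτ]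
  · rw [piecewise_eq_of_notMem (Ioi T) _ _ (notMem_Ioi.2 hτ)]
    refine contValue_congr_Ioc hx hy hτ
      (fun t ht => piecewise_eq_of_notMem (Ioi T) _ _ (notMem_Ioi.2 ht.2)) ?_
    rw [hge T le_rfl, hT]

theorem contValue_piecewise_Ioc {u T S : ℝ} (hx : Integrable x μ) (hTS : T ≤ S)
    (hT : contValue μ x T = u) (hS : contValue μ x S = u) :
    contValue μ ((Ioc T S).piecewise (fun _ => u) x) =
      (Ioc T S).piecewise (fun _ => u) (contValue μ x) := by
  have hy : Integrable ((Ioc T S).piecewise (fun _ => u) x) μ :=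
    .piecewise measurableSet_Ioc (integrable_const u).integrableOn hx.integrableOn
  have hge : ∀ τ, S ≤ τ →
      contValue μ ((Ioc T S).piecewise (fun _ => u) x) τ = contValue μ x τ := fun τ hτ =>
    contValue_congr_Ioi fun t ht =>
      piecewise_eq_of_notMem _ _ _ fun h => (hτ.trans_lt ht).not_ge h.2
  have hmid : ∀ τ, T ≤ τ → τ ≤ S →
      contValue μ ((Ioc T S).piecewise (fun _ => u) x) τ = u := fun τ hTτ hτS =>
    (contValue_congr_Ioc (integrable_const u) hy hτS
      (fun t ht => piecewise_eq_of_mem _ _ _ ⟨hTτ.trans_lt ht.1, ht.2⟩)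
      (by rw [hge S le_rfl, hS, contValue_const])).trans (contValue_const u τ)
  funext τ
  by_cases hτ : τ ∈ Ioc T S
  · rw [hmid τ hτ.1.le hτ.2, piecewise_eq_of_mem _ _ _ hτ]
  rw [piecewise_eq_of_notMem _ _ _ hτ]
  rcases lt_or_ge T τ with hτT | hτT
  · exact hge τ (le_of_lt (not_le.1 fun h => hτ ⟨hτT, h⟩))
  · refine contValue_congr_Ioc hx hy hτT
      (fun t ht => piecewise_eq_of_notMem _ _ _ fun h => h.1.not_ge ht.2) ?_
    rw [hmid T le_rfl hTS, hT]

end ContValue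

/-- A technology seen through real-valued frontiers, with effective domains `I₀` and `I₁` inside
`[0, u₀]` and with supergradients relative to these domains. -/
structure IsFrontierPair (f₀ f₁ : ℝ → ℝ) (I₀ I₁ : Set ℝ) (u₀ u₁ us : ℝ) : Prop where
  us_nonneg : 0 ≤ us
  us_lt : us < u₀
  u₁_nonneg : 0 ≤ u₁
  u₁_lt : u₁ < u₀
  Ioc_subset : Ioc 0 u₀ ⊆ I₀
  subset_new : I₀ ⊆ I₁
  subset_Icc : I₁ ⊆ Icc 0 u₀
  concaveOn_old : ConcaveOn ℝ I₀ f₀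
  concaveOn_new : ConcaveOn ℝ I₁ f₁
  measurable_old : Measurable f₀
  strictMonoOn_old : StrictMonoOn f₀ I₀
  strictAntiOn_new : StrictAntiOn f₁ (Icc u₁ u₀)
  lt_of_supergradOn : ∀ u s η, us < u → u < u₀ → SupergradOn f₀ I₀ u s → SupergradOn f₁ I₁ u η →
    η < s
  exists_shared : 0 < us → ∃ η, SupergradOn f₀ I₀ us η ∧ SupergradOn f₁ I₁ us η
  strict_max : 0 < us → ∀ᶠ v in 𝓝[≠] us, f₁ v - f₀ v < f₁ us - f₀ us

/-- The flows that are available to the designer in the real-valued model: measurable, with values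
in `[0, u₀]`, and with a finite payoff before any given time. -/
structure Admissible (μ : Measure ℝ) (f₀ : ℝ → ℝ) (I₀ : Set ℝ) (u₀ : ℝ) (x : ℝ → ℝ) : Prop where
  measurable : Measurable x
  mem_Icc : ∀ t, x t ∈ Icc 0 u₀
  ae_mem : ∀ᵐ t ∂μ, x t ∈ I₀
  integrableOn : ∀ τ, IntegrableOn (fun t => f₀ (x t)) (Iic τ) μ

/-- The payoff of the flow `x` when the breakthrough occurs at time `τ` and its disclosure is
rewarded by the continuation value of `x`. -/
noncomputable def disclosureValue (μ : Measure ℝ) (f₀ f₁ : ℝ → ℝ) (x : ℝ → ℝ) (τ : ℝ) : ℝ :=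
  (∫ t in Iic τ, f₀ (x t) ∂μ) + μ.real (Ioi τ) * f₁ (contValue μ x τ)

/-- An admissible flow is efficient if no other one yields a weakly better disclosure value at every
time and a strictly better one at some time. -/
structure Efficient (μ : Measure ℝ) (f₀ f₁ : ℝ → ℝ) (I₀ : Set ℝ) (u₀ : ℝ) (x : ℝ → ℝ) :
    Prop where
  admissible : Admissible μ f₀ I₀ u₀ x
  eq_of_le : ∀ y, Admissible μ f₀ I₀ u₀ y →
    (∀ τ, 0 ≤ τ → disclosureValue μ f₀ f₁ x τ ≤ disclosureValue μ f₀ f₁ y τ) →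
    ∀ τ, 0 ≤ τ → disclosureValue μ f₀ f₁ y τ = disclosureValue μ f₀ f₁ x τ

section

variable {μ : Measure ℝ} {f₀ f₁ : ℝ → ℝ} {I₀ I₁ : Set ℝ} {u₀ u₁ us u m s : ℝ} {x y : ℝ → ℝ}

namespace IsFrontierPair

theorem u₀_pos (h : IsFrontierPair f₀ f₁ I₀ I₁ u₀ u₁ us) : 0 < u₀ := h.us_nonneg.trans_lt h.us_lt

theorem mem_old (h : IsFrontierPair f₀ f₁ I₀ I₁ u₀ u₁ us) (hu : 0 < u) (hu' : u ≤ u₀) :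
    u ∈ I₀ := h.Ioc_subset ⟨hu, hu'⟩

theorem mem_new (h : IsFrontierPair f₀ f₁ I₀ I₁ u₀ u₁ us) (hu : 0 < u) (hu' : u ≤ u₀) :
    u ∈ I₁ := h.subset_new (h.mem_old hu hu')

theorem u₀_mem_old (h : IsFrontierPair f₀ f₁ I₀ I₁ u₀ u₁ us) : u₀ ∈ I₀ := h.mem_old h.u₀_pos le_rfl

theorem mem_interior_old (h : IsFrontierPair f₀ f₁ I₀ I₁ u₀ u₁ us) (hu : 0 < u) (hu' : u < u₀) :
    u ∈ interior I₀ :=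
  interior_mono h.Ioc_subset (mem_interior_iff_mem_nhds.2 (Ioc_mem_nhds hu hu'))

theorem exists_supergradOn_old (h : IsFrontierPair f₀ f₁ I₀ I₁ u₀ u₁ us) (hu : 0 < u)
    (hu' : u < u₀) : ∃ s, SupergradOn f₀ I₀ u s :=
  SupergradOn.exists_of_mem_interior h.concaveOn_old (h.mem_interior_old hu hu')

theorem exists_supergradOn_new (h : IsFrontierPair f₀ f₁ I₀ I₁ u₀ u₁ us) (hu : 0 < u)
    (hu' : u < u₀) : ∃ s, SupergradOn f₁ I₁ u s :=
  SupergradOn.exists_of_mem_interior h.concaveOn_new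
    (interior_mono h.subset_new (h.mem_interior_old hu hu'))

theorem supergradOn_old_pos (h : IsFrontierPair f₀ f₁ I₀ I₁ u₀ u₁ us) (hu : 0 < u)
    (hu' : u < u₀) (hs : SupergradOn f₀ I₀ u s) : 0 < s := by
  have hgrad := hs u₀ h.u₀_mem_old
  have hlt := h.strictMonoOn_old (h.mem_old hu hu'.le) h.u₀_mem_old hu'
  exact pos_of_mul_pos_left (by linarith) (sub_nonneg.2 hu'.le)

end IsFrontierPair

namespace Admissible

theorem nonneg (hx : Admissible μ f₀ I₀ u₀ x) (t : ℝ) : 0 ≤ x t := (hx.mem_Icc t).1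

theorem le (hx : Admissible μ f₀ I₀ u₀ x) (t : ℝ) : x t ≤ u₀ := (hx.mem_Icc t).2

theorem integrable [IsFiniteMeasure μ] (hx : Admissible μ f₀ I₀ u₀ x) : Integrable x μ :=
  integrable_of_forall_mem_Icc hx.measurable hx.mem_Icc

theorem contValue_mem_Icc [IsDiscountMeasure μ] (hx : Admissible μ f₀ I₀ u₀ x) (t : ℝ) :
    contValue μ x t ∈ Icc 0 u₀ :=
  _root_.contValue_mem_Icc hx.measurable hx.mem_Icc t

theorem contValue_mem_new [IsDiscountMeasure μ] (hF : IsFrontierPair f₀ f₁ I₀ I₁ u₀ u₁ us)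
    (hx : Admissible μ f₀ I₀ u₀ x) (τ : ℝ) : contValue μ x τ ∈ I₁ := by
  rcases (hx.contValue_mem_Icc τ).1.eq_or_lt with h0 | hpos
  · have hzero : x =ᵐ[μ.restrict (Ioi τ)] 0 := by
      rw [← integral_eq_zero_iff_of_nonneg hx.nonneg hx.integrable.integrableOn]
      exact (measureReal_Ioi_mul_contValue τ).symm.trans (by rw [← h0, mul_zero])
    have : NeZero (μ.restrict (Ioi τ)) :=
      ⟨fun h => (measureReal_Ioi_pos (μ := μ) τ).ne' (by simp_all [measureReal_def])⟩
    obtain ⟨t, hxt, ht⟩ := (hzero.and (ae_restrict_of_ae hx.ae_mem)).exists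
    rw [← h0]
    exact hF.subset_new (by simpa [hxt] using ht)
  · exact hF.mem_new hpos (hx.contValue_mem_Icc τ).2

theorem of_add_le [IsFiniteMeasure μ] (hF : IsFrontierPair f₀ f₁ I₀ I₁ u₀ u₁ us)
    (hx : Admissible μ f₀ I₀ u₀ x) {z : ℝ → ℝ} (hym : Measurable y) (hy : ∀ t, y t ∈ Icc 0 u₀)
    (hz : Integrable z μ) (h : ∀ᵐ t ∂μ, y t ∈ I₀ ∧ f₀ (x t) + z t ≤ f₀ (y t)) :
    Admissible μ f₀ I₀ u₀ y where
  measurable := hym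
  mem_Icc := hy
  ae_mem := h.mono fun t ht => ht.1
  integrableOn τ := by
    refine integrable_of_le_of_le (hF.measurable_old.comp hym).aestronglyMeasurable
      (ae_restrict_of_ae (h.mono fun t ht => ht.2)) (ae_restrict_of_ae (h.mono fun t ht => ?_))
      ((hx.integrableOn τ).add hz.integrableOn) (integrable_const (f₀ u₀))
    exact hF.strictMonoOn_old.monotoneOn ht.1 hF.u₀_mem_old (hy t).2

theorem setIntegral_add_le (hx : Admissible μ f₀ I₀ u₀ x) (hy : Admissible μ f₀ I₀ u₀ y)
    {z : ℝ → ℝ} (hz : Integrable z μ) (h : ∀ᵐ t ∂μ, f₀ (x t) + z t ≤ f₀ (y t)) (τ : ℝ) :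
    (∫ t in Iic τ, f₀ (x t) ∂μ) + ∫ t in Iic τ, z t ∂μ ≤ ∫ t in Iic τ, f₀ (y t) ∂μ := by
  rw [← integral_add (hx.integrableOn τ) hz.integrableOn]
  exact integral_mono_ae ((hx.integrableOn τ).add hz.integrableOn) (hy.integrableOn τ)
    (ae_restrict_of_ae h)

theorem mem_Icc_of_mem_uIcc (hx : Admissible μ f₀ I₀ u₀ x) (hm : m ∈ Icc 0 u₀)
    (hy : ∀ t, y t ∈ uIcc (x t) m) (t : ℝ) : y t ∈ Icc 0 u₀ :=
  ordConnected_Icc.uIcc_subset (hx.mem_Icc t) hm (hy t)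

theorem ae_add_mul_sub_le (hF : IsFrontierPair f₀ f₁ I₀ I₁ u₀ u₁ us)
    (hx : Admissible μ f₀ I₀ u₀ x) (hm : m ∈ I₀) (hs : SupergradOn f₀ I₀ m s)
    (hy : ∀ t, y t ∈ uIcc (x t) m) :
    ∀ᵐ t ∂μ, y t ∈ I₀ ∧ f₀ (x t) + s * (y t - x t) ≤ f₀ (y t) :=
  hx.ae_mem.mono fun t ht => ⟨hF.concaveOn_old.1.ordConnected.uIcc_subset ht hm (hy t),
    hs.add_mul_sub_le hF.concaveOn_old hm ht (hy t)⟩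

theorem of_mem_uIcc [IsFiniteMeasure μ] (hF : IsFrontierPair f₀ f₁ I₀ I₁ u₀ u₁ us)
    (hx : Admissible μ f₀ I₀ u₀ x) (hm : m ∈ I₀) (hs : SupergradOn f₀ I₀ m s)
    (hym : Measurable y) (hy : ∀ t, y t ∈ uIcc (x t) m) : Admissible μ f₀ I₀ u₀ y := by
  have hyI := hx.mem_Icc_of_mem_uIcc (hF.subset_Icc (hF.subset_new hm)) hy
  exact hx.of_add_le hF hym hyI
    (((integrable_of_forall_mem_Icc hym hyI).sub hx.integrable).const_mul s)
    (hx.ae_add_mul_sub_le hF hm hs hy)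

theorem add_mul_setIntegral_le [IsFiniteMeasure μ] (hF : IsFrontierPair f₀ f₁ I₀ I₁ u₀ u₁ us)
    (hx : Admissible μ f₀ I₀ u₀ x) (hy : Admissible μ f₀ I₀ u₀ y) (hm : m ∈ I₀)
    (hs : SupergradOn f₀ I₀ m s) (hyx : ∀ t, y t ∈ uIcc (x t) m) (τ : ℝ) :
    (∫ t in Iic τ, f₀ (x t) ∂μ) + s * ∫ t in Iic τ, (y t - x t) ∂μ ≤
      ∫ t in Iic τ, f₀ (y t) ∂μ := by
  rw [← integral_const_mul]
  exact hx.setIntegral_add_le hy ((hy.integrable.sub hx.integrable).const_mul s)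
    ((hx.ae_add_mul_sub_le hF hm hs hyx).mono fun t ht => ht.2) τ

end Admissible

namespace Efficient

variable [IsDiscountMeasure μ]

/-- Redistributing the flow towards `m` gains at least `s` per unit transferred before disclosure;
if it never loses more than that through the reward, efficiency makes every estimate an equality. -/
theorem eq_of_mem_uIcc (hF : IsFrontierPair f₀ f₁ I₀ I₁ u₀ u₁ us) (hE : Efficient μ f₀ f₁ I₀ u₀ x)
    (hm : m ∈ I₀) (hs : SupergradOn f₀ I₀ m s) (hym : Measurable y)
    (hy : ∀ t, y t ∈ uIcc (x t) m) (hxy : ∫ t, y t ∂μ = ∫ t, x t ∂μ)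
    (h : ∀ τ, 0 ≤ τ →
      f₁ (contValue μ x τ) ≤ f₁ (contValue μ y τ) + s * (contValue μ x τ - contValue μ y τ)) :
    (∀ τ, 0 ≤ τ →
      f₁ (contValue μ x τ) = f₁ (contValue μ y τ) + s * (contValue μ x τ - contValue μ y τ)) ∧
      ∀ᵐ t ∂μ, f₀ (y t) = f₀ (x t) + s * (y t - x t) := by
  have hx := hE.admissible
  have hya := hx.of_mem_uIcc hF hm hs hym hy
  have hz : Integrable (fun t => s * (y t - x t)) μ :=
    (hya.integrable.sub hx.integrable).const_mul s
  have hflow := fun τ => hx.add_mul_setIntegral_le hF hya hm hs hy τ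
  have hshift := setIntegral_Iic_sub_eq hx.integrable hya.integrable hxy
  have hreward := fun τ hτ =>
    mul_le_mul_of_nonneg_left (h τ hτ) (measureReal_Ioi_pos (μ := μ) τ).le
  have heq := hE.eq_of_le y hya fun τ hτ => by
    unfold disclosureValue
    linarith [hflow τ, hreward τ hτ, congrArg (s * ·) (hshift τ)]
  unfold disclosureValue at heq
  constructor
  · intro τ hτ
    refine mul_left_cancel₀ (measureReal_Ioi_pos (μ := μ) τ).ne' ?_
    linarith [hflow τ, hreward τ hτ, congrArg (s * ·) (hshift τ), heq τ hτ]
  · have hle : (fun t => f₀ (x t) + s * (y t - x t)) ≤ᵐ[μ] fun t => f₀ (y t) :=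
      (hx.ae_add_mul_sub_le hF hm hs hy).mono fun t ht => ht.2
    refine (ae_eq_of_forall_setIntegral_Iic_eq
      (fun n => (hx.integrableOn n).add hz.integrableOn) (fun n => hya.integrableOn n) hle
      fun n => ?_).symm
    simp only [Pi.add_apply]
    rw [integral_add (hx.integrableOn n) hz.integrableOn, integral_const_mul]
    linarith [hflow n, hreward n n.cast_nonneg, congrArg (s * ·) (hshift n), heq n n.cast_nonneg]

theorem eq_of_contValue_piecewise (hF : IsFrontierPair f₀ f₁ I₀ I₁ u₀ u₁ us)
    (hE : Efficient μ f₀ f₁ I₀ u₀ x) (hu : u ∈ I₀) (hs : SupergradOn f₀ I₀ u s)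
    {J : Set ℝ} [DecidablePred (· ∈ J)] (hJ : MeasurableSet J) (hJ0 : J ⊆ Ioi 0)
    (hcont : contValue μ (J.piecewise (fun _ => u) x) = J.piecewise (fun _ => u) (contValue μ x))
    (h : ∀ τ ∈ J, f₁ (contValue μ x τ) ≤ f₁ u + s * (contValue μ x τ - u)) :
    ∀ τ ∈ J, f₁ (contValue μ x τ) = f₁ u + s * (contValue μ x τ - u) := by
  have hin : ∀ τ ∈ J, contValue μ (J.piecewise (fun _ => u) x) τ = u := fun τ hτ => by
    rw [hcont, piecewise_eq_of_mem _ _ _ hτ]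
  have hout : ∀ τ ∉ J, contValue μ (J.piecewise (fun _ => u) x) τ = contValue μ x τ :=
    fun τ hτ => by rw [hcont, piecewise_eq_of_notMem _ _ _ hτ]
  have hmem : ∀ t, J.piecewise (fun _ => u) x t ∈ uIcc (x t) u := fun t => by
    by_cases ht : t ∈ J
    · rw [piecewise_eq_of_mem _ _ _ ht]; exact right_mem_uIcc
    · rw [piecewise_eq_of_notMem _ _ _ ht]; exact left_mem_uIcc
  have hint : ∫ t, J.piecewise (fun _ => u) x t ∂μ = ∫ t, x t ∂μ := by
    rw [integral_eq_contValue_zero, integral_eq_contValue_zero,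
      hout 0 fun h0 => lt_irrefl (0 : ℝ) (hJ0 h0)]
  intro τ hτ
  have heq := (hE.eq_of_mem_uIcc hF hu hs
    (Measurable.piecewise hJ measurable_const hE.admissible.measurable) hmem hint
    fun τ _ => ?_).1 τ (hJ0 hτ).le
  · rwa [hin τ hτ] at heq
  · by_cases hτ : τ ∈ J
    · rw [hin τ hτ]; exact h τ hτ
    · rw [hout τ hτ, sub_self, mul_zero, add_zero]

theorem us_le_contValue_zero (hF : IsFrontierPair f₀ f₁ I₀ I₁ u₀ u₁ us)
    (hE : Efficient μ f₀ f₁ I₀ u₀ x) : us ≤ contValue μ x 0 := by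
  have hx := hE.admissible
  rcases hF.us_nonneg.eq_or_lt with h0 | h0
  · exact h0 ▸ (hx.contValue_mem_Icc 0).1
  by_contra! hlt
  obtain ⟨η, hη₀, hη₁⟩ := hF.exists_shared h0
  have hmem : ∀ t, us ∈ uIcc (x t) us := fun t => right_mem_uIcc
  have hus := hF.mem_old h0 hF.us_lt.le
  have hy := hx.of_mem_uIcc hF hus hη₀ measurable_const hmem
  have hgain : ∀ τ, disclosureValue μ f₀ f₁ x τ < disclosureValue μ f₀ f₁ (fun _ => us) τ := by
    intro τ
    have hflow := hx.add_mul_setIntegral_le hF hy hus hη₀ hmem τ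
    have hreward := mul_le_mul_of_nonneg_left (hη₁ _ (hx.contValue_mem_new hF τ))
      (measureReal_Ioi_pos (μ := μ) τ).le
    rw [integral_sub hy.integrable.integrableOn hx.integrable.integrableOn,
      setIntegral_Iic_eq_sub hx.integrable, setIntegral_Iic_eq_sub hy.integrable,
      contValue_const, contValue_const] at hflow
    have hpos := mul_pos (hF.supergradOn_old_pos h0 hF.us_lt hη₀) (sub_pos.2 hlt)
    unfold disclosureValue
    rw [contValue_const]
    nlinarith
  exact (hgain 0).ne' (hE.eq_of_le _ hy (fun τ _ => (hgain τ).le) 0 le_rfl)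

end Efficient

end

theorem exists_last_eq {X : ℝ → ℝ} (hX : Continuous X) {a b u : ℝ} (hab : a ≤ b) (ha : X a ≤ u)
    (hb : u ≤ X b) : ∃ T ∈ Icc a b, X T = u ∧ ∀ t ∈ Ioc T b, u ≤ X t := by
  obtain ⟨T, ⟨hT, hTu⟩, hTmax⟩ := (isCompact_Icc.inter_right
    (isClosed_le hX (continuous_const (y := u)))).exists_isGreatest ⟨a, left_mem_Icc.2 hab, ha⟩
  obtain ⟨t, ht, htu⟩ := intermediate_value_Icc hT.2 hX.continuousOn ⟨hTu, hb⟩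
  obtain rfl : t = T := (hTmax ⟨⟨hT.1.trans ht.1, ht.2⟩, htu.le⟩).antisymm ht.1
  refine ⟨t, hT, htu, fun t' ht' => le_of_not_gt fun hlt => ht'.1.not_ge (hTmax ?_)⟩
  exact ⟨⟨hT.1.trans ht'.1.le, ht'.2⟩, hlt.le⟩

theorem exists_first_eq {X : ℝ → ℝ} (hX : Continuous X) {a b u : ℝ} (hab : a ≤ b) (ha : u ≤ X a)
    (hb : X b ≤ u) : ∃ T ∈ Icc a b, X T = u ∧ ∀ t ∈ Ico a T, u ≤ X t := by
  obtain ⟨T, hT, hTu, hlast⟩ := exists_last_eq (hX.comp continuous_neg) (neg_le_neg hab)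
    (u := u) (by simpa using hb) (by simpa using ha)
  refine ⟨-T, ⟨le_neg_of_le_neg hT.2, neg_le_of_neg_le hT.1⟩, hTu, fun t ht => ?_⟩
  simpa using hlast (-t) ⟨lt_neg_of_lt_neg ht.2, neg_le_neg ht.1⟩

section

variable {μ : Measure ℝ} {f₀ f₁ : ℝ → ℝ} {I₀ I₁ : Set ℝ} {u₀ u₁ us u η T τ : ℝ} {x : ℝ → ℝ}

theorem IsFrontierPair.eventually_lt_of_supergradOn (hF : IsFrontierPair f₀ f₁ I₀ I₁ u₀ u₁ us)
    (h0 : 0 < us) (hη : SupergradOn f₀ I₀ us η) :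
    ∀ᶠ v in 𝓝[≠] us, f₁ v < f₁ us + η * (v - us) := by
  filter_upwards [hF.strict_max h0, nhdsWithin_le_nhds (Ioo_mem_nhds h0 hF.us_lt)] with v hv hvI
  linarith [hη v (hF.mem_old hvI.1 hvI.2.le)]

namespace Efficient

variable [IsDiscountMeasure μ]

/-- On a positive value `us`, the two frontiers share a supergradient whose line touches `f₁` only
at `us` nearby, so a continuous continuation value on that line cannot leave `us`. -/
theorem contValue_eq_us_of_pos (hF : IsFrontierPair f₀ f₁ I₀ I₁ u₀ u₁ us)
    (hE : Efficient μ f₀ f₁ I₀ u₀ x) (h0 : 0 < us) (hT : 0 ≤ T) (hTu : contValue μ x T = us)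
    (hτ : T ≤ τ) : contValue μ x τ = us := by
  classical
  have hx := hE.admissible
  obtain ⟨η, hη₀, hη₁⟩ := hF.exists_shared h0
  have hline : ∀ t ∈ Ici T, f₁ (contValue μ x t) = f₁ us + η * (contValue μ x t - us) := by
    intro t ht
    rcases (mem_Ici.1 ht).eq_or_lt with rfl | ht
    · rw [hTu, sub_self, mul_zero, add_zero]
    · exact hE.eq_of_contValue_piecewise hF (hF.mem_old h0 hF.us_lt.le) hη₀ measurableSet_Ioi
        (Ioi_subset_Ioi hT) (contValue_piecewise_Ioi hx.integrable hTu)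
        (fun t _ => hη₁ _ (hx.contValue_mem_new hF t)) t ht
  have hmem : us ∈ contValue μ x '' Ici T := ⟨T, self_mem_Ici, hTu⟩
  have hpre : IsPreconnected (contValue μ x '' Ici T) :=
    isPreconnected_Ici.image _ (continuous_contValue hx.integrable).continuousOn
  by_contra hne
  have hacc := accPt_iff_frequently_nhdsNE.1
    (hpre.preperfect_of_nontrivial ⟨us, hmem, _, mem_image_of_mem _ hτ, Ne.symm hne⟩ us hmem)
  obtain ⟨_, ⟨t, ht, rfl⟩, hlt⟩ :=
    (hacc.and_eventually (hF.eventually_lt_of_supergradOn h0 hη₀)).exists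
  exact hlt.ne (hline t ht)

theorem contValue_eq_us (hF : IsFrontierPair f₀ f₁ I₀ I₁ u₀ u₁ us)
    (hE : Efficient μ f₀ f₁ I₀ u₀ x) (hT : 0 ≤ T) (hTu : contValue μ x T = us) (hτ : T ≤ τ) :
    contValue μ x τ = us := by
  have hx := hE.admissible
  rcases hF.us_nonneg.eq_or_lt with rfl | h0
  · have hdiff := tailValue_sub_tailValue hx.integrable hτ
    have hnonneg : 0 ≤ ∫ s in Ioc T τ, x s ∂μ := integral_nonneg hx.nonneg
    rw [← measureReal_Ioi_mul_contValue, hTu, mul_zero, ← measureReal_Ioi_mul_contValue] at hdiff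
    refine le_antisymm ?_ (hx.contValue_mem_Icc τ).1
    exact nonpos_of_mul_nonpos_right (by linarith) (measureReal_Ioi_pos (μ := μ) τ)
  · exact hE.contValue_eq_us_of_pos hF h0 hT hTu hτ

theorem us_le_contValue (hF : IsFrontierPair f₀ f₁ I₀ I₁ u₀ u₁ us)
    (hE : Efficient μ f₀ f₁ I₀ u₀ x) (hτ : 0 ≤ τ) : us ≤ contValue μ x τ := by
  by_contra! hlt
  obtain ⟨T, hT, hTu⟩ := intermediate_value_Icc' hτ
    (continuous_contValue hE.admissible.integrable).continuousOn
    ⟨hlt.le, hE.us_le_contValue_zero hF⟩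
  exact hlt.ne (hE.contValue_eq_us hF hT.1 hTu hT.2)

/-- Above `us` the old frontier is strictly steeper than the new one, so smoothing an excursion of
the continuation value above `u` would be strictly profitable. -/
theorem contValue_eq_of_piecewise (hF : IsFrontierPair f₀ f₁ I₀ I₁ u₀ u₁ us)
    (hE : Efficient μ f₀ f₁ I₀ u₀ x) (hus : us < u) (hu : u < u₀) {J : Set ℝ}
    [DecidablePred (· ∈ J)] (hJ : MeasurableSet J) (hJ0 : J ⊆ Ioi 0)
    (hcont : contValue μ (J.piecewise (fun _ => u) x) = J.piecewise (fun _ => u) (contValue μ x))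
    (h : ∀ τ ∈ J, u ≤ contValue μ x τ) : ∀ τ ∈ J, contValue μ x τ = u := by
  have hu0 := hF.us_nonneg.trans_lt hus
  obtain ⟨s, hs⟩ := hF.exists_supergradOn_old hu0 hu
  obtain ⟨η, hη⟩ := hF.exists_supergradOn_new hu0 hu
  have hlt := hF.lt_of_supergradOn u s η hus hu hs hη
  have hnew := fun τ => hη _ (hE.admissible.contValue_mem_new hF τ)
  intro τ hτ
  have heq := hE.eq_of_contValue_piecewise hF (hF.mem_old hu0 hu.le) hs hJ hJ0 hcont
    (fun t ht => (hnew t).trans (by nlinarith [h t ht])) τ hτ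
  nlinarith [h τ hτ, hnew τ]

theorem antitoneOn_contValue (hF : IsFrontierPair f₀ f₁ I₀ I₁ u₀ u₁ us)
    (hE : Efficient μ f₀ f₁ I₀ u₀ x) : AntitoneOn (contValue μ x) (Ici 0) := by
  classical
  intro a ha b _ hab
  by_contra! hlt
  have hxi := hE.admissible.integrable
  have hX := continuous_contValue hxi
  obtain ⟨u, hau, hub⟩ := exists_between hlt
  have hus := (hE.us_le_contValue hF ha).trans_lt hau
  have hu := hub.trans_le (hE.admissible.contValue_mem_Icc b).2
  obtain ⟨T, hTab, hTu, hlast⟩ := exists_last_eq hX hab hau.le hub.le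
  have hT0 : 0 ≤ T := ha.trans hTab.1
  have hTb : T < b := lt_of_le_of_ne hTab.2 fun h => hub.ne' (h ▸ hTu)
  by_cases hret : ∃ c, b ≤ c ∧ contValue μ x c ≤ u
  · obtain ⟨c, hbc, hcu⟩ := hret
    obtain ⟨S, hS, hSu, hfirst⟩ := exists_first_eq hX hbc hub.le hcu
    refine hub.ne' (hE.contValue_eq_of_piecewise hF hus hu measurableSet_Ioc
      (Ioc_subset_Ioi_self.trans (Ioi_subset_Ioi hT0))
      (contValue_piecewise_Ioc hxi (hTb.le.trans hS.1) hTu hSu) (fun t ht => ?_) b ⟨hTb, hS.1⟩)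
    rcases le_or_gt t b with htb | htb
    · exact hlast t ⟨ht.1, htb⟩
    · exact ht.2.eq_or_lt.elim (fun h => h ▸ hSu.ge) fun h => hfirst t ⟨htb.le, h⟩
  · push Not at hret
    refine hub.ne' (hE.contValue_eq_of_piecewise hF hus hu measurableSet_Ioi (Ioi_subset_Ioi hT0)
      (contValue_piecewise_Ioi hxi hTu) (fun t ht => ?_) b hTb)
    rcases le_or_gt t b with htb | htb
    · exact hlast t ⟨ht, htb⟩
    · exact (hret t htb.le).le

end Efficient

end

theorem le_add_mul_sub_of_eq_of_mem_uIcc {f : ℝ → ℝ} {I : Set ℝ} {m s x y : ℝ}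
    (hf : ConcaveOn ℝ I f) (hm : m ∈ I) (hx : x ∈ I) (hy : y ∈ uIcc x m) (hne : y ≠ x)
    (h : f y = f x + s * (y - x)) : f m ≤ f x + s * (m - x) := by
  rw [← segment_eq_uIcc] at hy
  obtain ⟨a, b, ha, hb, hab, rfl⟩ := hy
  obtain rfl : a = 1 - b := by linarith
  have hbpos : 0 < b := hb.lt_of_ne' fun h0 => hne (by simp [h0])
  have hconc := hf.2 hx hm ha hb hab
  rw [h] at hconc
  simp only [smul_eq_mul] at hconc
  exact le_of_mul_le_mul_left (by linarith) hbpos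

section

variable {μ : Measure ℝ} {g h : ℝ → ℝ} {τ : ℝ}

theorem exists_measure_inter_Ioc_pos {A : Set ℝ} {T : ℝ} (hA : 0 < μ (A ∩ Ioi T)) :
    ∃ n, T < n ∧ 0 < μ (A ∩ Ioc T n) := by
  have hU : A ∩ Ioi T = ⋃ n : ℕ, A ∩ Ioc T n := by
    rw [← inter_iUnion]
    congr 1
    ext t
    simpa using fun _ => exists_nat_ge t
  rw [hU] at hA
  obtain ⟨n, hn⟩ := exists_measure_pos_of_not_measure_iUnion_null hA.ne'
  obtain ⟨t, -, ht⟩ := nonempty_of_measure_ne_zero hn.ne'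
  exact ⟨n, ht.1.trans_le ht.2, hn⟩

theorem exists_measure_inter_Ioc_pos_of_pos [IsFiniteMeasure μ] [NullSingletonClass μ] {A : Set ℝ}
    {a b : ℝ} (hab : a < b) (hA : 0 < μ (A ∩ Ioc a b)) :
    ∃ c ∈ Ioo a b, 0 < μ (A ∩ Ioc a c) ∧ 0 < μ (A ∩ Ioc c b) := by
  set g : ℝ → ℝ := fun t => (μ.restrict A).real (Ioi t)
  have hg : ∀ c d, c ≤ d → (0 < μ (A ∩ Ioc c d) ↔ g d < g c) := fun c d hcd => by
    rw [← sub_pos (b := g d), ← measureReal_Ioc_eq_sub hcd, measureReal_def,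
      Measure.restrict_apply measurableSet_Ioc, inter_comm, ENNReal.toReal_pos_iff]
    exact (and_iff_left (measure_lt_top _ _)).symm
  obtain ⟨v, hbv, hva⟩ := exists_between ((hg a b hab.le).1 hA)
  obtain ⟨c, hc, rfl⟩ := intermediate_value_Icc' hab.le
    (continuous_measureReal_Ioi (μ := μ.restrict A)).continuousOn ⟨hbv.le, hva.le⟩
  refine ⟨c, ⟨hc.1.lt_of_ne ?_, hc.2.lt_of_ne ?_⟩, (hg a c hc.1).2 hva, (hg c b hc.2).2 hbv⟩
  · rintro rfl; exact lt_irrefl _ hva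
  · rintro rfl; exact lt_irrefl _ hbv

end

/-- The combination of `g` and `h` whose total value is `0`: it moves value between the supports of
`g` and `h`. -/
noncomputable def balancedShift (μ : Measure ℝ) (g h : ℝ → ℝ) (t : ℝ) : ℝ :=
  (∫ s, h s ∂μ) * g t - (∫ s, g s ∂μ) * h t

section

variable {μ : Measure ℝ} {g h : ℝ → ℝ} {c₀ c c₁ τ : ℝ}

theorem integrable_balancedShift (hg : Integrable g μ) (hh : Integrable h μ) :
    Integrable (balancedShift μ g h) μ :=
  (hg.const_mul _).sub (hh.const_mul _)

theorem measurable_balancedShift (hg : Measurable g) (hh : Measurable h) :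
    Measurable (balancedShift μ g h) :=
  (hg.const_mul _).sub (hh.const_mul _)

theorem tailValue_balancedShift (hg : Integrable g μ) (hh : Integrable h μ) (τ : ℝ) :
    tailValue μ (balancedShift μ g h) τ =
      (∫ t, h t ∂μ) * tailValue μ g τ - (∫ t, g t ∂μ) * tailValue μ h τ := by
  unfold tailValue balancedShift
  rw [integral_sub (hg.const_mul _).integrableOn (hh.const_mul _).integrableOn,
    integral_const_mul, integral_const_mul]

theorem tailValue_balancedShift_of_le (hg : Integrable g μ) (hh : Integrable h μ)
    (hg0 : ∀ t, t ≤ τ → g t = 0) (hh0 : ∀ t, t ≤ τ → h t = 0) :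
    tailValue μ (balancedShift μ g h) τ = 0 := by
  rw [tailValue_balancedShift hg hh, tailValue_eq_integral hg0, tailValue_eq_integral hh0]
  ring

theorem tailValue_balancedShift_of_lt (hg0 : ∀ t, τ < t → g t = 0) (hh0 : ∀ t, τ < t → h t = 0) :
    tailValue μ (balancedShift μ g h) τ = 0 :=
  tailValue_eq_zero fun t ht => by rw [balancedShift, hg0 t ht, hh0 t ht]; ring

theorem tailValue_balancedShift_separator (hg : Integrable g μ) (hh : Integrable h μ)
    (hgc : ∀ t, c < t → g t = 0) (hhc : ∀ t, t ≤ c → h t = 0) :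
    tailValue μ (balancedShift μ g h) c = -((∫ t, g t ∂μ) * ∫ t, h t ∂μ) := by
  rw [tailValue_balancedShift hg hh, tailValue_eq_zero hgc, tailValue_eq_integral hhc]
  ring

theorem tailValue_balancedShift_mem_Icc (hg : Integrable g μ) (hh : Integrable h μ)
    (hg0 : ∀ t, 0 ≤ g t) (hh0 : ∀ t, 0 ≤ h t) (hgc : ∀ t, c < t → g t = 0)
    (hhc : ∀ t, t ≤ c → h t = 0) (τ : ℝ) :
    tailValue μ (balancedShift μ g h) τ ∈ Icc (-((∫ t, g t ∂μ) * ∫ t, h t ∂μ)) 0 := by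
  obtain ⟨hgl, hgu⟩ := tailValue_mem_Icc hg hg0 τ
  obtain ⟨hhl, hhu⟩ := tailValue_mem_Icc hh hh0 τ
  rw [tailValue_balancedShift hg hh]
  rcases le_total τ c with hτ | hτ
  · rw [tailValue_eq_integral fun t ht => hhc t (ht.trans hτ)] at hhl ⊢
    constructor <;> nlinarith
  · rw [tailValue_eq_zero fun t ht => hgc t (hτ.trans_lt ht)] at hgu ⊢
    constructor <;> nlinarith

theorem contValue_balancedShift_eq_zero (hg : Integrable g μ) (hh : Integrable h μ)
    (hgP : ∀ t ∉ Ioc c₀ c, g t = 0) (hhQ : ∀ t ∉ Ioc c c₁, h t = 0) (hc₀ : c₀ ≤ c) (hc₁ : c ≤ c₁)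
    (hτ : τ ≤ c₀ ∨ c₁ ≤ τ) : contValue μ (balancedShift μ g h) τ = 0 := by
  rw [contValue, div_eq_zero_iff]
  rcases hτ with hτ | hτ
  · exact Or.inl (tailValue_balancedShift_of_le hg hh
      (fun t ht => hgP t fun h => h.1.not_ge (ht.trans hτ))
      fun t ht => hhQ t fun h => h.1.not_ge (ht.trans (hτ.trans hc₀)))
  · exact Or.inl (tailValue_balancedShift_of_lt
      (fun t ht => hgP t fun h => h.2.not_gt ((hc₁.trans hτ).trans_lt ht))
      fun t ht => hhQ t fun h => h.2.not_gt (hτ.trans_lt ht))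

theorem add_mul_sub_mem_uIcc {a x m : ℝ} (ha : a ∈ Icc (0 : ℝ) 1) :
    x + a * (m - x) ∈ uIcc x m := by
  rw [← segment_eq_uIcc]
  exact ⟨1 - a, a, sub_nonneg.2 ha.2, ha.1, by ring, by simp only [smul_eq_mul]; ring⟩

theorem add_mul_balancedShift_indicator_mem_uIcc {x : ℝ → ℝ} {m θ : ℝ} {P Q : Set ℝ}
    (hPQ : Disjoint P Q) (hθ : 0 ≤ θ)
    (hP0 : 0 ≤ ∫ t, P.indicator (fun t => m - x t) t ∂μ)
    (hQ0 : 0 ≤ ∫ t, Q.indicator (fun t => x t - m) t ∂μ)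
    (hP1 : θ * ∫ t, P.indicator (fun t => m - x t) t ∂μ ≤ 1)
    (hQ1 : θ * ∫ t, Q.indicator (fun t => x t - m) t ∂μ ≤ 1) (t : ℝ) :
    x t + θ * balancedShift μ (P.indicator fun t => m - x t) (Q.indicator fun t => x t - m) t ∈
      uIcc (x t) m := by
  rw [balancedShift]
  by_cases htP : t ∈ P
  · rw [indicator_of_mem htP, indicator_of_notMem (disjoint_left.1 hPQ htP), mul_zero, sub_zero,
      ← mul_assoc]
    exact add_mul_sub_mem_uIcc ⟨mul_nonneg hθ hQ0, hQ1⟩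
  by_cases htQ : t ∈ Q
  · rw [indicator_of_notMem htP, indicator_of_mem htQ, mul_zero, zero_sub, ← mul_neg, neg_sub,
      ← mul_assoc]
    exact add_mul_sub_mem_uIcc ⟨mul_nonneg hθ hP0, hP1⟩
  · rw [indicator_of_notMem htP, indicator_of_notMem htQ, mul_zero, mul_zero, sub_zero, mul_zero,
      add_zero]
    exact left_mem_uIcc

theorem integral_indicator_pos {A : Set ℝ} (hA : MeasurableSet A) (hμA : 0 < μ A)
    (hg : Integrable g μ) (hpos : ∀ t ∈ A, 0 < g t) : 0 < ∫ t, A.indicator g t ∂μ := by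
  rw [integral_indicator hA, setIntegral_pos_iff_support_of_nonneg_ae
    (ae_restrict_of_forall_mem hA fun t ht => (hpos t ht).le) hg.integrableOn]
  exact hμA.trans_le (measure_mono fun t ht => ⟨(hpos t ht).ne', ht⟩)

end

section

variable {μ : Measure ℝ} [IsDiscountMeasure μ] {x : ℝ → ℝ} {m c₀ c c₁ κ : ℝ} {P Q : Set ℝ}

theorem exists_mul_contValue_balancedShift_mem_Icc {g h : ℝ → ℝ} (hg : Integrable g μ)
    (hh : Integrable h μ) (hg0 : ∀ t, 0 ≤ g t) (hh0 : ∀ t, 0 ≤ h t)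
    (hgP : ∀ t ∉ Ioc c₀ c, g t = 0) (hhQ : ∀ t ∉ Ioc c c₁, h t = 0) (hc₀ : c₀ ≤ c) (hc₁ : c ≤ c₁)
    (hκ : 0 < κ) :
    ∃ θ : ℝ, 0 < θ ∧ θ * ∫ t, g t ∂μ ≤ 1 ∧ θ * ∫ t, h t ∂μ ≤ 1 ∧
      ∀ τ, θ * contValue μ (balancedShift μ g h) τ ∈ Icc (-κ) 0 := by
  set p := ∫ t, g t ∂μ
  set q := ∫ t, h t ∂μ
  have hμ := measureReal_Ioi_pos (μ := μ) c₁
  have hsmall : ∀ r b : ℝ, 0 < b → ∀ᶠ θ in 𝓝[>] (0 : ℝ), θ * r < b := fun r b hb =>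
    nhdsWithin_le_nhds
      (((continuous_mul_const r).tendsto' 0 0 (zero_mul r)).eventually_lt_const hb)
  obtain ⟨θ, ⟨⟨hθp, hθq⟩, hθκ⟩, hθ⟩ := ((((hsmall p 1 one_pos).and (hsmall q 1 one_pos)).and
    (hsmall (p * q) _ (mul_pos hκ hμ))).and self_mem_nhdsWithin).exists
  refine ⟨θ, hθ, hθp.le, hθq.le, fun τ => ?_⟩
  rcases le_or_gt c₁ τ with hτ | hτ
  · rw [contValue_balancedShift_eq_zero hg hh hgP hhQ hc₀ hc₁ (Or.inr hτ), mul_zero]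
    exact ⟨neg_nonpos.2 hκ.le, le_rfl⟩
  have htail := tailValue_balancedShift_mem_Icc hg hh hg0 hh0
    (fun t ht => hgP t fun h => h.2.not_gt ht) (fun t ht => hhQ t fun h => h.1.not_ge ht) τ
  have hmono : μ.real (Ioi c₁) ≤ μ.real (Ioi τ) := measureReal_mono (Ioi_subset_Ioi hτ.le)
  have hτpos := measureReal_Ioi_pos (μ := μ) τ
  rw [contValue, ← mul_div_assoc]
  refine ⟨(le_div_iff₀ hτpos).2 ?_, div_nonpos_of_nonpos_of_nonneg ?_ hτpos.le⟩
  · have := mul_le_mul_of_nonneg_left htail.1 (mem_Ioi.1 hθ).le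
    nlinarith
  · exact mul_nonpos_of_nonneg_of_nonpos (mem_Ioi.1 hθ).le htail.2

theorem contValue_balancedShift_separator_neg {g h : ℝ → ℝ} (hg : Integrable g μ)
    (hh : Integrable h μ) (hgpos : 0 < ∫ t, g t ∂μ) (hhpos : 0 < ∫ t, h t ∂μ)
    (hg0 : ∀ t, c < t → g t = 0) (hh0 : ∀ t, t ≤ c → h t = 0) :
    contValue μ (balancedShift μ g h) c < 0 := by
  rw [contValue, tailValue_balancedShift_separator hg hh hg0 hh0]
  exact div_neg_of_neg_of_pos (neg_lt_zero.2 (mul_pos hgpos hhpos)) (measureReal_Ioi_pos c)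

/-- A flow that is below `m` on `P` and above `m` on the later set `Q` can be advanced a little: its
value is moved from `Q` to `P`, towards the level `m`, within the period from `c₀` to `c₁`. -/
theorem exists_advance (hxm : Measurable x) (hx : Integrable x μ) (hκ : 0 < κ)
    (hP : MeasurableSet P) (hQ : MeasurableSet Q) (hPc : P ⊆ Ioc c₀ c) (hQc : Q ⊆ Ioc c c₁)
    (hP0 : 0 < μ P) (hQ0 : 0 < μ Q) (hPm : ∀ t ∈ P, x t < m) (hQm : ∀ t ∈ Q, m < x t) :
    ∃ y : ℝ → ℝ, Measurable y ∧ (∀ t, y t ∈ uIcc (x t) m) ∧ (∀ t ∈ Q, y t ≠ x t) ∧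
      (∀ τ, contValue μ x τ - contValue μ y τ ∈ Icc 0 κ) ∧
      (∀ τ, τ ≤ c₀ ∨ c₁ ≤ τ → contValue μ y τ = contValue μ x τ) ∧
      contValue μ y c < contValue μ x c := by
  set g : ℝ → ℝ := P.indicator fun t => m - x t
  set h : ℝ → ℝ := Q.indicator fun t => x t - m
  have hxi' : Integrable (fun t => m - x t) μ := (integrable_const m).sub hx
  have hxi'' : Integrable (fun t => x t - m) μ := hx.sub (integrable_const m)
  have hgi : Integrable g μ := hxi'.indicator hP
  have hhi : Integrable h μ := hxi''.indicator hQ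
  have hgc : ∀ t ∉ Ioc c₀ c, g t = 0 := fun t ht => indicator_of_notMem (fun h => ht (hPc h)) _
  have hhc : ∀ t ∉ Ioc c c₁, h t = 0 := fun t ht => indicator_of_notMem (fun h => ht (hQc h)) _
  have hgpos := integral_indicator_pos hP hP0 hxi' fun t ht => sub_pos.2 (hPm t ht)
  have hhpos := integral_indicator_pos hQ hQ0 hxi'' fun t ht => sub_pos.2 (hQm t ht)
  obtain ⟨p, hp⟩ := nonempty_of_measure_ne_zero hP0.ne'
  obtain ⟨q, hq⟩ := nonempty_of_measure_ne_zero hQ0.ne'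
  have hc₀ : c₀ ≤ c := (hPc hp).1.le.trans (hPc hp).2
  have hc₁ : c ≤ c₁ := (hQc hq).1.le.trans (hQc hq).2
  obtain ⟨θ, hθ, hθg, hθh, hθκ⟩ := exists_mul_contValue_balancedShift_mem_Icc hgi hhi
    (indicator_nonneg fun t ht => sub_nonneg.2 (hPm t ht).le)
    (indicator_nonneg fun t ht => sub_nonneg.2 (hQm t ht).le) hgc hhc hc₀ hc₁ hκ
  have hcont := contValue_add_const_mul hx (integrable_balancedShift hgi hhi) θ
  have hyQ : ∀ t ∈ Q, x t + θ * balancedShift μ g h t =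
      x t + θ * (∫ s, g s ∂μ) * (m - x t) := fun t ht => by
    rw [balancedShift, hgc t fun h => h.2.not_gt (hQc ht).1, show h t = x t - m from
      indicator_of_mem ht _]
    ring
  refine ⟨fun t => x t + θ * balancedShift μ g h t,
    hxm.add ((measurable_balancedShift ((measurable_const.sub hxm).indicator hP)
      ((hxm.sub measurable_const).indicator hQ)).const_mul θ), fun t => ?_, fun t ht => ?_,
    fun τ => ?_, fun τ hτ => ?_, ?_⟩
  · exact add_mul_balancedShift_indicator_mem_uIcc (disjoint_left.2 fun s hsP hsQ =>
      (hPc hsP).2.not_gt (hQc hsQ).1) hθ.le hgpos.le hhpos.le hθg hθh t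
  · refine (hyQ t ht).trans_ne ?_
    exact fun heq => (mul_pos (mul_pos hθ hgpos) (sub_pos.2 (hQm t ht))).ne' (by linarith)
  · have := hθκ τ
    rw [hcont, mem_Icc]
    constructor <;> linarith [this.1, this.2]
  · rw [hcont, contValue_balancedShift_eq_zero hgi hhi hgc hhc hc₀ hc₁ hτ, mul_zero, add_zero]
  · rw [hcont]
    exact add_lt_of_neg_right _ (mul_neg_of_pos_of_neg hθ (contValue_balancedShift_separator_neg hgi
      hhi hgpos hhpos (fun t ht => hgc t fun h => h.2.not_gt ht)
      fun t ht => hhc t fun h => h.1.not_ge ht))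

/-- The counterpart of `exists_advance` in which value is moved from `P` to the later set `Q`. -/
theorem exists_delay (hxm : Measurable x) (hx : Integrable x μ) (hκ : 0 < κ)
    (hP : MeasurableSet P) (hQ : MeasurableSet Q) (hPc : P ⊆ Ioc c₀ c) (hQc : Q ⊆ Ioc c c₁)
    (hP0 : 0 < μ P) (hQ0 : 0 < μ Q) (hPm : ∀ t ∈ P, m < x t) (hQm : ∀ t ∈ Q, x t < m) :
    ∃ y : ℝ → ℝ, Measurable y ∧ (∀ t, y t ∈ uIcc (x t) m) ∧ (∀ t ∈ Q, y t ≠ x t) ∧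
      (∀ τ, contValue μ y τ - contValue μ x τ ∈ Icc 0 κ) ∧
      ∀ τ, τ ≤ c₀ ∨ c₁ ≤ τ → contValue μ y τ = contValue μ x τ := by
  obtain ⟨y, hym, hy, hyQ, hyκ, hyout, -⟩ := exists_advance (μ := μ) (m := -m) hxm.neg hx.neg hκ
    hP hQ hPc hQc hP0 hQ0 (fun t ht => neg_lt_neg (hPm t ht)) fun t ht => neg_lt_neg (hQm t ht)
  refine ⟨fun t => -y t, hym.neg, fun t => ?_, fun t ht h => hyQ t ht (neg_eq_iff_eq_neg.1 h),
    fun τ => ?_, fun τ hτ => ?_⟩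
  · have := hy t
    rw [Pi.neg_apply, mem_uIcc] at this
    rw [mem_uIcc]
    rcases this with h | h
    · exact Or.inr ⟨le_neg_of_le_neg h.2, neg_le_of_neg_le h.1⟩
    · exact Or.inl ⟨le_neg_of_le_neg h.2, neg_le_of_neg_le h.1⟩
  · have := hyκ τ
    rw [contValue_neg]
    rwa [show contValue μ (-x) τ = _ from contValue_neg x τ, neg_sub_comm] at this
  · rw [contValue_neg, hyout τ hτ, show contValue μ (-x) τ = _ from contValue_neg x τ, neg_neg]

theorem ae_eq_of_contValue_eq {l u a b : ℝ} (hxm : Measurable x) (hxI : ∀ t, x t ∈ Icc l u)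
    (hX : AntitoneOn (contValue μ x) (Ici 0)) (ha : 0 ≤ a) (hab : a ≤ b)
    (h : contValue μ x b = contValue μ x a) : ∀ᵐ t ∂μ, t ∈ Ioc a b → x t = contValue μ x a := by
  have hx : Integrable x μ := integrable_of_forall_mem_Icc hxm hxI
  have hle : (fun _ => contValue μ x a) ≤ᵐ[μ.restrict (Ioc a b)] x := by
    rw [Filter.EventuallyLE, ae_restrict_iff' measurableSet_Ioc]
    filter_upwards [contValue_le_ae_of_antitoneOn hxm hxI hX] with t ht htab
    exact h.ge.trans ((hX (ha.trans htab.1.le) (ha.trans hab) htab.2).trans ht)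
  have hint : ∫ _ in Ioc a b, contValue μ x a ∂μ = ∫ t in Ioc a b, x t ∂μ := by
    rw [setIntegral_const, measureReal_Ioc_eq_sub hab, ← tailValue_sub_tailValue hx hab,
      ← measureReal_Ioi_mul_contValue a, ← measureReal_Ioi_mul_contValue b, h, smul_eq_mul, sub_mul]
  have heq := (integral_eq_iff_of_ae_le (integrable_const _) hx.integrableOn hle).1 hint
  exact ((ae_restrict_iff' measurableSet_Ioc).1 heq).mono fun t ht htab => (ht htab).symm

theorem contValue_lt_of_measure_pos {l u a b : ℝ} (hxm : Measurable x) (hxI : ∀ t, x t ∈ Icc l u)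
    (hX : AntitoneOn (contValue μ x) (Ici 0)) (ha : 0 ≤ a) (hab : a ≤ b) {A : Set ℝ}
    (hA : 0 < μ (A ∩ Ioc a b)) (hne : ∀ t ∈ A, x t ≠ contValue μ x a) :
    contValue μ x b < contValue μ x a := by
  refine (hX ha (ha.trans hab) hab).lt_of_ne fun heq => hA.ne' (measure_mono_null ?_
    (ae_iff.1 (ae_eq_of_contValue_eq hxm hxI hX ha hab heq)))
  exact fun t ht hxt => hne t ht.1 (hxt ht.2)

theorem measure_le_contValue_pos (hx : Integrable x μ) (n : ℝ) :
    0 < μ ({t | x t ≤ contValue μ x n} ∩ Ioi n) := by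
  have h := measure_le_setAverage_pos (f := x)
    ((measureReal_ne_zero_iff (measure_ne_top μ _)).1 (measureReal_Ioi_pos (μ := μ) n).ne')
    (measure_ne_top μ (Ioi n)) hx.integrableOn
  rw [setAverage_eq, smul_eq_mul, ← div_eq_inv_mul] at h
  exact h.trans_le (measure_mono fun t ht => ⟨ht.2, ht.1⟩)

end

section

variable {μ : Measure ℝ} {f₀ f₁ : ℝ → ℝ} {I₀ I₁ : Set ℝ} {u₀ u₁ us w v m p q s η T T₀ : ℝ}
  {x y : ℝ → ℝ}

namespace IsFrontierPair

theorem not_supergradOn_old (hF : IsFrontierPair f₀ f₁ I₀ I₁ u₀ u₁ us) (hw : us < w) (hwu : w < u₀)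
    (hη : SupergradOn f₁ I₁ w η) (hsη : s ≤ η) : ¬ SupergradOn f₀ I₀ w s :=
  fun h => hsη.not_gt (hF.lt_of_supergradOn _ s η hw hwu h hη)

theorem lt_of_supergradOn_le (hF : IsFrontierPair f₀ f₁ I₀ I₁ u₀ u₁ us) (hw : us < w)
    (hwu : w < u₀) (hη : SupergradOn f₁ I₁ w η) (hv : v ∈ I₀) (hs : SupergradOn f₀ I₀ v s)
    (hsη : s ≤ η) : w < v := by
  have hw0 := hF.us_nonneg.trans_lt hw
  refine lt_of_not_ge fun hvw => ?_
  obtain h | h := hvw.eq_or_lt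
  · exact hF.not_supergradOn_old hw hwu hη hsη (h ▸ hs)
  obtain ⟨s', hs'⟩ := hF.exists_supergradOn_old hw0 hwu
  have hss' : s < s' := hsη.trans_lt (hF.lt_of_supergradOn _ s' η hw hwu hs' hη)
  nlinarith [hs' v hv, hs _ (hF.mem_old hw0 hwu.le)]

/-- A loss-free move from `y` towards `v` would extend the line of slope `s` supporting the old
frontier at `v` down to `y`, hence past `w`. -/
theorem ne_add_mul_sub_of_mem_uIcc (hF : IsFrontierPair f₀ f₁ I₀ I₁ u₀ u₁ us) (hw : us < w)
    (hwu : w < u₀) (hη : SupergradOn f₁ I₁ w η) (hv : v ∈ I₀) (hs : SupergradOn f₀ I₀ v s)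
    (hsη : s ≤ η) {y z : ℝ} (hy : y ∈ I₀) (hyw : y ≤ w) (hz : z ∈ uIcc y v) (hne : z ≠ y) :
    f₀ z ≠ f₀ y + s * (z - y) := by
  intro heq
  have hwv := hF.lt_of_supergradOn_le hw hwu hη hv hs hsη
  have h₁ := le_add_mul_sub_of_eq_of_mem_uIcc hF.concaveOn_old hv hy hz hne heq
  have h₂ := hs.add_mul_sub_le hF.concaveOn_old hv hy (mem_uIcc.2 (Or.inl ⟨hyw, hwv.le⟩))
  refine hF.not_supergradOn_old hw hwu hη hsη fun a ha => ?_
  linarith [hs a ha]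

end IsFrontierPair

namespace Efficient

variable [IsDiscountMeasure μ]

/-- Where the new frontier is at least as steep at the continuation value as the old one is at `v`,
delaying the flow, from times when it exceeds `v` to later times when it is low, would be
profitable. -/
theorem measure_lt_inter_Ioi_eq_zero (hF : IsFrontierPair f₀ f₁ I₀ I₁ u₀ u₁ us)
    (hE : Efficient μ f₀ f₁ I₀ u₀ x) (hT : 0 ≤ T) (hTs : us < contValue μ x T)
    (hTu : contValue μ x T < u₀) (hη : SupergradOn f₁ I₁ (contValue μ x T) η) (hv : v ∈ I₀)
    (hs : SupergradOn f₀ I₀ v s) (hsη : s ≤ η) : μ ({t | v < x t} ∩ Ioi T) = 0 := by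
  have hx := hE.admissible
  have hxi := hx.integrable
  have hX := hE.antitoneOn_contValue hF
  have hTv := hF.lt_of_supergradOn_le hTs hTu hη hv hs hsη
  by_contra hne
  obtain ⟨n, hTn, hn⟩ := exists_measure_inter_Ioc_pos (pos_iff_ne_zero.2 hne)
  obtain ⟨t₁, ⟨hTt, -⟩, hA₁, hA₂⟩ := exists_measure_inter_Ioc_pos_of_pos hTn hn
  obtain ⟨c, -, hB⟩ := exists_measure_inter_Ioc_pos (measure_le_contValue_pos hxi n)
  have ht₁ : 0 ≤ t₁ := hT.trans hTt.le
  have hlt : contValue μ x t₁ < contValue μ x T := contValue_lt_of_measure_pos hx.measurable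
    hx.mem_Icc hX hT hTt.le hA₁ fun t ht => (hTv.trans ht).ne'
  have hnT : contValue μ x n ≤ contValue μ x T := hX hT (hT.trans hTn.le) hTn.le
  obtain ⟨y, hym, hy, hyne, hyκ, hyout⟩ := exists_delay hx.measurable hxi (sub_pos.2 hlt)
    ((measurableSet_lt measurable_const hx.measurable).inter measurableSet_Ioc)
    ((measurableSet_le hx.measurable measurable_const).inter measurableSet_Ioc)
    inter_subset_right inter_subset_right hA₂ hB (fun t ht => ht.1)
    (fun t ht => (ht.1.trans hnT).trans_lt hTv)
  have hxy : ∫ t, y t ∂μ = ∫ t, x t ∂μ := by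
    rw [integral_eq_contValue_zero, integral_eq_contValue_zero, hyout 0 (Or.inl ht₁)]
  have hreward : ∀ τ, 0 ≤ τ → f₁ (contValue μ x τ) ≤
      f₁ (contValue μ y τ) + s * (contValue μ x τ - contValue μ y τ) := fun τ hτ => by
    by_cases hτout : τ ≤ t₁ ∨ c ≤ τ
    · simp only [hyout τ hτout, sub_self, mul_zero, add_zero, le_refl]
    push Not at hτout
    have hτt := hX ht₁ hτ hτout.1.le
    have hslope := hη.mul_sub_le_sub hF.concaveOn_new
      (hF.mem_new (hF.us_nonneg.trans_lt hTs) hTu.le) (hx.contValue_mem_new hF τ)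
      (v := contValue μ y τ) (by linarith [(hyκ τ).1]) (by linarith [(hyκ τ).2])
    linarith [mul_le_mul_of_nonneg_right hsη (hyκ τ).1]
  have heq := (hE.eq_of_mem_uIcc hF hv hs hym hy hxy hreward).2
  refine hB.ne' (measure_mono_null ?_ (ae_iff.1 (hx.ae_mem.and heq)))
  exact fun t ht h => hF.ne_add_mul_sub_of_mem_uIcc hTs hTu hη hv hs hsη h.1 (ht.1.trans hnT)
    (hy t) (hyne t ht) h.2

theorem contValue_le_of_measure_pos (hF : IsFrontierPair f₀ f₁ I₀ I₁ u₀ u₁ us)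
    (hE : Efficient μ f₀ f₁ I₀ u₀ x) (hT : T₀ ≤ T) (hA : 0 < μ ({t | x t ≤ p} ∩ Ioc 0 T₀)) :
    contValue μ x T ≤ p := by
  have hx := hE.admissible
  have hX := hE.antitoneOn_contValue hF
  by_contra! hpT
  refine hA.ne' (measure_mono_null ?_
    (ae_iff.1 (contValue_le_ae_of_antitoneOn hx.measurable hx.mem_Icc hX)))
  intro t ht h
  have htT : t ≤ T := ht.2.2.trans hT
  exact (hpT.trans_le ((hX ht.2.1.le (ht.2.1.le.trans htT) htT).trans h)).not_ge ht.1

theorem us_lt_contValue_of_measure_pos (hF : IsFrontierPair f₀ f₁ I₀ I₁ u₀ u₁ us)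
    (hE : Efficient μ f₀ f₁ I₀ u₀ x) {n : ℝ} (hT : 0 ≤ T) (hTn : T ≤ n)
    (hq : contValue μ x T < q) (hA : 0 < μ ({t | q ≤ x t} ∩ Ioc T n)) : us < contValue μ x T := by
  have hx := hE.admissible
  refine (hE.us_le_contValue hF hT).lt_of_ne fun h => ?_
  have hlt := contValue_lt_of_measure_pos hx.measurable hx.mem_Icc (hE.antitoneOn_contValue hF)
    hT hTn hA fun t ht => (hq.trans_le ht).ne'
  exact (hlt.trans_eq h.symm).ne (hE.contValue_eq_us hF hT h.symm hTn)

/-- If the flow rose across `m`, where the old frontier is steeper than the new one is at the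
continuation value, advancing the flow towards `m` would be strictly profitable. -/
theorem false_of_measure_lt_of_measure_gt (hF : IsFrontierPair f₀ f₁ I₀ I₁ u₀ u₁ us)
    (hE : Efficient μ f₀ f₁ I₀ u₀ x) (hT₀ : 0 ≤ T₀) {c : ℝ} (hT₀c : T₀ < c)
    (hcT : contValue μ x T < contValue μ x c) (hT : contValue μ x T ∈ I₁)
    (hη : SupergradOn f₁ I₁ (contValue μ x T) η) (hm : m ∈ I₀) (hs : SupergradOn f₀ I₀ m s)
    (hηs : η < s) (hA : 0 < μ ({t | x t < m} ∩ Ioc 0 T₀)) (hB : 0 < μ ({t | m < x t} ∩ Ioc T₀ c)) :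
    False := by
  have hx := hE.admissible
  have hX := hE.antitoneOn_contValue hF
  obtain ⟨y, hym, hy, -, hyκ, hyout, hyT₀⟩ := exists_advance hx.measurable hx.integrable
    (sub_pos.2 hcT) ((measurableSet_lt hx.measurable measurable_const).inter measurableSet_Ioc)
    ((measurableSet_lt measurable_const hx.measurable).inter measurableSet_Ioc)
    inter_subset_right inter_subset_right hA hB (fun t ht => ht.1) (fun t ht => ht.1)
  have hxy : ∫ t, y t ∂μ = ∫ t, x t ∂μ := by
    rw [integral_eq_contValue_zero, integral_eq_contValue_zero, hyout 0 (Or.inl le_rfl)]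
  have hreward : ∀ τ, 0 ≤ τ → τ < c → f₁ (contValue μ x τ) ≤
      f₁ (contValue μ y τ) + η * (contValue μ x τ - contValue μ y τ) := fun τ hτ hτc => by
    have hcτ := hX hτ (hT₀.trans hT₀c.le) hτc.le
    linarith [hη.sub_le_mul_sub hF.concaveOn_new hT (hx.contValue_mem_new hF τ)
      (u := contValue μ y τ) (by linarith [(hyκ τ).2]) (by linarith [(hyκ τ).1])]
  have heq := (hE.eq_of_mem_uIcc hF hm hs hym hy hxy fun τ hτ => by
    by_cases hτc : c ≤ τ
    · simp only [hyout τ (Or.inr hτc), sub_self, mul_zero, add_zero, le_refl]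
    linarith [hreward τ hτ (not_le.1 hτc), mul_le_mul_of_nonneg_right hηs.le (hyκ τ).1]).1 T₀ hT₀
  nlinarith [hreward T₀ hT₀ hT₀c]

theorem measure_le_inter_Ioi_eq_zero (hF : IsFrontierPair f₀ f₁ I₀ I₁ u₀ u₁ us)
    (hE : Efficient μ f₀ f₁ I₀ u₀ x) (hT₀ : 0 ≤ T₀) (hpq : p < q)
    (hA : 0 < μ ({t | x t ≤ p} ∩ Ioc 0 T₀)) : μ ({t | q ≤ x t} ∩ Ioi T₀) = 0 := by
  have hx := hE.admissible
  by_contra hne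
  obtain ⟨n, hT₀n, hn⟩ := exists_measure_inter_Ioc_pos (pos_iff_ne_zero.2 hne)
  obtain ⟨T, ⟨hT₀T, hTn⟩, hB₁, hB₂⟩ := exists_measure_inter_Ioc_pos_of_pos hT₀n hn
  obtain ⟨c, ⟨hT₀c, hcT⟩, hB₃, hB₄⟩ := exists_measure_inter_Ioc_pos_of_pos hT₀T hB₁
  have hT : 0 ≤ T := hT₀.trans hT₀T.le
  have hcq : contValue μ x c < q := (hE.contValue_le_of_measure_pos hF hT₀c.le hA).trans_lt hpq
  have hTp : contValue μ x T ≤ p := hE.contValue_le_of_measure_pos hF hT₀T.le hA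
  have hTs := hE.us_lt_contValue_of_measure_pos hF hT hTn.le (hTp.trans_lt hpq) hB₂
  have hlt : contValue μ x T < contValue μ x c := contValue_lt_of_measure_pos hx.measurable
    hx.mem_Icc (hE.antitoneOn_contValue hF) (hT₀.trans hT₀c.le) hcT.le hB₄
    fun t ht => (hcq.trans_le ht).ne'
  obtain ⟨m, hpm, hmq⟩ := exists_between hpq
  have hT0 : 0 < contValue μ x T := hF.us_nonneg.trans_lt hTs
  have hmu : m < u₀ := by
    obtain ⟨t, ht⟩ := nonempty_of_measure_ne_zero hB₁.ne'
    exact hmq.trans_le (le_trans ht.1 (hx.le t))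
  have hm0 : 0 < m := hT0.trans_le (hTp.trans hpm.le)
  have hTu : contValue μ x T < u₀ := hTp.trans_lt (hpm.trans hmu)
  obtain ⟨s, hs⟩ := hF.exists_supergradOn_old hm0 hmu
  obtain ⟨η, hη⟩ := hF.exists_supergradOn_new hT0 hTu
  have hm := hF.mem_old hm0 hmu.le
  have hηs : η < s := lt_of_not_ge fun hsη => hB₂.ne' <| measure_mono_null
    (inter_subset_inter (fun t ht => hmq.trans_le ht) Ioc_subset_Ioi_self)
    (hE.measure_lt_inter_Ioi_eq_zero hF hT hTs hTu hη hm hs hsη)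
  exact hE.false_of_measure_lt_of_measure_gt hF hT₀ hT₀c hlt (hF.mem_new hT0 hTu.le) hη hm hs hηs
    (hA.trans_le (measure_mono (inter_subset_inter_left _ fun t ht => hpm.trans_le' ht)))
    (hB₃.trans_le (measure_mono (inter_subset_inter_left _ fun t ht => hmq.trans_le ht)))

end Efficient

end

theorem exists_antitoneOn_of_measure_eq_zero {μ : Measure ℝ} {x : ℝ → ℝ}
    (hpos : ∀ᵐ t ∂μ, 0 < t)
    (h : ∀ p q T, 0 ≤ T → p < q → 0 < μ ({t | x t ≤ p} ∩ Ioc 0 T) →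
      μ ({t | q ≤ x t} ∩ Ioi T) = 0) : ∃ N : Set ℝ, (∀ᵐ t ∂μ, t ∈ N) ∧ AntitoneOn x N := by
  have hsep : ∀ p q T : ℚ, 0 ≤ T → p < q →
      (∀ᵐ t ∂μ, t ∈ Ioc (0 : ℝ) T → p < x t) ∨ ∀ᵐ t ∂μ, (T : ℝ) < t → x t < q := by
    intro p q T hT hpq
    by_cases hA : μ ({t | x t ≤ p} ∩ Ioc 0 (T : ℝ)) = 0
    · exact Or.inl ((measure_eq_zero_iff_ae_notMem.1 hA).mono fun t ht htT =>
        not_le.1 fun hp => ht ⟨hp, htT⟩)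
    · have hB := h p q T (by exact_mod_cast hT) (by exact_mod_cast hpq) (pos_iff_ne_zero.2 hA)
      exact Or.inr ((measure_eq_zero_iff_ae_notMem.1 hB).mono fun t ht htT =>
        not_le.1 fun hq => ht ⟨hq, htT⟩)
  let N : Set ℝ := {t | 0 < t ∧
    (∀ p T : ℚ, (∀ᵐ s ∂μ, s ∈ Ioc (0 : ℝ) T → p < x s) → t ∈ Ioc (0 : ℝ) T → p < x t) ∧
    ∀ q T : ℚ, (∀ᵐ s ∂μ, (T : ℝ) < s → x s < q) → (T : ℝ) < t → x t < q}
  have hN : ∀ᵐ t ∂μ, t ∈ N :=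
    hpos.and ((ae_all_iff.2 fun p => ae_all_iff.2 fun T => eventually_imp_distrib_left.2 id).and
      (ae_all_iff.2 fun q => ae_all_iff.2 fun T => eventually_imp_distrib_left.2 id))
  refine ⟨N, hN, fun a ha b hb hab => le_of_not_gt fun hlt => ?_⟩
  obtain ⟨p, hap, hpb⟩ := exists_rat_btwn hlt
  obtain ⟨q, hpq, hqb⟩ := exists_rat_btwn hpb
  obtain ⟨T, haT, hTb⟩ := exists_rat_btwn (hab.lt_of_ne fun h => hlt.ne (congrArg x h))
  have hT : (0 : ℚ) ≤ T := by exact_mod_cast (ha.1.trans haT).le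
  rcases hsep p q T hT (by exact_mod_cast hpq) with hA | hB
  · exact hap.not_gt (ha.2.1 p T hA ⟨ha.1, haT.le⟩)
  · exact hqb.not_gt (hb.2.2 q T hB hTb)

theorem exists_antitone_ae_eq {μ : Measure ℝ} {x : ℝ → ℝ} {l u : ℝ} (hx : ∀ t, x t ∈ Icc l u)
    {N : Set ℝ} (hN : ∀ᵐ t ∂μ, t ∈ N) (h : AntitoneOn x N) :
    ∃ z : ℝ → ℝ, Antitone z ∧ (∀ t, z t ∈ Icc l u) ∧ z =ᵐ[μ] x := by
  have hlu : l ≤ u := (hx 0).1.trans (hx 0).2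
  obtain ⟨g, hg, hgx⟩ := h.exists_antitone_extension
    ⟨l, forall_mem_image.2 fun t _ => (hx t).1⟩ ⟨u, forall_mem_image.2 fun t _ => (hx t).2⟩
  refine ⟨fun t => projIcc l u hlu (g t), fun a b hab => monotone_projIcc hlu (hg hab),
    fun t => (projIcc l u hlu (g t)).2, hN.mono fun t ht => ?_⟩
  simp only [← hgx ht, projIcc_of_mem hlu (hx t)]

/-- An admissible flow is mean-efficient for the law `G` of the breakthrough if no other one raises
the disclosure value, at every time, by at least a function with positive `G`-mean. -/
structure MeanEfficient (μ G : Measure ℝ) (f₀ f₁ : ℝ → ℝ) (I₀ : Set ℝ) (u₀ : ℝ) (x : ℝ → ℝ) :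
    Prop where
  admissible : Admissible μ f₀ I₀ u₀ x
  integral_nonpos : ∀ y, Admissible μ f₀ I₀ u₀ y → ∀ k : ℝ → ℝ, Integrable k G →
    (∀ τ, 0 ≤ τ → disclosureValue μ f₀ f₁ x τ + k τ ≤ disclosureValue μ f₀ f₁ y τ) →
    ∫ τ, k τ ∂G ≤ 0

namespace SupergradOn

variable {f : ℝ → ℝ} {I : Set ℝ} {l m s₀ s σ v : ℝ}

theorem le_of_lt (hs₀ : SupergradOn f I l s₀) (hs : SupergradOn f I m s) (hl : l ∈ I) (hm : m ∈ I)
    (hlm : l < m) : s ≤ s₀ := by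
  nlinarith [hs₀ m hm, hs l hl]

theorem le_add_mul_sub_of_eventually {F : Filter ℝ} [F.NeBot] (hF : F ≤ 𝓝 l)
    (hs₀ : SupergradOn f I l s₀) (hv : v ∈ I)
    (h : ∀ᶠ m in F, m ∈ I ∧ ∃ s, SupergradOn f I m s ∧ s * (v - m) ≤ σ * (v - m)) :
    f v ≤ f l + σ * (v - l) := by
  have hlim : Tendsto (fun m => f l + s₀ * (m - l) + σ * (v - m)) F
      (𝓝 (f l + s₀ * (l - l) + σ * (v - l))) := (Continuous.tendsto (by fun_prop) l).mono_left hF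
  rw [sub_self, mul_zero, add_zero] at hlim
  refine ge_of_tendsto hlim (h.mono ?_)
  rintro m ⟨hm, s, hs, hsσ⟩
  linarith [hs v hv, hs₀ m hm]

theorem of_eventually_gt (hs₀ : SupergradOn f I l s₀) (hσ : σ ≤ s₀)
    (h : ∀ᶠ m in 𝓝[>] l, m ∈ I ∧ ∃ s ≤ σ, SupergradOn f I m s) : SupergradOn f I l σ := by
  intro v hv
  rcases le_or_gt v l with hvl | hlv
  · nlinarith [hs₀ v hv]
  · refine le_add_mul_sub_of_eventually (F := 𝓝[>] l) nhdsWithin_le_nhds hs₀ hv ?_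
    filter_upwards [h, Ioo_mem_nhdsGT hlv] with m ⟨hm, s, hsσ, hs⟩ hmv
    exact ⟨hm, s, hs, mul_le_mul_of_nonneg_right hsσ (sub_nonneg.2 hmv.2.le)⟩

theorem of_eventually_lt (hs₀ : SupergradOn f I l s₀) (hσ : s₀ ≤ σ)
    (h : ∀ᶠ m in 𝓝[<] l, m ∈ I ∧ ∃ s ≥ σ, SupergradOn f I m s) : SupergradOn f I l σ := by
  intro v hv
  rcases le_or_gt l v with hlv | hvl
  · nlinarith [hs₀ v hv]
  · refine le_add_mul_sub_of_eventually (F := 𝓝[<] l) nhdsWithin_le_nhds hs₀ hv ?_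
    filter_upwards [h, Ioo_mem_nhdsLT hvl] with m ⟨hm, s, hsσ, hs⟩ hmv
    exact ⟨hm, s, hs, mul_le_mul_of_nonpos_right hsσ (sub_nonpos.2 hmv.1.le)⟩

end SupergradOn

section

variable {μ G : Measure ℝ} {f₀ f₁ : ℝ → ℝ} {I₀ I₁ : Set ℝ} {u₀ u₁ us l m v s s₁ η c S T τ : ℝ}
  {x y : ℝ → ℝ}

/-- The strict inequality between the slopes at `l` survives moving apart the two points at which
they are taken: otherwise the right derivative of the old frontier would be a supergradient of the
new frontier at `l`. -/
theorem IsFrontierPair.exists_supergradOn_lt (hF : IsFrontierPair f₀ f₁ I₀ I₁ u₀ u₁ us)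
    (hl : us < l) (hlu : l < u₀) : ∃ l' ∈ Ioo 0 l, ∃ m ∈ Ioo l u₀, ∃ η s,
      SupergradOn f₁ I₁ l' η ∧ SupergradOn f₀ I₀ m s ∧ η < s := by
  by_contra! hc
  have hl0 : 0 < l := hF.us_nonneg.trans_lt hl
  obtain ⟨s₀, hs₀⟩ := hF.exists_supergradOn_old hl0 hlu
  obtain ⟨η₀, hη₀⟩ := hF.exists_supergradOn_new hl0 hlu
  set A : Set ℝ := {s | ∃ m ∈ Ioo l u₀, SupergradOn f₀ I₀ m s}
  have hA : ∀ m ∈ Ioo l u₀, ∃ s ∈ A, SupergradOn f₀ I₀ m s := fun m hm =>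
    let ⟨s, hs⟩ := hF.exists_supergradOn_old (hl0.trans hm.1) hm.2
    ⟨s, ⟨m, hm, hs⟩, hs⟩
  have hne : A.Nonempty := let ⟨m, hm⟩ := exists_between hlu; let ⟨s, hs, _⟩ := hA m hm; ⟨s, hs⟩
  have hs₀A : ∀ s ∈ A, s ≤ s₀ := fun s ⟨m, hm, hs⟩ =>
    hs₀.le_of_lt hs (hF.mem_old hl0 hlu.le) (hF.mem_old (hl0.trans hm.1) hm.2.le) hm.1
  have hold : SupergradOn f₀ I₀ l (sSup A) := hs₀.of_eventually_gt (csSup_le hne hs₀A) <| by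
    filter_upwards [Ioo_mem_nhdsGT hlu] with m hm
    obtain ⟨s, hsA, hs⟩ := hA m hm
    exact ⟨hF.mem_old (hl0.trans hm.1) hm.2.le, s, le_csSup ⟨s₀, hs₀A⟩ hsA, hs⟩
  have hlt : η₀ < sSup A := hF.lt_of_supergradOn l _ _ hl hlu hold hη₀
  have hnew : SupergradOn f₁ I₁ l (sSup A) := hη₀.of_eventually_lt hlt.le <| by
    filter_upwards [Ioo_mem_nhdsLT hl0] with l' hl'
    obtain ⟨η, hη⟩ := hF.exists_supergradOn_new hl'.1 (hl'.2.trans hlu)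
    refine ⟨hF.mem_new hl'.1 (hl'.2.trans hlu).le, η, csSup_le hne ?_, hη⟩
    rintro s ⟨m, hm, hs⟩
    exact hc l' hl' m hm η s hη hs
  exact lt_irrefl _ (hF.lt_of_supergradOn l _ _ hl hlu hold hnew)

theorem Admissible.disclosureValue_add_le [IsDiscountMeasure μ] (hx : Admissible μ f₀ I₀ u₀ x)
    (hy : Admissible μ f₀ I₀ u₀ y) {z : ℝ → ℝ} (hz : Integrable z μ)
    (h : ∀ᵐ t ∂μ, f₀ (x t) + z t ≤ f₀ (y t))
    (hη : f₁ (contValue μ x τ) + η * (contValue μ y τ - contValue μ x τ) ≤ f₁ (contValue μ y τ)) :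
    disclosureValue μ f₀ f₁ x τ +
        ((∫ t in Iic τ, z t ∂μ) + η * (tailValue μ y τ - tailValue μ x τ)) ≤
      disclosureValue μ f₀ f₁ y τ := by
  have hflow := hx.setIntegral_add_le hy hz h τ
  have hreward := mul_le_mul_of_nonneg_left hη (measureReal_Ioi_pos (μ := μ) τ).le
  unfold disclosureValue
  rw [← measureReal_Ioi_mul_contValue, ← measureReal_Ioi_mul_contValue]
  linarith

/-- Moving the flow towards `m` gains `s` per unit before disclosure; if afterwards the flow only
increases, its continuation value stays below `m`, where the reward has slope at least `η`. -/
theorem Admissible.disclosureValue_add_le_of_mem_uIcc [IsDiscountMeasure μ]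
    (hF : IsFrontierPair f₀ f₁ I₀ I₁ u₀ u₁ us) (hx : Admissible μ f₀ I₀ u₀ x) (hm0 : 0 < m)
    (hmu : m < u₀) (hs : SupergradOn f₀ I₀ m s) (hη : SupergradOn f₁ I₁ m η)
    (hy : Admissible μ f₀ I₀ u₀ y) (hyx : ∀ t, y t ∈ uIcc (x t) m)
    (hτ : ∀ t, τ < t → x t ≤ y t ∧ y t ≤ m) :
    disclosureValue μ f₀ f₁ x τ + (s * (∫ t in Iic τ, (y t - x t) ∂μ) +
        η * (tailValue μ y τ - tailValue μ x τ)) ≤ disclosureValue μ f₀ f₁ y τ := by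
  have hxy : contValue μ x τ ≤ contValue μ y τ :=
    contValue_mono_of_ae hx.integrable hy.integrable (ae_of_all _ fun t ht => (hτ t ht).1)
  have hym : contValue μ y τ ≤ contValue μ (fun _ => m) τ :=
    contValue_mono_of_ae hy.integrable (integrable_const m) (ae_of_all _ fun t ht => (hτ t ht).2)
  rw [contValue_const] at hym
  have hslope := hη.mul_sub_le_sub hF.concaveOn_new (hF.mem_new hm0 hmu.le)
    (hx.contValue_mem_new hF τ) hxy hym
  rw [← integral_const_mul]
  exact hx.disclosureValue_add_le hy ((hy.integrable.sub hx.integrable).const_mul s)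
    ((hx.ae_add_mul_sub_le hF (hF.mem_old hm0 hmu.le) hs hyx).mono fun t ht => ht.2)
    (by linarith)

namespace MeanEfficient

theorem mul_measureReal_le [IsFiniteMeasure G] (hO : MeanEfficient μ G f₀ f₁ I₀ u₀ x)
    (hy : Admissible μ f₀ I₀ u₀ y) {A B : Set ℝ} (hA : MeasurableSet A) (hB : MeasurableSet B)
    {a b : ℝ} (h : ∀ τ, 0 ≤ τ → disclosureValue μ f₀ f₁ x τ +
      (A.indicator (fun _ => a) τ - B.indicator (fun _ => b) τ) ≤ disclosureValue μ f₀ f₁ y τ) :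
    a * G.real A ≤ b * G.real B := by
  have hiA : Integrable (A.indicator fun _ => a) G := (integrable_const a).indicator hA
  have hiB : Integrable (B.indicator fun _ => b) G := (integrable_const b).indicator hB
  have hle := hO.integral_nonpos y hy _ (hiA.sub hiB) h
  simp only [Pi.sub_apply] at hle
  rw [integral_sub hiA hiB, integral_indicator hA, integral_indicator hB, setIntegral_const,
    setIntegral_const, smul_eq_mul, smul_eq_mul] at hle
  linarith

variable [IsDiscountMeasure μ]

/-- Raising the flow to `m` up to time `ε` gains on disclosures after `ε`, and loses at most in
proportion on earlier ones. -/
theorem mul_measureReal_Ioi_le [IsFiniteMeasure G] (hF : IsFrontierPair f₀ f₁ I₀ I₁ u₀ u₁ us)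
    (hO : MeanEfficient μ G f₀ f₁ I₀ u₀ x) (hm0 : 0 < m) (hmu : m < u₀)
    (hxm : ∀ t, 0 < t → x t < m) (hs : SupergradOn f₀ I₀ m s) (hη : SupergradOn f₁ I₁ m η)
    {ε : ℝ} (hε : 0 < ε) : s * G.real (Ioi ε) ≤ |η| * G.real (Iic ε) := by
  have hx := hO.admissible
  have hs0 := hF.supergradOn_old_pos hm0 hmu hs
  have hm := hF.mem_old hm0 hmu.le
  have hgap : Integrable (fun t => m - x t) μ := (integrable_const m).sub hx.integrable
  set d : ℝ → ℝ := (Ioc 0 ε).indicator fun t => m - x t with hd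
  set y : ℝ → ℝ := fun t => x t + d t with hy
  have hdi : Integrable d μ := hgap.indicator measurableSet_Ioc
  have hd0 : ∀ t, 0 ≤ d t := indicator_nonneg fun t ht => sub_nonneg.2 (hxm t ht.1).le
  have hyx : ∀ t, y t ∈ uIcc (x t) m := fun t => by
    by_cases ht : t ∈ Ioc 0 ε
    · simp only [hy, hd, indicator_of_mem ht, add_sub_cancel, right_mem_uIcc]
    · simp only [hy, hd, indicator_of_notMem ht, add_zero, left_mem_uIcc]
  have hya : Admissible μ f₀ I₀ u₀ y := hx.of_mem_uIcc hF hm hs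
    (hx.measurable.add ((measurable_const.sub hx.measurable).indicator measurableSet_Ioc)) hyx
  have hK : 0 < ∫ t, d t ∂μ := integral_indicator_pos measurableSet_Ioc
    (IsDiscountMeasure.measure_Ioc_pos 0 ε le_rfl hε) hgap fun t ht => sub_pos.2 (hxm t ht.1)
  refine le_of_mul_le_mul_right ?_ hK
  rw [mul_right_comm, mul_right_comm |η|]
  refine hO.mul_measureReal_le hya measurableSet_Ioi measurableSet_Iic fun τ hτ => ?_
  refine le_trans ?_ (hx.disclosureValue_add_le_of_mem_uIcc hF hm0 hmu hs hη hya hyx fun t ht =>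
    mem_Icc.1 (uIcc_of_le (hxm t (hτ.trans_lt ht)).le ▸ hyx t))
  have htail := tailValue_mem_Icc hdi hd0 τ
  rw [tailValue_add hx.integrable hdi, add_sub_cancel_left]
  simp only [hy, add_sub_cancel_left]
  rcases le_or_gt τ ε with hτε | hτε
  · rw [indicator_of_notMem (notMem_Ioi.2 hτε), indicator_of_mem (mem_Iic.2 hτε)]
    have hgain : 0 ≤ s * ∫ t in Iic τ, d t ∂μ := mul_nonneg hs0.le (integral_nonneg hd0)
    have hloss : -(|η| * ∫ t, d t ∂μ) ≤ η * tailValue μ d τ :=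
      (neg_le_neg (mul_le_mul_of_nonneg_left htail.2 (abs_nonneg η))).trans
        (neg_mul |η| _ ▸ mul_le_mul_of_nonneg_right (neg_abs_le η) htail.1)
    linarith
  · have hzero : tailValue μ d τ = 0 := tailValue_eq_zero fun t ht =>
      indicator_of_notMem (fun h => (hτε.trans ht).not_ge h.2) _
    rw [indicator_of_mem (mem_Ioi.2 hτε), indicator_of_notMem (notMem_Iic.2 hτε),
      ← setIntegral_Iic_add_tailValue hdi τ, hzero]
    linarith

theorem exists_lt_apply [IsProbabilityMeasure G] (hF : IsFrontierPair f₀ f₁ I₀ I₁ u₀ u₁ us)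
    (hO : MeanEfficient μ G f₀ f₁ I₀ u₀ x) (hG : ProbabilityTheory.cdf G 0 = 0) (hv : v < u₀) :
    ∃ t, 0 < t ∧ v < x t := by
  by_contra! hxv
  obtain ⟨m, hvm, hmu⟩ := exists_between (max_lt hF.u₀_pos hv)
  obtain ⟨hm0, hvm⟩ := max_lt_iff.1 hvm
  obtain ⟨s, hs⟩ := hF.exists_supergradOn_old hm0 hmu
  obtain ⟨η, hη⟩ := hF.exists_supergradOn_new hm0 hmu
  have hcdf : Tendsto (ProbabilityTheory.cdf G) (𝓝[>] 0) (𝓝 0) := by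
    have := ((ProbabilityTheory.cdf G).right_continuous 0).tendsto
    rw [hG] at this
    exact this.mono_left (nhdsWithin_mono _ Ioi_subset_Ici_self)
  have hle := le_of_tendsto_of_tendsto ((hcdf.const_sub 1).const_mul s) (hcdf.const_mul |η|) <| by
    filter_upwards [self_mem_nhdsWithin] with ε hε
    have := hO.mul_measureReal_Ioi_le hF hm0 hmu (fun t ht => (hxv t ht).trans_lt hvm) hs hη hε
    rwa [← compl_Iic, probReal_compl_eq_one_sub measurableSet_Iic,
      ← ProbabilityTheory.cdf_eq_real] at this
  linarith [hF.supergradOn_old_pos hm0 hmu hs]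

end MeanEfficient

/-- The shift that adds `h` to the flow and pays for it by lowering the flow by `c` after time
`S`. -/
noncomputable def lateShift (c S : ℝ) (h : ℝ → ℝ) (t : ℝ) : ℝ :=
  h t - (Ioi S).indicator (fun _ => c) t

/-- A transfer of flow from the times after `S` to the times before `T`: adding `h` to the flow `x`
gains `s` per unit, and is affordable by lowering the flow by `c`, down to `l` at most. -/
structure IsLateTransfer (μ : Measure ℝ) (f₀ : ℝ → ℝ) (u₀ : ℝ) (x : ℝ → ℝ) (l c s T S : ℝ)
    (h : ℝ → ℝ) : Prop where
  le_apply : ∀ t, l + c ≤ x t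
  measurable : Measurable h
  nonneg : ∀ t, 0 ≤ h t
  eq_zero : ∀ t, T < t → h t = 0
  add_le : ∀ t, x t + h t ≤ u₀
  add_mul_le : ∀ t, f₀ (x t) + s * h t ≤ f₀ (x t + h t)
  integral_le : ∫ t, h t ∂μ ≤ c * μ.real (Ioi S)
  mul_integral : s * ∫ t, h t ∂μ = s * (c * μ.real (Ioi S))

theorem integral_indicator_Ioi_const (c S : ℝ) :
    ∫ t, (Ioi S).indicator (fun _ => c) t ∂μ = c * μ.real (Ioi S) := by
  rw [integral_indicator measurableSet_Ioi, setIntegral_const, smul_eq_mul, mul_comm]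

namespace IsLateTransfer

variable {h : ℝ → ℝ}

theorem le_add_lateShift (hh : IsLateTransfer μ f₀ u₀ x l c s T S h) (hc : 0 ≤ c) (t : ℝ) :
    l ≤ x t + lateShift c S h t := by
  have hind : (Ioi S).indicator (fun _ => c) t ≤ c := indicator_le_self' (fun _ _ => hc) t
  rw [lateShift]
  linarith [hh.le_apply t, hh.nonneg t]

theorem integrable [IsFiniteMeasure μ] (hh : IsLateTransfer μ f₀ u₀ x l c s T S h)
    (hx : Admissible μ f₀ I₀ u₀ x) : Integrable h μ :=
  integrable_of_forall_mem_Icc (b := u₀) hh.measurable fun t =>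
    ⟨hh.nonneg t, by linarith [hh.add_le t, hx.nonneg t]⟩

theorem ae_add_le (hh : IsLateTransfer μ f₀ u₀ x l c s T S h)
    (hF : IsFrontierPair f₀ f₁ I₀ I₁ u₀ u₁ us) (hx : Admissible μ f₀ I₀ u₀ x) (hl0 : 0 < l)
    (hlu : l < u₀) (hc : 0 ≤ c) (hTS : T ≤ S) (hs₁ : SupergradOn f₀ I₀ l s₁) :
    ∀ᵐ t ∂μ, x t + lateShift c S h t ∈ I₀ ∧
      f₀ (x t) + (s * h t - s₁ * (Ioi S).indicator (fun _ => c) t) ≤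
        f₀ (x t + lateShift c S h t) := by
  filter_upwards [hx.ae_mem] with t ht
  unfold lateShift
  rcases le_or_gt t S with htS | htS
  · rw [indicator_of_notMem (notMem_Ioi.2 htS), mul_zero, sub_zero, sub_zero]
    exact ⟨hF.mem_old (by linarith [hh.nonneg t, hh.le_apply t]) (hh.add_le t), hh.add_mul_le t⟩
  · rw [indicator_of_mem (mem_Ioi.2 htS), hh.eq_zero t (hTS.trans_lt htS), mul_zero, zero_sub,
      zero_sub]
    have hle : l ≤ x t + -c := by linarith [hh.le_apply t]
    refine ⟨hF.mem_old (hl0.trans_le hle) (by linarith [hx.le t]), ?_⟩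
    linarith [hs₁.sub_le_mul_sub hF.concaveOn_old (hF.mem_old hl0 hlu.le) ht hle (by linarith)]

variable [IsDiscountMeasure μ]

theorem admissible (hh : IsLateTransfer μ f₀ u₀ x l c s T S h)
    (hF : IsFrontierPair f₀ f₁ I₀ I₁ u₀ u₁ us) (hx : Admissible μ f₀ I₀ u₀ x) (hl0 : 0 < l)
    (hlu : l < u₀) (hc : 0 ≤ c) (hTS : T ≤ S) :
    Admissible μ f₀ I₀ u₀ fun t => x t + lateShift c S h t := by
  obtain ⟨s₁, hs₁⟩ := hF.exists_supergradOn_old hl0 hlu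
  refine hx.of_add_le hF (hx.measurable.add (hh.measurable.sub
    (measurable_const.indicator measurableSet_Ioi))) (fun t => ⟨hl0.le.trans
    (hh.le_add_lateShift hc t), ?_⟩) (((hh.integrable hx).const_mul s).sub
    (((integrable_const c).indicator measurableSet_Ioi).const_mul s₁))
    (hh.ae_add_le hF hx hl0 hlu hc hTS hs₁)
  have hind : 0 ≤ (Ioi S).indicator (fun _ => c) t := indicator_nonneg (fun _ _ => hc) t
  rw [lateShift]
  linarith [hh.add_le t]

theorem disclosureValue_add_le (hh : IsLateTransfer μ f₀ u₀ x l c s T S h)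
    (hF : IsFrontierPair f₀ f₁ I₀ I₁ u₀ u₁ us) (hx : Admissible μ f₀ I₀ u₀ x) (hl0 : 0 < l)
    (hlu : l < u₀) (hc : 0 ≤ c) (hTS : T ≤ S) (hη : SupergradOn f₁ I₁ l η)
    (hs₁ : SupergradOn f₀ I₀ l s₁) {b : ℝ}
    (hb : tailValue μ ((Ioi S).indicator fun _ => c) τ = b) (hab : tailValue μ h τ ≤ b) :
    disclosureValue μ f₀ f₁ x τ + (s * (c * μ.real (Ioi S) - tailValue μ h τ) -
        s₁ * (c * μ.real (Ioi S) - b) - η * (b - tailValue μ h τ)) ≤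
      disclosureValue μ f₀ f₁ (fun t => x t + lateShift c S h t) τ := by
  have hhi := hh.integrable hx
  have hci : Integrable ((Ioi S).indicator fun _ => c) μ :=
    (integrable_const c).indicator measurableSet_Ioi
  have hya := hh.admissible hF hx hl0 hlu hc hTS
  have htail : tailValue μ (fun t => x t + lateShift c S h t) τ =
      tailValue μ x τ + (tailValue μ h τ - b) := by
    rw [← hb, ← tailValue_sub hhi hci]
    exact tailValue_add hx.integrable (hhi.sub hci) τ
  have hle : contValue μ (fun t => x t + lateShift c S h t) τ ≤ contValue μ x τ :=
    div_le_div_of_nonneg_right (by linarith) measureReal_nonneg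
  have hlc : l ≤ contValue μ (fun t => x t + lateShift c S h t) τ :=
    (contValue_mem_Icc hya.measurable (fun t => ⟨hh.le_add_lateShift hc t, hya.le t⟩) τ).1
  have hslope := hη.sub_le_mul_sub hF.concaveOn_new (hF.mem_new hl0 hlu.le)
    (hx.contValue_mem_new hF τ) hlc hle
  refine le_trans (le_of_eq ?_) (hx.disclosureValue_add_le hya
    ((hhi.const_mul s).sub (hci.const_mul s₁))
    ((hh.ae_add_le hF hx hl0 hlu hc hTS hs₁).mono fun t ht => ht.2) (by linarith))
  simp only [Pi.sub_apply]
  rw [integral_sub (hhi.const_mul s).integrableOn (hci.const_mul s₁).integrableOn,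
    integral_const_mul, integral_const_mul, htail,
    eq_sub_of_add_eq (setIntegral_Iic_add_tailValue hhi τ),
    eq_sub_of_add_eq (setIntegral_Iic_add_tailValue hci τ), integral_indicator_Ioi_const, hb]
  linarith [hh.mul_integral]

theorem mul_measureReal_Ioc_le [IsFiniteMeasure G] (hh : IsLateTransfer μ f₀ u₀ x l c s T S h)
    (hF : IsFrontierPair f₀ f₁ I₀ I₁ u₀ u₁ us) (hO : MeanEfficient μ G f₀ f₁ I₀ u₀ x)
    (hl0 : 0 < l) (hlu : l < u₀) (hc : 0 < c) (hTS : T ≤ S) (hs : 0 ≤ s)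
    (hη : SupergradOn f₁ I₁ l η) (hηs : η ≤ s) (hs₁ : SupergradOn f₀ I₀ l s₁) :
    (s - η) * G.real (Ioc T S) ≤ s₁ * G.real (Ioi S) := by
  have hx := hO.admissible
  have hK : 0 < c * μ.real (Ioi S) := mul_pos hc (measureReal_Ioi_pos S)
  have hci : Integrable ((Ioi S).indicator fun _ => c) μ :=
    (integrable_const c).indicator measurableSet_Ioi
  refine le_of_mul_le_mul_right ?_ hK
  rw [mul_right_comm, mul_right_comm s₁]
  refine hO.mul_measureReal_le (hh.admissible hF hx hl0 hlu hc.le hTS) measurableSet_Ioc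
    measurableSet_Ioi fun τ _ => ?_
  have ha := tailValue_mem_Icc (hh.integrable hx) hh.nonneg τ
  have hb := tailValue_mem_Icc hci (indicator_nonneg fun _ _ => hc.le) τ
  rw [integral_indicator_Ioi_const] at hb
  have hzero : T ≤ τ → tailValue μ h τ = 0 := fun hτ =>
    tailValue_eq_zero fun t ht => hh.eq_zero t (hτ.trans_lt ht)
  rcases le_or_gt τ S with hτS | hSτ
  · have hbK : tailValue μ ((Ioi S).indicator fun _ => c) τ = c * μ.real (Ioi S) :=
      (tailValue_eq_integral fun t ht => indicator_of_notMem (notMem_Ioi.2 (ht.trans hτS)) _).trans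
        (integral_indicator_Ioi_const c S)
    refine le_trans ?_ (hh.disclosureValue_add_le hF hx hl0 hlu hc.le hTS hη hs₁ hbK
      (ha.2.trans hh.integral_le))
    rw [indicator_of_notMem (notMem_Ioi.2 hτS)]
    rcases lt_or_ge T τ with hTτ | hτT
    · rw [indicator_of_mem (mem_Ioc.2 ⟨hTτ, hτS⟩), hzero hTτ.le]
      linarith
    · rw [indicator_of_notMem fun h' => h'.1.not_ge hτT]
      have := mul_nonneg (sub_nonneg.2 hηs) (sub_nonneg.2 (ha.2.trans hh.integral_le))
      linarith
  · refine le_trans ?_ (hh.disclosureValue_add_le hF hx hl0 hlu hc.le hTS hη hs₁ rfl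
      ((hzero (hTS.trans hSτ.le)).trans_le hb.1))
    rw [indicator_of_mem (mem_Ioi.2 hSτ), indicator_of_notMem fun h' => h'.2.not_gt hSτ,
      hzero (hTS.trans hSτ.le)]
    have hpaid := mul_nonneg hs (sub_nonneg.2 hb.2)
    have hslope := mul_nonneg (sub_nonneg.2 hηs) hb.1
    have hold := mul_nonneg (hF.supergradOn_old_pos hl0 hlu hs₁).le hb.1
    linarith

end IsLateTransfer

theorem tendsto_measureReal_Ioi_atTop [IsProbabilityMeasure G] :
    Tendsto (fun S => G.real (Ioi S)) atTop (𝓝 0) := by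
  have := (ProbabilityTheory.tendsto_cdf_atTop G).const_sub 1
  rw [sub_self] at this
  refine this.congr fun S => ?_
  rw [ProbabilityTheory.cdf_eq_real, ← probReal_compl_eq_one_sub measurableSet_Iic, compl_Iic]

theorem not_eventually_mul_measureReal_Ioc_le [IsProbabilityMeasure G] {α β : ℝ} (hα : 0 < α)
    (hT : 0 < G.real (Ioi T)) :
    ¬ ∀ᶠ S in atTop, α * G.real (Ioc T S) ≤ β * G.real (Ioi S) := by
  intro h
  have hlim : Tendsto (fun S => G.real (Ioi S)) atTop (𝓝 0) := tendsto_measureReal_Ioi_atTop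
  have hle := le_of_tendsto_of_tendsto ((hlim.const_sub (G.real (Ioi T))).const_mul α)
    (hlim.const_mul β) <| by
      filter_upwards [h, eventually_ge_atTop T] with S hS hTS
      rwa [← measureReal_Ioc_eq_sub hTS]
  rw [sub_zero, mul_zero] at hle
  exact hle.not_gt (mul_pos hα hT)

/-- Once `S` is large, the flow released after `S` is worth less than raising the flow to `m` during
a unit of time, so that the transfer can be scaled down to balance. -/
theorem Admissible.eventually_exists_isLateTransfer [IsDiscountMeasure μ]
    (hF : IsFrontierPair f₀ f₁ I₀ I₁ u₀ u₁ us) (hx : Admissible μ f₀ I₀ u₀ x) (hl0 : 0 < l)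
    (hlx : ∀ t, l + c ≤ x t) (hc : 0 < c) (hT0 : 0 ≤ T) (hxm : ∀ t, T < t → x t < m)
    (hmu : m < u₀) (hs : SupergradOn f₀ I₀ m s) :
    ∀ᶠ S in atTop, ∃ h, IsLateTransfer μ f₀ u₀ x l c s (T + 1) S h := by
  have hgap : Integrable (fun t => m - x t) μ := (integrable_const m).sub hx.integrable
  set g : ℝ → ℝ := (Ioc T (T + 1)).indicator fun t => m - x t with hg
  have hg0 : ∀ t, 0 ≤ g t := indicator_nonneg fun t ht => sub_nonneg.2 (hxm t ht.1).le
  have hR : 0 < ∫ t, g t ∂μ := integral_indicator_pos measurableSet_Ioc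
    (IsDiscountMeasure.measure_Ioc_pos T (T + 1) hT0 (lt_add_one T)) hgap
    fun t ht => sub_pos.2 (hxm t ht.1)
  have hlim : Tendsto (fun S => c * μ.real (Ioi S)) atTop (𝓝 0) := by
    simpa using (tendsto_measureReal_Ioi_atTop (G := μ)).const_mul c
  filter_upwards [hlim.eventually (gt_mem_nhds hR)] with S hS
  set θ := c * μ.real (Ioi S) / ∫ t, g t ∂μ with hθ
  have hθ0 : 0 ≤ θ := div_nonneg (mul_nonneg hc.le measureReal_nonneg) hR.le
  have hθ1 : θ ≤ 1 := (div_le_one hR).2 hS.le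
  have hint : ∫ t, θ * g t ∂μ = c * μ.real (Ioi S) := by
    rw [integral_const_mul, hθ, div_mul_cancel₀ _ hR.ne']
  have hxI : ∀ t, x t ∈ I₀ := fun t => hF.mem_old (by linarith [hlx t]) (hx.le t)
  have hm0 : 0 < m := by linarith [hlx (T + 1), hxm (T + 1) (lt_add_one T)]
  have hmem : ∀ t, x t + θ * g t ∈ uIcc (x t) m := fun t => by
    by_cases ht : t ∈ Ioc T (T + 1)
    · rw [hg, indicator_of_mem ht]
      exact add_mul_sub_mem_uIcc ⟨hθ0, hθ1⟩
    · rw [hg, indicator_of_notMem ht, mul_zero, add_zero]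
      exact left_mem_uIcc
  refine ⟨fun t => θ * g t, hlx, ((measurable_const.sub hx.measurable).indicator
    measurableSet_Ioc).const_mul θ, fun t => mul_nonneg hθ0 (hg0 t), fun t ht => ?_,
    fun t => (hx.mem_Icc_of_mem_uIcc ⟨hm0.le, hmu.le⟩ hmem t).2, fun t => ?_, hint.le,
    congrArg (s * ·) hint⟩
  · rw [hg, indicator_of_notMem fun h => h.2.not_gt ht, mul_zero]
  · simpa only [add_sub_cancel_left] using
      hs.add_mul_sub_le hF.concaveOn_old (hF.mem_old hm0 hmu.le) (hxI t) (hmem t)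

namespace MeanEfficient

variable [IsDiscountMeasure μ] [IsProbabilityMeasure G]

theorem exists_apply_lt (hF : IsFrontierPair f₀ f₁ I₀ I₁ u₀ u₁ us)
    (hO : MeanEfficient μ G f₀ f₁ I₀ u₀ x) (hG : 0 < G.real (Ioi T)) : ∃ t, x t < u₀ := by
  by_contra! hxu
  have hx := hO.admissible
  obtain ⟨l, hul, hlu⟩ := exists_between hF.u₁_lt
  have hl0 : 0 < l := hF.u₁_nonneg.trans_lt hul
  obtain ⟨η, hη⟩ := hF.exists_supergradOn_new hl0 hlu
  obtain ⟨s₁, hs₁⟩ := hF.exists_supergradOn_old hl0 hlu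
  have hη0 : η < 0 := by
    obtain ⟨v, huv, hvl⟩ := exists_between hul
    have hlt := hF.strictAntiOn_new ⟨huv.le, (hvl.trans hlu).le⟩ ⟨hul.le, hlu.le⟩ hvl
    nlinarith [hη v (hF.mem_new (hF.u₁_nonneg.trans_lt huv) (hvl.trans hlu).le)]
  refine not_eventually_mul_measureReal_Ioc_le (neg_pos.2 hη0) hG (β := s₁) ?_
  filter_upwards [eventually_ge_atTop T] with S hTS
  have hh : IsLateTransfer μ f₀ u₀ x l (u₀ - l) 0 T S fun _ => 0 :=
    { le_apply := fun t => by linarith [hxu t]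
      measurable := measurable_const
      nonneg := fun _ => le_rfl
      eq_zero := fun _ _ => rfl
      add_le := fun t => by simpa using hx.le t
      add_mul_le := fun t => by simp
      integral_le := by
        rw [integral_zero]
        exact mul_nonneg (sub_nonneg.2 hlu.le) measureReal_nonneg
      mul_integral := by simp }
  simpa using hh.mul_measureReal_Ioc_le hF hO hl0 hlu (sub_pos.2 hlu) hTS le_rfl hη hη0.le hs₁

theorem le_us_of_tendsto (hF : IsFrontierPair f₀ f₁ I₀ I₁ u₀ u₁ us)
    (hO : MeanEfficient μ G f₀ f₁ I₀ u₀ x) (hG : ∀ a, 0 < G.real (Ioi a)) (hlx : ∀ t, l ≤ x t)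
    (hlim : Tendsto x atTop (𝓝 l)) : l ≤ us := by
  have hx := hO.admissible
  by_contra! hl
  have hlu : l < u₀ := let ⟨t, ht⟩ := hO.exists_apply_lt hF (hG 0); (hlx t).trans_lt ht
  obtain ⟨l', ⟨hl'0, hl'l⟩, m, ⟨hlm, hmu⟩, η, s, hη, hs, hηs⟩ := hF.exists_supergradOn_lt hl hlu
  obtain ⟨s₁, hs₁⟩ := hF.exists_supergradOn_old hl'0 (hl'l.trans hlu)
  obtain ⟨T, hT0, hTm⟩ : ∃ T, 0 ≤ T ∧ ∀ t, T < t → x t < m := by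
    obtain ⟨T, hT⟩ := eventually_atTop.1 (hlim.eventually (gt_mem_nhds hlm))
    exact ⟨max T 0, le_max_right _ _, fun t ht => hT t ((le_max_left _ _).trans ht.le)⟩
  refine not_eventually_mul_measureReal_Ioc_le (sub_pos.2 hηs) (hG (T + 1)) (β := s₁) ?_
  filter_upwards [eventually_ge_atTop (T + 1), hx.eventually_exists_isLateTransfer hF hl'0
    (fun t => (add_sub_cancel l' l).trans_le (hlx t)) (sub_pos.2 hl'l) hT0 hTm hmu hs]
    with S hTS ⟨h, hh⟩
  exact hh.mul_measureReal_Ioc_le hF hO hl'0 (hl'l.trans hlu) (sub_pos.2 hl'l) hTS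
    (hF.supergradOn_old_pos (hl'0.trans (hl'l.trans hlm)) hmu hs).le hη hηs.le hs₁

end MeanEfficient

theorem disclosureValue_congr (h : y =ᵐ[μ] x) :
    disclosureValue μ f₀ f₁ y = disclosureValue μ f₀ f₁ x := by
  funext τ
  unfold disclosureValue contValue tailValue
  rw [integral_congr_ae (ae_restrict_of_ae h), setIntegral_congr_ae (g := fun t => f₀ (x t))
    measurableSet_Iic (h.mono fun t ht _ => congrArg f₀ ht)]

theorem Admissible.congr (hx : Admissible μ f₀ I₀ u₀ x) (h : y =ᵐ[μ] x) (hym : Measurable y)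
    (hy : ∀ t, y t ∈ Icc 0 u₀) : Admissible μ f₀ I₀ u₀ y where
  measurable := hym
  mem_Icc := hy
  ae_mem := by filter_upwards [hx.ae_mem, h] with t h1 h2; rwa [h2]
  integrableOn τ := (hx.integrableOn τ).congr (ae_restrict_of_ae (h.symm.fun_comp f₀))

theorem MeanEfficient.congr (hO : MeanEfficient μ G f₀ f₁ I₀ u₀ x) (h : y =ᵐ[μ] x)
    (hy : Admissible μ f₀ I₀ u₀ y) : MeanEfficient μ G f₀ f₁ I₀ u₀ y where
  admissible := hy
  integral_nonpos := by rw [disclosureValue_congr h]; exact hO.integral_nonpos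

variable [IsDiscountMeasure μ]

theorem exists_lt_of_ae {p : ℝ → Prop} (hp : ∀ᵐ t ∂μ, p t) (T : ℝ) : ∃ t, T < t ∧ p t := by
  by_contra! h
  have hnull : μ (Ioi T) = 0 := measure_mono_null (fun t ht => h t ht) (ae_iff.1 hp)
  exact (measureReal_Ioi_pos (μ := μ) T).ne' (by rw [measureReal_def, hnull, ENNReal.toReal_zero])

theorem Efficient.us_le_ae (hF : IsFrontierPair f₀ f₁ I₀ I₁ u₀ u₁ us)
    (hE : Efficient μ f₀ f₁ I₀ u₀ x) : ∀ᵐ t ∂μ, us ≤ x t := by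
  filter_upwards [contValue_le_ae_of_antitoneOn hE.admissible.measurable hE.admissible.mem_Icc
    (hE.antitoneOn_contValue hF), ae_pos_of_isDiscountMeasure (μ := μ)] with t ht h0
  exact (hE.us_le_contValue hF h0.le).trans ht

theorem Efficient.exists_antitone_ae_eq (hF : IsFrontierPair f₀ f₁ I₀ I₁ u₀ u₁ us)
    (hE : Efficient μ f₀ f₁ I₀ u₀ x) :
    ∃ z, Antitone z ∧ z =ᵐ[μ] x ∧ Admissible μ f₀ I₀ u₀ z := by
  obtain ⟨N, hN, hxN⟩ := exists_antitoneOn_of_measure_eq_zero (μ := μ) (x := x)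
    ae_pos_of_isDiscountMeasure fun p q T hT hpq hA =>
      hE.measure_le_inter_Ioi_eq_zero hF hT hpq hA
  obtain ⟨z, hz, hzI, hzx⟩ := _root_.exists_antitone_ae_eq hE.admissible.mem_Icc hN hxN
  exact ⟨z, hz, hzx, hE.admissible.congr hzx hz.measurable hzI⟩

theorem Efficient.exists_antitone_tendsto [IsProbabilityMeasure G]
    (hF : IsFrontierPair f₀ f₁ I₀ I₁ u₀ u₁ us) (hE : Efficient μ f₀ f₁ I₀ u₀ x)
    (hO : MeanEfficient μ G f₀ f₁ I₀ u₀ x) (hG0 : ProbabilityTheory.cdf G 0 = 0)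
    (hG : ∀ a, 0 < G.real (Ioi a)) :
    ∃ z, Antitone z ∧ z =ᵐ[μ] x ∧ Admissible μ f₀ I₀ u₀ z ∧ Tendsto z (𝓝[>] 0) (𝓝 u₀) ∧
      Tendsto z atTop (𝓝 us) := by
  obtain ⟨z, hz, hzx, hza⟩ := hE.exists_antitone_ae_eq hF
  have hzO := hO.congr hzx hza
  refine ⟨z, hz, hzx, hza, tendsto_order.2 ⟨fun v hv => ?_, fun v hv =>
    Eventually.of_forall fun t => (hza.le t).trans_lt hv⟩, ?_⟩
  · obtain ⟨t, ht, hvt⟩ := hzO.exists_lt_apply hF hG0 hv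
    filter_upwards [Ioo_mem_nhdsGT ht] with s hs using hvt.trans_le (hz hs.2.le)
  · have hbdd : BddBelow (range z) := ⟨0, forall_mem_range.2 hza.nonneg⟩
    have hlim := tendsto_atTop_ciInf hz hbdd
    have hge : us ≤ ⨅ t, z t := le_ciInf fun t => by
      obtain ⟨s, hts, hs, hzs⟩ := exists_lt_of_ae ((hE.us_le_ae hF).and hzx) t
      exact (hs.trans_eq hzs.symm).trans (hz hts.le)
    rwa [le_antisymm (hzO.le_us_of_tendsto hF hG (fun t => ciInf_le hbdd t) hlim) hge] at hlim

end

/-- The effective domain of a frontier. -/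
def effDomain (F : ℝ → EReal) : Set ℝ := {u | 0 ≤ u ∧ F u ≠ ⊥}

/-- The real-valued version of a frontier, meaningful on the effective domain. Negative arguments
are moved to `0`, which makes it measurable on the whole line. -/
noncomputable def realFrontier (F : ℝ → EReal) (u : ℝ) : ℝ := (F (max u 0)).toReal

theorem SupergradOn.of_eventually {f : ℝ → ℝ} {I : Set ℝ} {u s : ℝ} (hf : ConcaveOn ℝ I f)
    (hu : u ∈ I) (h : ∀ᶠ v in 𝓝[I] u, f v ≤ f u + s * (v - u)) : SupergradOn f I u s := by
  have hconc : ConcaveOn ℝ I fun v => f v - s * v :=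
    hf.sub ((LinearMap.mulLeft ℝ s).convexOn hf.1)
  have hmax : IsLocalMaxOn (fun v => f v - s * v) I u := by
    filter_upwards [h] with v hv
    linarith
  intro v hv
  have hle := isMaxOn_iff.1 (IsMaxOn.of_isLocalMaxOn_of_concaveOn hu hmax hconc) v hv
  linarith

theorem SupergradOn.of_inter {f : ℝ → ℝ} {I N : Set ℝ} {u s : ℝ} (hf : ConcaveOn ℝ I f)
    (hu : u ∈ I) (hN : N ∈ 𝓝 u) (hs : SupergradOn f (I ∩ N) u s) : SupergradOn f I u s :=
  .of_eventually hf hu <| by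
    filter_upwards [self_mem_nhdsWithin, nhdsWithin_le_nhds hN] with v hv hvN using hs v ⟨hv, hvN⟩

theorem strictAntiOn_Ioo_of_forall_not_isLocalMax {g : ℝ → ℝ} {a b c : ℝ}
    (hg : ContinuousOn g (Ioo a b)) (hmax : ∀ w ∈ Ioo a b, ¬IsLocalMax g w) (hcb : c < b)
    (hanti : StrictAntiOn g (Ico c b)) : StrictAntiOn g (Ioo a b) := by
  intro u hu v hv huv
  obtain ⟨d, hd, hdb⟩ := exists_between (max_lt hv.2 hcb)
  obtain ⟨hvd, hcd⟩ := max_lt_iff.1 hd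
  have hud : u < d := huv.trans hvd
  have hnot : ∀ w ∈ Ioo u d, ¬IsMaxOn g (Icc u d) w := fun w hw hw' =>
    hmax w ⟨hu.1.trans hw.1, hw.2.trans hdb⟩ (hw'.isLocalMax (Icc_mem_nhds hw.1 hw.2))
  obtain ⟨w, hw, hwmax⟩ := isCompact_Icc.exists_isMaxOn (nonempty_Icc.2 hud.le)
    (hg.mono fun t ht => ⟨hu.1.trans_le ht.1, ht.2.trans_lt hdb⟩)
  have hwd : w < d := by
    refine hw.2.lt_of_ne ?_
    rintro rfl
    have hlt := hanti ⟨le_max_right u c, max_lt hu.2 hcb⟩ ⟨hcd.le, hdb⟩ (max_lt hud hcd)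
    exact (hwmax ⟨le_max_left u c, max_le hud.le hcd.le⟩).not_gt hlt
  obtain rfl : u = w := hw.1.eq_or_lt.resolve_right fun huw => hnot w ⟨huw, hwd⟩ hwmax
  refine (hwmax ⟨huv.le, hvd.le⟩).lt_of_ne fun heq => hnot v ⟨huv, hvd⟩ fun t ht => ?_
  exact (hwmax ht).trans_eq heq.symm

namespace IsFrontier

variable {F : ℝ → EReal} {p u v s : ℝ}

theorem coe_realFrontier (hF : IsFrontier F p) (hu : u ∈ effDomain F) :
    (realFrontier F u : EReal) = F u := by
  rw [realFrontier, max_eq_left hu.1]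
  exact EReal.coe_toReal (hF.ne_top u hu.1) hu.2

theorem combo_mem_and_le (hF : IsFrontier F p) {a b : ℝ} (hu : u ∈ effDomain F)
    (hv : v ∈ effDomain F) (ha : 0 ≤ a) (hb : 0 ≤ b) (hab : a + b = 1) :
    a * u + b * v ∈ effDomain F ∧
      a * realFrontier F u + b * realFrontier F v ≤ realFrontier F (a * u + b * v) := by
  have h := hF.concave u v a b hu.1 hv.1 ha hb hab
  rw [← hF.coe_realFrontier hu, ← hF.coe_realFrontier hv] at h
  norm_cast at h
  have hmem : a * u + b * v ∈ effDomain F :=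
    ⟨add_nonneg (mul_nonneg ha hu.1) (mul_nonneg hb hv.1),
      ne_bot_of_le_ne_bot (EReal.coe_ne_bot _) h⟩
  rw [← hF.coe_realFrontier hmem] at h
  exact ⟨hmem, EReal.coe_le_coe_iff.1 h⟩

theorem concaveOn (hF : IsFrontier F p) : ConcaveOn ℝ (effDomain F) (realFrontier F) :=
  ⟨fun _ hu _ hv _ _ ha hb hab => (hF.combo_mem_and_le hu hv ha hb hab).1,
    fun _ hu _ hv _ _ ha hb hab => (hF.combo_mem_and_le hu hv ha hb hab).2⟩

theorem measurable_comp_max (hF : IsFrontier F p) : Measurable fun u => F (max u 0) := by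
  refine UpperSemicontinuous.measurable fun u c hc => ?_
  have htend : Tendsto (fun v : ℝ => max v 0) (𝓝 u) (𝓝[Ici 0] (max u 0)) :=
    tendsto_nhdsWithin_iff.2 ⟨(continuous_id.max continuous_const).tendsto u,
      Eventually.of_forall fun v => le_max_right v 0⟩
  exact htend.eventually (hF.usc (max u 0) (le_max_right u 0) c hc)

theorem measurable_realFrontier (hF : IsFrontier F p) : Measurable (realFrontier F) :=
  hF.measurable_comp_max.ereal_toReal

theorem peak_mem (hF : IsFrontier F p) : p ∈ effDomain F :=
  ⟨hF.peak_nonneg, ((hF.peak (p + 1) (by linarith [hF.peak_nonneg]) (by linarith)).bot_lt).ne'⟩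

theorem le_peak (hF : IsFrontier F p) (hu : 0 ≤ u) : F u ≤ F p := by
  rcases eq_or_ne u p with rfl | h
  exacts [le_rfl, (hF.peak u hu h).le]

theorem realFrontier_lt_of_mem_uIcc (hF : IsFrontier F p) (hu : u ∈ effDomain F)
    (hv : v ∈ uIcc u p) (hvu : v ≠ u) : realFrontier F u < realFrontier F v := by
  rw [← segment_eq_uIcc] at hv
  obtain ⟨a, b, ha, hb, hab, rfl⟩ := hv
  obtain rfl : a = 1 - b := by linarith
  have hb0 : 0 < b := hb.lt_of_ne (by rintro rfl; simp at hvu)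
  have hup : u ≠ p := by
    rintro rfl
    exact hvu (by simp only [smul_eq_mul]; ring)
  have hpeak : realFrontier F u < realFrontier F p := by
    rw [← EReal.coe_lt_coe_iff, hF.coe_realFrontier hu, hF.coe_realFrontier hF.peak_mem]
    exact hF.peak u hu.1 hup
  have hcombo := (hF.combo_mem_and_le hu hF.peak_mem ha hb hab).2
  simp only [smul_eq_mul]
  linarith [mul_lt_mul_of_pos_left hpeak hb0]

theorem strictMonoOn (hF : IsFrontier F p) :
    StrictMonoOn (realFrontier F) (effDomain F ∩ Iic p) := fun _ hu _ hv huv =>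
  hF.realFrontier_lt_of_mem_uIcc hu.1 (mem_uIcc.2 (.inl ⟨huv.le, hv.2⟩)) huv.ne'

theorem strictAntiOn (hF : IsFrontier F p) :
    StrictAntiOn (realFrontier F) (effDomain F ∩ Ici p) := fun _ hu _ hv huv =>
  hF.realFrontier_lt_of_mem_uIcc hv.1 (mem_uIcc.2 (.inr ⟨hu.2, huv.le⟩)) huv.ne

theorem isSupergradient_coe_iff (hF : IsFrontier F p) (hu : u ∈ effDomain F) :
    IsSupergradient F u s ↔ SupergradOn (realFrontier F) (effDomain F) u s := by
  constructor
  · intro hs v hv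
    rcases eq_or_ne v u with rfl | hne
    · simp
    have h := hs.2 v hv.1 hne
    rw [← hF.coe_realFrontier hu, ← hF.coe_realFrontier hv] at h
    norm_cast at h
    linarith
  · refine fun hs => ⟨subset_closure hu, fun v hv0 _ => ?_⟩
    by_cases hv : F v = ⊥
    · rw [hv, EReal.bot_sub]
      exact bot_le
    · have h := hs v ⟨hv0, hv⟩
      rw [← hF.coe_realFrontier hu, ← hF.coe_realFrontier ⟨hv0, hv⟩]
      norm_cast
      linarith

end IsFrontier

namespace IsTechnology

variable {F₀ F₁ : ℝ → EReal} {u₀ u₁ us u s : ℝ}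

theorem mem_old (h : IsTechnology F₀ F₁ u₀ u₁ us) (hu : 0 < u) (hu' : u ≤ u₀) :
    u ∈ effDomain F₀ := ⟨hu.le, h.old_finite u hu hu'⟩

theorem effDomain_subset (h : IsTechnology F₀ F₁ u₀ u₁ us) : effDomain F₀ ⊆ effDomain F₁ :=
  fun u hu => ⟨hu.1, ne_bot_of_le_ne_bot hu.2 (h.old_le_new u hu.1)⟩

theorem mem_new (h : IsTechnology F₀ F₁ u₀ u₁ us) (hu : 0 < u) (hu' : u ≤ u₀) :
    u ∈ effDomain F₁ := h.effDomain_subset (h.mem_old hu hu')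

theorem u₀_pos (h : IsTechnology F₀ F₁ u₀ u₁ us) : 0 < u₀ :=
  h.new.peak_nonneg.trans_lt h.conflict

theorem us_nonneg (h : IsTechnology F₀ F₁ u₀ u₁ us) : 0 ≤ us := h.ustar.1.1

theorem us_lt (h : IsTechnology F₀ F₁ u₀ u₁ us) : us < u₀ := h.ustar.1.2.1

theorem Icc_subset_new (h : IsTechnology F₀ F₁ u₀ u₁ us) : Icc u₁ u₀ ⊆ effDomain F₁ := by
  rintro u ⟨hu, hu'⟩
  rcases hu.eq_or_lt with rfl | hlt
  exacts [h.new.peak_mem, h.mem_new (h.new.peak_nonneg.trans_lt hlt) hu']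

theorem not_shared (h : IsTechnology F₀ F₁ u₀ u₁ us) (hus : us < u) (hu : u < u₀)
    (h₀ : SupergradOn (realFrontier F₀) (effDomain F₀) u s) :
    ¬SupergradOn (realFrontier F₁) (effDomain F₁) u s := fun h₁ => by
  have hu0 : 0 < u := h.us_nonneg.trans_lt hus
  exact hus.not_ge (h.ustar.2 ⟨hu0.le, hu, s,
    (h.old.isSupergradient_coe_iff (h.mem_old hu0 hu.le)).2 h₀,
    (h.new.isSupergradient_coe_iff (h.mem_new hu0 hu.le)).2 h₁⟩)

theorem not_isLocalMax_sub (h : IsTechnology F₀ F₁ u₀ u₁ us) (hu : u ∈ Ioo us u₀) :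
    ¬IsLocalMax (fun v => realFrontier F₁ v - realFrontier F₀ v) u := by
  intro hmax
  have hu0 : 0 < u := h.us_nonneg.trans_lt hu.1
  have hint : u ∈ interior (effDomain F₀) := mem_interior_iff_mem_nhds.2 <|
    mem_of_superset (Ioo_mem_nhds hu0 hu.2) fun v hv => h.mem_old hv.1 hv.2.le
  obtain ⟨s, hs⟩ := SupergradOn.exists_of_mem_interior h.old.concaveOn hint
  refine h.not_shared hu.1 hu.2 hs
    (.of_eventually h.new.concaveOn (h.mem_new hu0 hu.2.le) (nhdsWithin_le_nhds ?_))
  filter_upwards [hmax, mem_interior_iff_mem_nhds.1 hint] with v hv hvI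
  linarith [hs v hvI]

theorem continuousOn_sub (h : IsTechnology F₀ F₁ u₀ u₁ us) :
    ContinuousOn (fun v => realFrontier F₁ v - realFrontier F₀ v) (Ioo 0 u₀) :=
  ((h.new.concaveOn.subset (fun _ hv => h.mem_new hv.1 hv.2.le)
    (convex_Ioo 0 u₀)).continuousOn isOpen_Ioo).sub
    ((h.old.concaveOn.subset (fun _ hv => h.mem_old hv.1 hv.2.le)
      (convex_Ioo 0 u₀)).continuousOn isOpen_Ioo)

theorem strictAntiOn_sub_Ioc (h : IsTechnology F₀ F₁ u₀ u₁ us) :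
    StrictAntiOn (fun v => realFrontier F₁ v - realFrontier F₀ v) (Ioc u₁ u₀) := by
  intro u hu v hv huv
  have hu0 : 0 < u := h.new.peak_nonneg.trans_lt hu.1
  have hnew := h.new.strictAntiOn ⟨h.mem_new hu0 hu.2, hu.1.le⟩
    ⟨h.mem_new (hu0.trans huv) hv.2, hv.1.le⟩ huv
  have hold := h.old.strictMonoOn ⟨h.mem_old hu0 hu.2, hu.2⟩
    ⟨h.mem_old (hu0.trans huv) hv.2, hv.2⟩ huv
  linarith

theorem strictAntiOn_sub (h : IsTechnology F₀ F₁ u₀ u₁ us) :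
    StrictAntiOn (fun v => realFrontier F₁ v - realFrontier F₀ v) (Ioc us u₀) := by
  obtain ⟨c, hc, hcu⟩ := exists_between h.conflict
  have hIoo := strictAntiOn_Ioo_of_forall_not_isLocalMax
    (h.continuousOn_sub.mono (Ioo_subset_Ioo_left h.us_nonneg)) (fun _ => h.not_isLocalMax_sub) hcu
    (h.strictAntiOn_sub_Ioc.mono fun v hv => ⟨hc.trans_le hv.1, hv.2.le⟩)
  intro u hu v hv huv
  rcases hv.2.lt_or_eq with hlt | rfl
  · exact hIoo ⟨hu.1, huv.trans hlt⟩ ⟨hv.1, hlt⟩ huv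
  obtain ⟨e, he, hev⟩ := exists_between (max_lt huv h.conflict)
  obtain ⟨hue, hue'⟩ := max_lt_iff.1 he
  exact (h.strictAntiOn_sub_Ioc ⟨hue', hev.le⟩ ⟨h.conflict, le_rfl⟩ hev).trans
    (hIoo ⟨hu.1, huv⟩ ⟨hu.1.trans hue, hev⟩ hue)

theorem lt_of_supergradOn (h : IsTechnology F₀ F₁ u₀ u₁ us) {η : ℝ} (hu : u ∈ Ioo us u₀)
    (hs : SupergradOn (realFrontier F₀) (effDomain F₀) u s)
    (hη : SupergradOn (realFrontier F₁) (effDomain F₁) u η) : η < s := by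
  have hu0 : 0 < u := h.us_nonneg.trans_lt hu.1
  by_contra! hle
  refine h.not_shared hu.1 hu.2 hs (.of_eventually h.new.concaveOn (h.mem_new hu0 hu.2.le)
    (nhdsWithin_le_nhds ?_))
  filter_upwards [Ioo_mem_nhds hu0 hu.2] with v hv
  rcases le_or_gt v u with hvu | huv
  · have hgrad := hη v (h.mem_new hv.1 hv.2.le)
    linarith [mul_le_mul_of_nonpos_right hle (sub_nonpos.2 hvu)]
  · have hgap := h.strictAntiOn_sub ⟨hu.1, hu.2.le⟩ ⟨hu.1.trans huv, hv.2.le⟩ huv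
    linarith [hs v (h.mem_old hv.1 hv.2.le)]

theorem exists_shared (h : IsTechnology F₀ F₁ u₀ u₁ us) (hus : 0 < us) :
    ∃ η : ℝ, SupergradOn (realFrontier F₀) (effDomain F₀) us η ∧
      SupergradOn (realFrontier F₁) (effDomain F₁) us η := by
  obtain ⟨η, h₀, h₁⟩ := h.ustar.1.2.2
  have hlt := h.us_lt
  have hmem := h.mem_old hus hlt.le
  have hne_top : η ≠ ⊤ := by
    rintro rfl
    have hgrad := h₀.2 (us / 2) (by linarith) (by linarith)
    rw [← h.old.coe_realFrontier (h.mem_old (half_pos hus) (by linarith)),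
      ← h.old.coe_realFrontier hmem, EReal.top_mul_coe_of_neg (by linarith)] at hgrad
    exact EReal.coe_ne_bot _ (le_bot_iff.1 hgrad)
  have hne_bot : η ≠ ⊥ := by
    rintro rfl
    have hgrad := h₀.2 u₀ h.u₀_pos.le hlt.ne'
    rw [← h.old.coe_realFrontier (h.mem_old h.u₀_pos le_rfl), ← h.old.coe_realFrontier hmem,
      EReal.bot_mul_coe_of_pos (by linarith)] at hgrad
    exact EReal.coe_ne_bot _ (le_bot_iff.1 hgrad)
  lift η to ℝ using ⟨hne_top, hne_bot⟩
  exact ⟨η, (h.old.isSupergradient_coe_iff hmem).1 h₀,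
    (h.new.isSupergradient_coe_iff (h.effDomain_subset hmem)).1 h₁⟩

theorem eventually_sub_lt (h : IsTechnology F₀ F₁ u₀ u₁ us) (hus : 0 < us) :
    ∀ᶠ v in 𝓝[≠] us, realFrontier F₁ v - realFrontier F₀ v <
      realFrontier F₁ us - realFrontier F₀ us := by
  have hcoe : ∀ v, 0 < v → v ≤ u₀ →
      ((realFrontier F₁ v - realFrontier F₀ v : ℝ) : EReal) = F₁ v - F₀ v := fun v hv hv' => by
    rw [EReal.coe_sub, h.new.coe_realFrontier (h.mem_new hv hv'),
      h.old.coe_realFrontier (h.mem_old hv hv')]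
  filter_upwards [h.strict_max hus, nhdsWithin_le_nhds (Ioo_mem_nhds hus h.us_lt)] with v hv hvI
  rwa [← hcoe v hvI.1 hvI.2.le, ← hcoe us hus h.us_lt.le, EReal.coe_lt_coe_iff] at hv

theorem isFrontierPair (h : IsTechnology F₀ F₁ u₀ u₁ us) :
    IsFrontierPair (realFrontier F₀) (realFrontier F₁) (effDomain F₀ ∩ Icc 0 u₀)
      (effDomain F₁ ∩ Icc 0 u₀) u₀ u₁ us where
  us_nonneg := h.us_nonneg
  us_lt := h.us_lt
  u₁_nonneg := h.new.peak_nonneg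
  u₁_lt := h.conflict
  Ioc_subset u hu := ⟨h.mem_old hu.1 hu.2, hu.1.le, hu.2⟩
  subset_new := inter_subset_inter_left _ h.effDomain_subset
  subset_Icc := inter_subset_right
  concaveOn_old := h.old.concaveOn.subset inter_subset_left
    (h.old.concaveOn.1.inter (convex_Icc 0 u₀))
  concaveOn_new := h.new.concaveOn.subset inter_subset_left
    (h.new.concaveOn.1.inter (convex_Icc 0 u₀))
  measurable_old := h.old.measurable_realFrontier
  strictMonoOn_old := h.old.strictMonoOn.mono (inter_subset_inter_right _ Icc_subset_Iic_self)
  strictAntiOn_new := h.new.strictAntiOn.mono fun _ hv => ⟨h.Icc_subset_new hv, hv.1⟩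
  lt_of_supergradOn u s η hus hu hs hη := by
    have hu0 : 0 < u := h.us_nonneg.trans_lt hus
    have hN : Icc 0 u₀ ∈ 𝓝 u := Icc_mem_nhds hu0 hu
    exact h.lt_of_supergradOn ⟨hus, hu⟩ (.of_inter h.old.concaveOn (h.mem_old hu0 hu.le) hN hs)
      (.of_inter h.new.concaveOn (h.mem_new hu0 hu.le) hN hη)
  exists_shared hus :=
    have ⟨η, h₀, h₁⟩ := h.exists_shared hus
    ⟨η, fun v hv => h₀ v hv.1, fun v hv => h₁ v hv.1⟩
  strict_max := h.eventually_sub_lt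

end IsTechnology

section EIntegral

variable {α : Type*} [MeasurableSpace α] {μ : Measure α} {f g : α → EReal} {h : α → ℝ}

theorem eintegral_mono_ae (hfg : f ≤ᵐ[μ] g) : eintegral μ f ≤ eintegral μ g := by
  refine EReal.sub_le_sub ?_ ?_
  · exact_mod_cast lintegral_mono_ae (hfg.mono fun a ha => EReal.toENNReal_le_toENNReal ha)
  · exact_mod_cast lintegral_mono_ae (hfg.mono fun a ha =>
      EReal.toENNReal_le_toENNReal (EReal.neg_le_neg_iff.2 ha))

theorem eintegral_congr_ae (hfg : f =ᵐ[μ] g) : eintegral μ f = eintegral μ g :=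
  le_antisymm (eintegral_mono_ae hfg.le) (eintegral_mono_ae hfg.symm.le)

theorem eintegral_coe (hh : Integrable h μ) :
    eintegral μ (fun a => (h a : EReal)) = ((∫ a, h a ∂μ : ℝ) : EReal) := by
  have hpos : ∫⁻ a, ENNReal.ofReal (h a) ∂μ ≠ ∞ := hh.lintegral_lt_top.ne
  have hneg : ∫⁻ a, ENNReal.ofReal (-h a) ∂μ ≠ ∞ := hh.neg.lintegral_lt_top.ne
  unfold eintegral
  simp only [← EReal.coe_neg, EReal.real_coe_toENNReal]
  rw [integral_eq_lintegral_pos_part_sub_lintegral_neg_part hh, EReal.coe_sub,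
    EReal.coe_ennreal_toReal hpos, EReal.coe_ennreal_toReal hneg]

theorem eintegral_dirac [MeasurableSingletonClass α] (a : α) :
    eintegral (Measure.dirac a) f = f a := by
  unfold eintegral
  rw [lintegral_dirac, lintegral_dirac]
  rcases le_total 0 (f a) with h | h
  · rw [EReal.coe_toENNReal h, EReal.toENNReal_of_nonpos (EReal.neg_le_zero.2 h)]
    simp
  · rw [EReal.toENNReal_of_nonpos h, EReal.coe_toENNReal (EReal.neg_nonneg.2 h)]
    simp

theorem lintegral_toENNReal_ne_top (hh : Integrable h μ) (hfh : ∀ᵐ a ∂μ, f a ≤ h a) :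
    ∫⁻ a, (f a).toENNReal ∂μ ≠ ∞ := by
  refine ne_top_of_le_ne_top hh.lintegral_lt_top.ne (lintegral_mono_ae (hfh.mono fun a ha => ?_))
  rw [← EReal.real_coe_toENNReal]
  exact EReal.toENNReal_le_toENNReal ha

theorem lintegral_toENNReal_neg_ne_top (hbot : eintegral μ f ≠ ⊥) :
    ∫⁻ a, (-f a).toENNReal ∂μ ≠ ∞ := fun htop =>
  hbot (by rw [eintegral, htop, EReal.coe_ennreal_top, EReal.sub_top])

theorem ae_eq_coe_toReal_of_eintegral_ne_bot (hf : AEMeasurable f μ) (hfh : ∀ᵐ a ∂μ, f a ≤ h a)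
    (hbot : eintegral μ f ≠ ⊥) : ∀ᵐ a ∂μ, f a = ((f a).toReal : EReal) := by
  filter_upwards [hfh, ae_lt_top' hf.neg.ereal_toENNReal (lintegral_toENNReal_neg_ne_top hbot)]
    with a hle hlt
  refine (EReal.coe_toReal (hle.trans_lt (EReal.coe_lt_top _)).ne ?_).symm
  rintro heq
  simp [heq] at hlt

theorem integrable_toReal_of_eintegral_ne_bot (hf : AEMeasurable f μ) (hh : Integrable h μ)
    (hfh : ∀ᵐ a ∂μ, f a ≤ h a) (hbot : eintegral μ f ≠ ⊥) :
    Integrable (fun a => (f a).toReal) μ := by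
  refine ⟨hf.ereal_toReal.aestronglyMeasurable, ?_⟩
  calc ∫⁻ a, ‖(f a).toReal‖ₑ ∂μ
      ≤ ∫⁻ a, ((f a).toENNReal + (-f a).toENNReal) ∂μ := by
        refine lintegral_mono_ae ?_
        filter_upwards [ae_eq_coe_toReal_of_eintegral_ne_bot hf hfh hbot] with a ha
        rw [ha, ← EReal.coe_neg, EReal.real_coe_toENNReal, EReal.real_coe_toENNReal,
          EReal.toReal_coe, Real.enorm_eq_ofReal_abs]
        rcases abs_cases (f a).toReal with habs | habs <;> rw [habs.1]
        exacts [le_self_add, le_add_self]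
    _ < ∞ := by
        have hneg : AEMeasurable (fun a => (-f a).toENNReal) μ := hf.neg.ereal_toENNReal
        rw [lintegral_add_right' _ hneg]
        exact ENNReal.add_lt_top.2 ⟨(lintegral_toENNReal_ne_top hh hfh).lt_top,
          (lintegral_toENNReal_neg_ne_top hbot).lt_top⟩

theorem ae_eq_of_eintegral_eq (hf : AEMeasurable f μ) (hg : AEMeasurable g μ) (hh : Integrable h μ)
    (hfg : f ≤ᵐ[μ] g) (hgh : ∀ᵐ a ∂μ, g a ≤ h a) (hbot : eintegral μ f ≠ ⊥)
    (heq : eintegral μ f = eintegral μ g) : f =ᵐ[μ] g := by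
  have hfh : ∀ᵐ a ∂μ, f a ≤ h a := by
    filter_upwards [hfg, hgh] with a hle hle' using hle.trans hle'
  have hf_coe := ae_eq_coe_toReal_of_eintegral_ne_bot hf hfh hbot
  have hf_int := integrable_toReal_of_eintegral_ne_bot hf hh hfh hbot
  have hg_coe := ae_eq_coe_toReal_of_eintegral_ne_bot hg hgh (heq ▸ hbot)
  have hg_int := integrable_toReal_of_eintegral_ne_bot hg hh hgh (heq ▸ hbot)
  rw [eintegral_congr_ae hf_coe, eintegral_congr_ae hg_coe, eintegral_coe hf_int,
    eintegral_coe hg_int, EReal.coe_eq_coe_iff] at heq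
  have hle : (fun a => (f a).toReal) ≤ᵐ[μ] fun a => (g a).toReal := by
    filter_upwards [hfg, hf_coe, hg_coe] with a hle hfa hga
    rwa [hfa, hga, EReal.coe_le_coe_iff] at hle
  filter_upwards [(integral_eq_iff_of_ae_le hf_int hg_int hle).1 heq, hf_coe, hg_coe]
    with a ha hfa hga
  rw [hfa, hga, EReal.coe_eq_coe_iff]
  exact ha

end EIntegral

open ProbabilityTheory

section Exponential

variable {r : ℝ}

theorem expMeasure_eq_withDensity (r : ℝ) : expMeasure r =
    (volume.restrict (Ioi 0)).withDensity fun t => ENNReal.ofReal (r * Real.exp (-r * t)) := by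
  rw [← withDensity_indicator measurableSet_Ioi]
  refine withDensity_congr_ae ?_
  filter_upwards [compl_mem_ae_iff.2 (measure_singleton (μ := volume) (0 : ℝ))] with t ht
  change exponentialPDF r t = _
  rcases lt_or_gt_of_ne ht with hneg | hpos
  · rw [exponentialPDF_of_neg hneg, indicator_of_notMem (notMem_Ioi.2 hneg.le)]
  · rw [exponentialPDF_of_nonneg hpos.le, indicator_of_mem (mem_Ioi.2 hpos), neg_mul]

theorem setLIntegral_expMeasure (r : ℝ) {S : Set ℝ} (hS : MeasurableSet S) (φ : ℝ → ℝ≥0∞) :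
    ∫⁻ s in S, φ s ∂(expMeasure r) =
      ∫⁻ s in S ∩ Ioi 0, ENNReal.ofReal (r * Real.exp (-r * s)) * φ s := by
  rw [expMeasure_eq_withDensity, restrict_withDensity hS, Measure.restrict_restrict hS,
    lintegral_withDensity_eq_lintegral_mul_non_measurable _ (by fun_prop)
      (ae_of_all _ fun s => ENNReal.ofReal_lt_top)]
  rfl

theorem measureReal_expMeasure_Ioi (hr : 0 < r) {t : ℝ} (ht : 0 ≤ t) :
    (expMeasure r).real (Ioi t) = Real.exp (-r * t) := by
  have := isProbabilityMeasure_expMeasure hr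
  rw [← compl_Iic, probReal_compl_eq_one_sub measurableSet_Iic, ← cdf_eq_real,
    cdf_expMeasure_eq hr, if_pos ht, neg_mul, sub_sub_cancel]

theorem ae_expMeasure_iff (hr : 0 < r) {p : ℝ → Prop} :
    (∀ᵐ t ∂(expMeasure r), p t) ↔ ∀ᵐ t ∂(volume.restrict (Ici (0 : ℝ))), p t := by
  rw [expMeasure_eq_withDensity, ae_withDensity_iff (by fun_prop),
    Measure.restrict_congr_set Ioi_ae_eq_Ici]
  refine eventually_congr (ae_of_all _ fun t => ⟨fun h => h ?_, fun h _ => h⟩)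
  exact (ENNReal.ofReal_pos.2 (by positivity)).ne'

theorem expMeasure_eq_zero_iff (hr : 0 < r) {S : Set ℝ} :
    expMeasure r S = 0 ↔ volume.restrict (Ici 0) S = 0 := by
  rw [measure_eq_zero_iff_ae_notMem, measure_eq_zero_iff_ae_notMem, ae_expMeasure_iff hr]

theorem isDiscountMeasure_expMeasure (hr : 0 < r) : IsDiscountMeasure (expMeasure r) where
  toIsProbabilityMeasure := isProbabilityMeasure_expMeasure hr
  measure_singleton t := (expMeasure_eq_zero_iff hr).2 (measure_singleton t)
  measure_Iic_zero := by
    rw [expMeasure_eq_zero_iff hr, Measure.restrict_apply measurableSet_Iic, inter_comm,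
      Ici_inter_Iic, Icc_self, measure_singleton]
  measure_Ioc_pos a b ha hab := by
    rw [pos_iff_ne_zero, Ne, expMeasure_eq_zero_iff hr, Measure.restrict_apply measurableSet_Ioc,
      inter_eq_left.2 fun t ht => mem_Ici.2 (ha.trans ht.1.le), Real.volume_Ioc]
    exact (ENNReal.ofReal_pos.2 (sub_pos.2 hab)).ne'

theorem eintegral_Ioo_mul_exp (hr : 0 < r) (τ : ℝ) (f : ℝ → EReal) :
    eintegral (volume.restrict (Ioo 0 τ)) (fun t => ((r * Real.exp (-r * t) : ℝ) : EReal) * f t) =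
      eintegral ((expMeasure r).restrict (Iic τ)) f := by
  have hpos : ∀ t, (0 : EReal) ≤ ((r * Real.exp (-r * t) : ℝ) : EReal) := fun t => by
    exact_mod_cast (by positivity : 0 ≤ r * Real.exp (-r * t))
  have hset : volume.restrict (Ioo 0 τ) = volume.restrict (Iic τ ∩ Ioi (0 : ℝ)) := by
    rw [inter_comm, Ioi_inter_Iic, Measure.restrict_congr_set Ioo_ae_eq_Ioc]
  unfold eintegral
  rw [setLIntegral_expMeasure r measurableSet_Iic, setLIntegral_expMeasure r measurableSet_Iic,
    hset]
  simp only [← mul_neg, EReal.toENNReal_mul (hpos _), EReal.real_coe_toENNReal]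

end Exponential

theorem coe_add_coe_mul_right_injective {a c : ℝ} (hc : 0 < c) :
    Function.Injective fun x : EReal => (a : EReal) + c * x := by
  intro x y h
  have hmul : (c : EReal) * x = c * y := by
    simpa only [EReal.add_sub_cancel_left] using congrArg (· - (a : EReal)) h
  have hcancel : ∀ z : EReal, (c : EReal) * z / c = z := fun z => by
    rw [← EReal.mul_div,
      EReal.mul_div_cancel (EReal.coe_ne_bot c) (EReal.coe_ne_top c) (by exact_mod_cast hc.ne')]
  rw [← hcancel x, hmul, hcancel]

section RewardValue

variable {F : ℝ → EReal} {p : ℝ} {X Y : ℝ≥0∞}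

/-- The value `F(X)` of a reward `X ∈ [0,∞]`, with the convention `F(∞) = -∞`. -/
noncomputable def rewardValue (F : ℝ → EReal) (X : ℝ≥0∞) : EReal :=
  if X = ∞ then ⊥ else F X.toReal

theorem rewardValue_ofReal {c : ℝ} (hc : 0 ≤ c) : rewardValue F (ENNReal.ofReal c) = F c := by
  rw [rewardValue, if_neg ENNReal.ofReal_ne_top, ENNReal.toReal_ofReal hc]

theorem IsFrontier.rewardValue_le_peak (hF : IsFrontier F p) : rewardValue F X ≤ F p := by
  rw [rewardValue]
  split_ifs
  exacts [bot_le, hF.le_peak ENNReal.toReal_nonneg]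

theorem IsFrontier.rewardValue_lt_of_mem_uIcc (hF : IsFrontier F p) (hY : Y.toReal ∈ effDomain F)
    (h : Y ∈ uIcc X (ENNReal.ofReal p)) (hne : Y ≠ X) : rewardValue F X < rewardValue F Y := by
  have hYtop : Y ≠ ∞ := by
    rintro rfl
    rcases le_max_iff.1 h.2 with htop | htop
    · exact hne (top_le_iff.1 htop).symm
    · exact ENNReal.ofReal_ne_top (top_le_iff.1 htop)
  rw [rewardValue, rewardValue, if_neg hYtop]
  split_ifs with hX
  · exact bot_lt_iff_ne_bot.2 hY.2
  by_cases hbot : F X.toReal = ⊥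
  · exact hbot ▸ bot_lt_iff_ne_bot.2 hY.2
  have hXmem : X.toReal ∈ effDomain F := ⟨ENNReal.toReal_nonneg, hbot⟩
  rw [← hF.coe_realFrontier hXmem, ← hF.coe_realFrontier hY, EReal.coe_lt_coe_iff]
  refine hF.realFrontier_lt_of_mem_uIcc hXmem ?_ fun heq =>
    hne ((ENNReal.toReal_eq_toReal_iff' hYtop hX).1 heq)
  rcases mem_uIcc.1 h with h | h
  · exact mem_uIcc.2 (Or.inl ⟨ENNReal.toReal_mono hYtop h.1,
      ENNReal.toReal_le_of_le_ofReal hF.peak_nonneg h.2⟩)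
  · exact mem_uIcc.2 (Or.inr ⟨(ENNReal.ofReal_le_iff_le_toReal hYtop).1 h.1,
      ENNReal.toReal_mono hX h.2⟩)

end RewardValue

theorem IsTimeLaw.ae_nonneg {G : Measure ℝ} (hG : IsTimeLaw G) : ∀ᵐ τ ∂G, 0 ≤ τ :=
  (measure_eq_zero_iff_ae_notMem.1 hG.nonneg).mono fun _ => notMem_Iio.1

theorem isTimeLaw_dirac {τ : ℝ} (hτ : 0 ≤ τ) : IsTimeLaw (Measure.dirac τ) where
  prob := inferInstance
  nonneg := by
    rw [Measure.dirac_apply' _ measurableSet_Iio, indicator_of_notMem (notMem_Iio.2 hτ)]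

theorem measure_Ioi_pos {G : Measure ℝ} (h : ¬ BddAbove G.support) (a : ℝ) : 0 < G (Ioi a) := by
  obtain ⟨y, hy, hay⟩ := not_bddAbove_iff.1 h a
  exact (Measure.mem_support_iff_forall y).1 hy _ (Ioi_mem_nhds hay)

namespace Mechanism

variable {r τ : ℝ} {m m' : Mechanism} {F₀ F₁ : ℝ → EReal} {G : Measure ℝ} {X : ℝ → ℝ≥0∞}

theorem flowValue_eq_lintegral (hr : 0 < r) (m : Mechanism) (t : ℝ) {S : Set ℝ}
    (hS : MeasurableSet S) (hS0 : S ⊆ Ioi 0) : m.flowValue r t S =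
      ENNReal.ofReal (Real.exp (r * t)) * ∫⁻ s in S, ENNReal.ofReal (m.flow s) ∂(expMeasure r) := by
  rw [setLIntegral_expMeasure r hS, inter_eq_left.2 hS0, flowValue,
    ← lintegral_const_mul' _ _ ENNReal.ofReal_ne_top]
  refine lintegral_congr fun s => ?_
  rw [← mul_assoc, ← ENNReal.ofReal_mul (Real.exp_pos _).le, ← ENNReal.ofReal_mul (by positivity)]
  congr 1
  rw [show -r * (s - t) = r * t + -r * s by ring, Real.exp_add]
  ring

theorem flowValue_eq_integral_div (hr : 0 < r) (hm : Integrable m.flow (expMeasure r))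
    (h0 : ∀ t, 0 ≤ m.flow t) {t : ℝ} (ht : 0 ≤ t) {S : Set ℝ} (hS : MeasurableSet S)
    (hS0 : S ⊆ Ioi 0) : m.flowValue r t S =
      ENNReal.ofReal ((∫ s in S, m.flow s ∂(expMeasure r)) / (expMeasure r).real (Ioi t)) := by
  rw [flowValue_eq_lintegral hr m t hS hS0, ← ofReal_integral_eq_lintegral_ofReal hm.integrableOn
    (ae_of_all _ h0), ← ENNReal.ofReal_mul (Real.exp_pos _).le, measureReal_expMeasure_Ioi hr ht,
    neg_mul, Real.exp_neg, div_inv_eq_mul, mul_comm]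

theorem flowValue_congr (hr : 0 < r) (h : m.flow =ᵐ[expMeasure r] m'.flow) (t : ℝ) {S : Set ℝ}
    (hS : MeasurableSet S) (hS0 : S ⊆ Ioi 0) : m.flowValue r t S = m'.flowValue r t S := by
  rw [flowValue_eq_lintegral hr m t hS hS0, flowValue_eq_lintegral hr m' t hS hS0]
  congr 1
  exact lintegral_congr_ae (ae_restrict_of_ae (h.mono fun s hs => by simp only [hs]))

theorem payoffAt_eq (hr : 0 < r) (F₀ F₁ : ℝ → EReal) (m : Mechanism) (hτ : 0 ≤ τ) :
    m.payoffAt F₀ F₁ r τ = eintegral ((expMeasure r).restrict (Iic τ)) (fun t => F₀ (m.flow t)) +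
      (((expMeasure r).real (Ioi τ) : ℝ) : EReal) * rewardValue F₁ (m.reward τ) := by
  rw [payoffAt, eintegral_Ioo_mul_exp hr, measureReal_expMeasure_Ioi hr hτ, rewardValue]

theorem payoffAt_mono (hr : 0 < r) (hτ : 0 ≤ τ)
    (hflow : ∀ᵐ t ∂(expMeasure r), F₀ (m.flow t) ≤ F₀ (m'.flow t))
    (hreward : rewardValue F₁ (m.reward τ) ≤ rewardValue F₁ (m'.reward τ)) :
    m.payoffAt F₀ F₁ r τ ≤ m'.payoffAt F₀ F₁ r τ := by
  rw [payoffAt_eq hr _ _ _ hτ, payoffAt_eq hr _ _ _ hτ]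
  exact add_le_add (eintegral_mono_ae (ae_restrict_of_ae hflow))
    (mul_le_mul_of_nonneg_left hreward (by exact_mod_cast measureReal_nonneg))

theorem payoffAt_congr (hr : 0 < r) (hτ : 0 ≤ τ) (hflow : m.flow =ᵐ[expMeasure r] m'.flow)
    (hreward : m.reward τ = m'.reward τ) : m.payoffAt F₀ F₁ r τ = m'.payoffAt F₀ F₁ r τ :=
  le_antisymm (payoffAt_mono hr hτ (hflow.mono fun _ ht => (congrArg F₀ ht).le) (hreward ▸ le_rfl))
    (payoffAt_mono hr hτ (hflow.mono fun _ ht => (congrArg F₀ ht).ge) (hreward ▸ le_rfl))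

theorem payoff_mono (hG : IsTimeLaw G)
    (h : ∀ τ, 0 ≤ τ → m.payoffAt F₀ F₁ r τ ≤ m'.payoffAt F₀ F₁ r τ) :
    m.payoff F₀ F₁ r G ≤ m'.payoff F₀ F₁ r G :=
  eintegral_mono_ae (hG.ae_nonneg.mono h)

theorem IC.congr (hr : 0 < r) (hflow : m.flow =ᵐ[expMeasure r] m'.flow)
    (hreward : ∀ t, 0 ≤ t → m.reward t = m'.reward t) (h : m.IC r) : m'.IC r := by
  intro t ht
  obtain ⟨hdelay, hnever⟩ := h t ht
  rw [← flowValue_congr hr hflow t measurableSet_Ioi (Ioi_subset_Ioi ht), ← hreward t ht]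
  refine ⟨fun d hd => ?_, hnever⟩
  rw [← flowValue_congr hr hflow t measurableSet_Ioo fun s hs => mem_Ioi.2 (ht.trans_lt hs.1),
    ← hreward (t + d) (by positivity)]
  exact hdelay d hd

theorem Optimal.congr (hr : 0 < r) (hG : IsTimeLaw G) (hflow : m.flow =ᵐ[expMeasure r] m'.flow)
    (hreward : ∀ t, 0 ≤ t → m.reward t = m'.reward t) (h : m.Optimal F₀ F₁ r G) :
    m'.Optimal F₀ F₁ r G := by
  have hpayoff : ∀ G', IsTimeLaw G' → m'.payoff F₀ F₁ r G' = m.payoff F₀ F₁ r G' := fun G' hG' =>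
    eintegral_congr_ae (hG'.ae_nonneg.mono fun τ hτ =>
      (payoffAt_congr hr hτ hflow (hreward τ hτ)).symm)
  obtain ⟨hIC, hmax, -, hund⟩ := h
  have hIC' := hIC.congr hr hflow hreward
  refine ⟨hIC', fun n hn => (hmax n hn).trans_eq (hpayoff G hG).symm, hIC', ?_⟩
  rintro n hn ⟨hle, G', hG', hlt⟩
  exact hund n hn ⟨fun K hK => hpayoff K hK ▸ hle K hK, G', hG', hpayoff G' hG' ▸ hlt⟩

theorem Undominated.payoffAt_eq (hm : m.Undominated F₀ F₁ r) (hm' : m'.IC r)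
    (h : ∀ τ, 0 ≤ τ → m.payoffAt F₀ F₁ r τ ≤ m'.payoffAt F₀ F₁ r τ) (hτ : 0 ≤ τ) :
    m'.payoffAt F₀ F₁ r τ = m.payoffAt F₀ F₁ r τ := by
  by_contra hne
  refine hm.2 m' hm' ⟨fun G hG => payoff_mono hG h, Measure.dirac τ, isTimeLaw_dirac hτ, ?_⟩
  rw [payoff, payoff, eintegral_dirac, eintegral_dirac]
  exact lt_of_le_of_ne (h τ hτ) (Ne.symm hne)

/-- The mechanism `m` with its rewards replaced by `X`. -/
def withReward (m : Mechanism) (X : ℝ → ℝ≥0∞) : Mechanism := { m with reward := X }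

theorem IC.withReward_min (h : m.IC r) (hX : (m.withReward X).IC r) :
    (m.withReward fun t => min (m.reward t) (X t)).IC r := by
  refine fun t ht => ⟨fun d hd => le_min ?_ ?_, le_min (h t ht).2 (hX t ht).2⟩
  · refine le_trans ?_ ((h t ht).1 d hd)
    gcongr
    exacts [le_rfl, min_le_left _ _]
  · refine le_trans ?_ ((hX t ht).1 d hd)
    gcongr
    exacts [le_rfl, min_le_right _ _]

/-- The mechanism `m` with its flow capped at `c`. -/
def capFlow (m : Mechanism) {c : ℝ} (hc : 0 ≤ c) : Mechanism where
  flow t := min (m.flow t) c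
  reward := m.reward
  flow_nonneg t ht := le_min (m.flow_nonneg t ht) hc
  flow_meas := m.flow_meas.min aemeasurable_const

theorem IC.capFlow (hr : 0 < r) (h : m.IC r) {c : ℝ} (hc : 0 ≤ c) : (m.capFlow hc).IC r := by
  have hle : ∀ t S, (m.capFlow hc).flowValue r t S ≤ m.flowValue r t S := fun t S =>
    lintegral_mono fun s => ENNReal.ofReal_le_ofReal
      (mul_le_mul_of_nonneg_left (min_le_left _ _) (by positivity))
  exact fun t ht => ⟨fun d hd => (add_le_add_left (hle t _) _).trans ((h t ht).1 d hd),
    (hle t _).trans (h t ht).2⟩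

theorem frequently_payoffAt_ne_bot (hG : ¬ BddAbove G.support) (h : m.payoff F₀ F₁ r G ≠ ⊥) :
    ∃ᶠ τ in atTop, m.payoffAt F₀ F₁ r τ ≠ ⊥ := by
  refine fun hbot => lintegral_toENNReal_neg_ne_top h ?_
  obtain ⟨a, ha⟩ := eventually_atTop.1 hbot
  rw [eq_top_iff]
  calc ∞ = ∞ * G (Ioi a) := (ENNReal.top_mul (measure_Ioi_pos hG a).ne').symm
    _ = ∫⁻ _ in Ioi a, ∞ ∂G := by rw [setLIntegral_const]
    _ ≤ ∫⁻ τ in Ioi a, (-m.payoffAt F₀ F₁ r τ).toENNReal ∂G :=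
      setLIntegral_mono' measurableSet_Ioi fun τ hτ => by
        rw [not_not.1 (ha τ (le_of_lt hτ)), EReal.neg_bot, EReal.toENNReal_top]
    _ ≤ ∫⁻ τ, (-m.payoffAt F₀ F₁ r τ).toENNReal ∂G := setLIntegral_le_lintegral _ _

end Mechanism

/-- The flows of an undominated mechanism: with values in `[0, u₀]`, and with a finite payoff before
any given time under exponential discounting. -/
abbrev FeasibleFlow (F₀ : ℝ → EReal) (r u₀ : ℝ) (x : ℝ → ℝ) : Prop :=
  Admissible (expMeasure r) (realFrontier F₀) (effDomain F₀ ∩ Icc 0 u₀) u₀ x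

/-- The mechanism with the admissible flow `x` and the finite rewards `R`. -/
noncomputable def Admissible.mechanism {μ : Measure ℝ} {f₀ : ℝ → ℝ} {I₀ : Set ℝ} {u₀ : ℝ}
    {x : ℝ → ℝ} (hx : Admissible μ f₀ I₀ u₀ x) (R : ℝ → ℝ) : Mechanism where
  flow := x
  reward t := ENNReal.ofReal (R t)
  flow_nonneg t _ := hx.nonneg t
  flow_meas := hx.measurable.aemeasurable

/-- The gain from disclosing at time `t` for the reward `R t` over never disclosing, discounted to
time `0`. -/
noncomputable def discountedRent (μ : Measure ℝ) (x R : ℝ → ℝ) (t : ℝ) : ℝ :=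
  μ.real (Ioi t) * R t - tailValue μ x t

theorem discountedRent_const {μ : Measure ℝ} [IsFiniteMeasure μ] {x : ℝ → ℝ} (hx : Integrable x μ)
    (c : ℝ) : discountedRent μ x (fun _ => c) = tailValue μ fun t => c - x t := by
  funext t
  rw [discountedRent, ← tailValue_const]
  exact (integral_sub (integrable_const c).integrableOn hx.integrableOn).symm

section FeasibleFlow

variable {r u₀ τ t d : ℝ} {F₀ F₁ : ℝ → EReal} {x R : ℝ → ℝ}

theorem mechanism_delay_iff (hr : 0 < r) (hx : FeasibleFlow F₀ r u₀ x) (hR : ∀ t, 0 ≤ t → 0 ≤ R t)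
    (ht : 0 ≤ t) (hd : 0 ≤ d) :
    (hx.mechanism R).flowValue r t (Ioo t (t + d)) +
        ENNReal.ofReal (Real.exp (-r * d)) * (hx.mechanism R).reward (t + d) ≤
        (hx.mechanism R).reward t ↔
      discountedRent (expMeasure r) x R (t + d) ≤ discountedRent (expMeasure r) x R t := by
  have := isDiscountMeasure_expMeasure hr
  have hq : 0 < (expMeasure r).real (Ioi t) := measureReal_Ioi_pos t
  have hq_add : (expMeasure r).real (Ioi (t + d)) =
      (expMeasure r).real (Ioi t) * Real.exp (-r * d) := by
    rw [measureReal_expMeasure_Ioi hr ht, measureReal_expMeasure_Ioi hr (by positivity),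
      ← Real.exp_add, mul_add]
  have hflow : (hx.mechanism R).flowValue r t (Ioo t (t + d)) = ENNReal.ofReal
      ((tailValue (expMeasure r) x t - tailValue (expMeasure r) x (t + d)) /
        (expMeasure r).real (Ioi t)) := by
    rw [tailValue_sub_tailValue hx.integrable (le_add_of_nonneg_right hd),
      integral_Ioc_eq_integral_Ioo]
    exact Mechanism.flowValue_eq_integral_div hr hx.integrable hx.nonneg ht measurableSet_Ioo
      fun s hs => mem_Ioi.2 (ht.trans_lt hs.1)
  have htail : 0 ≤ tailValue (expMeasure r) x t - tailValue (expMeasure r) x (t + d) := by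
    rw [tailValue_sub_tailValue hx.integrable (le_add_of_nonneg_right hd)]
    exact integral_nonneg hx.nonneg
  have hR' := hR (t + d) (by positivity)
  rw [hflow, Admissible.mechanism, ← ENNReal.ofReal_mul (Real.exp_pos _).le,
    ← ENNReal.ofReal_add (by positivity) (by positivity), ENNReal.ofReal_le_ofReal_iff (hR t ht),
    div_add' _ _ _ hq.ne', div_le_iff₀ hq, discountedRent, discountedRent, hq_add]
  constructor <;> intro h <;> linarith

theorem mechanism_never_iff (hr : 0 < r) (hx : FeasibleFlow F₀ r u₀ x) (hR : ∀ t, 0 ≤ t → 0 ≤ R t)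
    (ht : 0 ≤ t) : (hx.mechanism R).flowValue r t (Ioi t) ≤ (hx.mechanism R).reward t ↔
      0 ≤ discountedRent (expMeasure r) x R t := by
  have := isDiscountMeasure_expMeasure hr
  rw [Mechanism.flowValue_eq_integral_div (m := hx.mechanism R) hr hx.integrable hx.nonneg ht
    measurableSet_Ioi (Ioi_subset_Ioi ht), Admissible.mechanism,
    ENNReal.ofReal_le_ofReal_iff (hR t ht),
    div_le_iff₀' (measureReal_Ioi_pos (μ := expMeasure r) t), discountedRent, sub_nonneg, tailValue]

theorem mechanism_ic_iff (hr : 0 < r) (hx : FeasibleFlow F₀ r u₀ x) (hR : ∀ t, 0 ≤ t → 0 ≤ R t) :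
    (hx.mechanism R).IC r ↔ AntitoneOn (discountedRent (expMeasure r) x R) (Ici 0) ∧
      ∀ t, 0 ≤ t → 0 ≤ discountedRent (expMeasure r) x R t := by
  constructor
  · refine fun h => ⟨fun a ha b hb hab => ?_, fun t ht =>
      (mechanism_never_iff hr hx hR ht).1 (h t ht).2⟩
    rcases hab.eq_or_lt with rfl | hlt
    · exact le_rfl
    have hd := sub_pos.2 hlt
    simpa only [add_sub_cancel] using (mechanism_delay_iff hr hx hR ha hd.le).1 ((h a ha).1 _ hd)
  · rintro ⟨hanti, hnonneg⟩ t ht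
    exact ⟨fun d hd => (mechanism_delay_iff hr hx hR ht hd.le).2
      (hanti ht (mem_Ici.2 (by positivity)) (le_add_of_nonneg_right hd.le)),
      (mechanism_never_iff hr hx hR ht).2 (hnonneg t ht)⟩

theorem mechanism_const_ic (hr : 0 < r) (hx : FeasibleFlow F₀ r u₀ x) :
    (hx.mechanism fun _ => u₀).IC r := by
  have := isDiscountMeasure_expMeasure hr
  have hgap : Integrable (fun s => u₀ - x s) (expMeasure r) :=
    (integrable_const u₀).sub hx.integrable
  have hgap0 : ∀ s, 0 ≤ u₀ - x s := fun s => sub_nonneg.2 (hx.le s)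
  rw [mechanism_ic_iff hr hx fun _ _ => (hx.nonneg 0).trans (hx.le 0),
    discountedRent_const hx.integrable]
  refine ⟨fun a _ b _ hab => sub_nonneg.1 ?_, fun t _ => integral_nonneg hgap0⟩
  rw [tailValue_sub_tailValue hgap hab]
  exact integral_nonneg hgap0

theorem eintegral_feasibleFlow {p : ℝ} (hF : IsFrontier F₀ p) (hx : FeasibleFlow F₀ r u₀ x)
    (τ : ℝ) : eintegral ((expMeasure r).restrict (Iic τ)) (fun t => F₀ (x t)) =
      ((∫ t in Iic τ, realFrontier F₀ (x t) ∂(expMeasure r) : ℝ) : EReal) := by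
  rw [← eintegral_coe (hx.integrableOn τ)]
  exact eintegral_congr_ae (ae_restrict_of_ae (hx.ae_mem.mono fun t ht =>
    (hF.coe_realFrontier ht.1).symm))

theorem mechanism_payoffAt {p : ℝ} (hr : 0 < r) (hF : IsFrontier F₀ p) (hx : FeasibleFlow F₀ r u₀ x)
    (hτ : 0 ≤ τ) (hR : 0 ≤ R τ) : (hx.mechanism R).payoffAt F₀ F₁ r τ =
      ((∫ t in Iic τ, realFrontier F₀ (x t) ∂(expMeasure r) : ℝ) : EReal) +
        (((expMeasure r).real (Ioi τ) : ℝ) : EReal) * F₁ (R τ) := by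
  rw [Mechanism.payoffAt_eq hr _ _ _ hτ, ← rewardValue_ofReal (F := F₁) hR,
    ← eintegral_feasibleFlow hF hx]
  rfl

end FeasibleFlow

theorem ae_of_frequently_ae_le {μ : Measure ℝ} {p : ℝ → Prop}
    (h : ∃ᶠ τ in atTop, ∀ᵐ t ∂μ, t ≤ τ → p t) : ∀ᵐ t ∂μ, p t := by
  have hnat : ∀ n : ℕ, ∀ᵐ t ∂μ, t ≤ (n : ℝ) → p t := fun n => by
    obtain ⟨τ, hnτ, hτ⟩ := frequently_atTop.1 h n
    exact hτ.mono fun t ht htn => ht (htn.trans hnτ)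
  filter_upwards [ae_all_iff.2 hnat] with t ht
  obtain ⟨n, hn⟩ := exists_nat_ge t
  exact ht n hn

namespace Mechanism

variable {r u₀ u₁ us τ : ℝ} {m : Mechanism} {F₀ F₁ : ℝ → EReal} {G : Measure ℝ} {X : ℝ → ℝ≥0∞}

theorem Optimal.payoff_ne_bot (hr : 0 < r) (hF : IsTechnology F₀ F₁ u₀ u₁ us) (hG : IsTimeLaw G)
    (hm : m.Optimal F₀ F₁ r G) : m.payoff F₀ F₁ r G ≠ ⊥ := by
  have := isDiscountMeasure_expMeasure hr
  have := hG.prob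
  have hmem : u₀ ∈ effDomain F₀ := hF.old.peak_mem
  have hconst : FeasibleFlow F₀ r u₀ fun _ => u₀ :=
    ⟨measurable_const, fun _ => ⟨hF.u₀_pos.le, le_rfl⟩,
      ae_of_all _ fun _ => ⟨hmem, hF.u₀_pos.le, le_rfl⟩, fun _ => integrable_const _⟩
  have hle : ((realFrontier F₀ u₀ : ℝ) : EReal) ≤ m.payoff F₀ F₁ r G := calc
    ((realFrontier F₀ u₀ : ℝ) : EReal)
      = eintegral G fun _ => ((realFrontier F₀ u₀ : ℝ) : EReal) := by
        rw [eintegral_coe (integrable_const _), integral_const, probReal_univ, one_smul]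
    _ ≤ (hconst.mechanism fun _ => u₀).payoff F₀ F₁ r G := by
        refine eintegral_mono_ae (hG.ae_nonneg.mono fun τ hτ => ?_)
        have hnew : realFrontier F₀ u₀ ≤ realFrontier F₁ u₀ := by
          rw [← EReal.coe_le_coe_iff, hF.old.coe_realFrontier hmem,
            hF.new.coe_realFrontier (hF.effDomain_subset hmem)]
          exact hF.old_le_new u₀ hF.u₀_pos.le
        have hsum : (expMeasure r).real (Iic τ) + (expMeasure r).real (Ioi τ) = 1 := by
          simpa only [compl_Iic] using probReal_add_probReal_compl (measurableSet_Iic (a := τ))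
        rw [mechanism_payoffAt hr hF.old hconst hτ hF.u₀_pos.le,
          ← hF.new.coe_realFrontier (hF.effDomain_subset hmem), ← EReal.coe_mul, ← EReal.coe_add,
          EReal.coe_le_coe_iff, setIntegral_const, smul_eq_mul]
        calc realFrontier F₀ u₀ = (expMeasure r).real (Iic τ) * realFrontier F₀ u₀ +
              (expMeasure r).real (Ioi τ) * realFrontier F₀ u₀ := by rw [← add_mul, hsum, one_mul]
          _ ≤ _ := by gcongr
    _ ≤ m.payoff F₀ F₁ r G := hm.2.1 _ (mechanism_const_ic hr hconst)
  exact ((EReal.bot_lt_coe _).trans_le hle).ne'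

end Mechanism

theorem IsFrontier.le_coe_realFrontier_peak {F : ℝ → EReal} {p u : ℝ} (hF : IsFrontier F p)
    (hu : 0 ≤ u) : F u ≤ (realFrontier F p : EReal) :=
  (hF.le_peak hu).trans_eq (hF.coe_realFrontier hF.peak_mem).symm

namespace Mechanism

variable {r u₀ u₁ us τ : ℝ} {m : Mechanism} {F₀ F₁ : ℝ → EReal} {G : Measure ℝ} {X : ℝ → ℝ≥0∞}

theorem aemeasurable_comp_flow (hr : 0 < r) {p : ℝ} (hF : IsFrontier F₀ p) (m : Mechanism) :
    AEMeasurable (fun t => F₀ (m.flow t)) (expMeasure r) := by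
  have hac : expMeasure r ≪ volume.restrict (Ici 0) := fun S => (expMeasure_eq_zero_iff hr).2
  refine (hF.measurable_comp_max.comp_aemeasurable (m.flow_meas.mono_ac hac)).congr ?_
  filter_upwards [(ae_expMeasure_iff hr).2 (ae_restrict_mem measurableSet_Ici)] with t ht
  exact congrArg F₀ (max_eq_left (m.flow_nonneg t ht))

theorem ae_flow_nonneg (hr : 0 < r) (m : Mechanism) : ∀ᵐ t ∂(expMeasure r), 0 ≤ m.flow t :=
  ((ae_expMeasure_iff hr).2 (ae_restrict_mem measurableSet_Ici)).mono fun t ht => m.flow_nonneg t ht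

theorem le_capFlow_peak {p t : ℝ} (hF : IsFrontier F₀ p) (ht : 0 ≤ m.flow t) :
    F₀ (m.flow t) ≤ F₀ ((m.capFlow hF.peak_nonneg).flow t) := by
  change F₀ (m.flow t) ≤ F₀ (min (m.flow t) p)
  rcases min_choice (m.flow t) p with h | h <;> rw [h]
  exact hF.le_peak ht

theorem eintegral_flow_ne_bot (hr : 0 < r) (hτ : 0 ≤ τ) (h : m.payoffAt F₀ F₁ r τ ≠ ⊥) :
    eintegral ((expMeasure r).restrict (Iic τ)) (fun t => F₀ (m.flow t)) ≠ ⊥ := by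
  rw [payoffAt_eq hr _ _ _ hτ, EReal.add_ne_bot_iff] at h
  exact h.1

theorem rewardValue_ne_bot (hr : 0 < r) (hτ : 0 ≤ τ) (h : m.payoffAt F₀ F₁ r τ ≠ ⊥) :
    rewardValue F₁ (m.reward τ) ≠ ⊥ := by
  have := isDiscountMeasure_expMeasure hr
  rw [payoffAt_eq hr _ _ _ hτ, EReal.add_ne_bot_iff] at h
  intro hbot
  exact h.2 (by rw [hbot, EReal.coe_mul_bot_of_pos (measureReal_Ioi_pos τ)])

theorem Undominated.eintegral_capFlow_eq (hr : 0 < r) {p : ℝ} (hF₀ : IsFrontier F₀ p)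
    (hF₁ : IsFrontier F₁ u₁) (hm : m.Undominated F₀ F₁ r) (hτ : 0 ≤ τ)
    (hbot : m.payoffAt F₀ F₁ r τ ≠ ⊥) :
    eintegral ((expMeasure r).restrict (Iic τ)) (fun t => F₀ (m.flow t)) =
      eintegral ((expMeasure r).restrict (Iic τ))
        (fun t => F₀ ((m.capFlow hF₀.peak_nonneg).flow t)) := by
  have heq := hm.payoffAt_eq (hm.1.capFlow hr hF₀.peak_nonneg) (fun τ' hτ' =>
    payoffAt_mono hr hτ' ((ae_flow_nonneg hr m).mono fun t => le_capFlow_peak hF₀) le_rfl) hτ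
  have hX := rewardValue_ne_bot hr hτ hbot
  have hXtop : rewardValue F₁ (m.reward τ) ≠ ⊤ := ne_top_of_le_ne_top
    (hF₁.ne_top u₁ hF₁.peak_nonneg) hF₁.rewardValue_le_peak
  rw [Mechanism.payoffAt_eq hr _ _ _ hτ, Mechanism.payoffAt_eq hr _ _ _ hτ,
    show (m.capFlow hF₀.peak_nonneg).reward = m.reward from rfl] at heq
  lift rewardValue F₁ (m.reward τ) to ℝ using ⟨hXtop, hX⟩ with X
  rw [← EReal.coe_mul] at heq
  simpa only [EReal.add_sub_cancel_right] using
    (congrArg (· - (((expMeasure r).real (Ioi τ) * X : ℝ) : EReal)) heq).symm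

/-- Capping the flow at `u₀` preserves incentive-compatibility and improves the flow payoff. -/
theorem Undominated.ae_flow_mem (hr : 0 < r) {p : ℝ} (hF₀ : IsFrontier F₀ p)
    (hF₁ : IsFrontier F₁ u₁) (hm : m.Undominated F₀ F₁ r)
    (hfreq : ∃ᶠ τ in atTop, m.payoffAt F₀ F₁ r τ ≠ ⊥) :
    ∀ᵐ t ∂(expMeasure r), m.flow t ∈ effDomain F₀ ∩ Icc 0 p := by
  have := isDiscountMeasure_expMeasure hr
  refine ae_of_frequently_ae_le ((hfreq.and_eventually (eventually_ge_atTop 0)).mono ?_)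
  rintro τ ⟨hbot, hτ⟩
  refine (ae_restrict_iff' (s := Iic τ) measurableSet_Iic).1 ?_
  have hnonneg := ae_restrict_of_ae (s := Iic τ) (ae_flow_nonneg hr m)
  have hflow_bot := eintegral_flow_ne_bot hr hτ hbot
  have hcap := ae_eq_of_eintegral_eq (aemeasurable_comp_flow hr hF₀ m).restrict
    (aemeasurable_comp_flow hr hF₀ (m.capFlow hF₀.peak_nonneg)).restrict (integrable_const _)
    (hnonneg.mono fun t => le_capFlow_peak hF₀)
    (hnonneg.mono fun t ht => hF₀.le_coe_realFrontier_peak (le_min ht hF₀.peak_nonneg)) hflow_bot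
    (hm.eintegral_capFlow_eq hr hF₀ hF₁ hτ hbot)
  filter_upwards [hnonneg, hcap, ae_eq_coe_toReal_of_eintegral_ne_bot
    (aemeasurable_comp_flow hr hF₀ m).restrict
    (hnonneg.mono fun t => hF₀.le_coe_realFrontier_peak) hflow_bot] with t ht hcap_t hcoe
  refine ⟨⟨ht, hcoe ▸ EReal.coe_ne_bot _⟩, ht, ?_⟩
  by_contra! hlt
  refine (hF₀.peak (m.flow t) ht hlt.ne').ne (hcap_t.trans ?_)
  exact congrArg F₀ (min_eq_right hlt.le)

theorem Undominated.exists_feasibleFlow (hr : 0 < r) (hF : IsTechnology F₀ F₁ u₀ u₁ us)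
    (hm : m.Undominated F₀ F₁ r) (hfreq : ∃ᶠ τ in atTop, m.payoffAt F₀ F₁ r τ ≠ ⊥) :
    ∃ x, FeasibleFlow F₀ r u₀ x ∧ m.flow =ᵐ[expMeasure r] x := by
  have := isDiscountMeasure_expMeasure hr
  have hac : expMeasure r ≪ volume.restrict (Ici 0) := fun S => (expMeasure_eq_zero_iff hr).2
  have hflow : AEMeasurable m.flow (expMeasure r) := m.flow_meas.mono_ac hac
  have hmem := hm.ae_flow_mem hr hF.old hF.new hfreq
  have hmx : m.flow =ᵐ[expMeasure r] fun t => max 0 (min (hflow.mk m.flow t) u₀) := by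
    filter_upwards [hmem, hflow.ae_eq_mk] with t ht hmk
    rw [← hmk, min_eq_left ht.2.2, max_eq_right ht.2.1]
  refine ⟨_, ⟨measurable_const.max (hflow.measurable_mk.min measurable_const), fun t =>
    ⟨le_max_left _ _, max_le hF.u₀_pos.le (min_le_right _ _)⟩, ?_, fun a => ?_⟩, hmx⟩
  · filter_upwards [hmem, hmx] with t ht heq using heq ▸ ht
  · obtain ⟨τ, hτ, hbot⟩ := frequently_atTop.1 hfreq (max a 0)
    have hint := integrable_toReal_of_eintegral_ne_bot (aemeasurable_comp_flow hr hF.old m).restrict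
      (integrable_const _) ((ae_restrict_of_ae hmem).mono fun t ht =>
        hF.old.le_coe_realFrontier_peak ht.2.1)
      (eintegral_flow_ne_bot hr ((le_max_right a 0).trans hτ) hbot)
    refine (IntegrableOn.mono_set hint (Iic_subset_Iic.2 ((le_max_left a 0).trans hτ))).congr
      (ae_restrict_of_ae ?_)
    filter_upwards [hmem, hmx] with t ht heq
    rw [← heq, realFrontier, max_eq_left ht.2.1]

theorem Undominated.reward_eq_of_mem_uIcc (hr : 0 < r) (hF : IsTechnology F₀ F₁ u₀ u₁ us)
    (hm : m.Undominated F₀ F₁ r) (hx : FeasibleFlow F₀ r u₀ m.flow) (hX : (m.withReward X).IC r)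
    (h : ∀ τ, 0 ≤ τ → X τ ∈ uIcc (m.reward τ) (ENNReal.ofReal u₁))
    (hle : ∀ τ, 0 ≤ τ → X τ ≤ ENNReal.ofReal u₀) (hτ : 0 ≤ τ) : X τ = m.reward τ := by
  have := isDiscountMeasure_expMeasure hr
  have hmem : ∀ τ, 0 ≤ τ → X τ ≠ m.reward τ → (X τ).toReal ∈ effDomain F₁ := by
    intro τ hτ hne
    rcases eq_or_ne (X τ) 0 with h0 | h0
    · have hu₁ : u₁ = 0 := by
        refine hF.new.peak_nonneg.antisymm' (ENNReal.ofReal_eq_zero.1 ?_)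
        rcases min_le_iff.1 ((h τ hτ).1.trans_eq h0) with hle0 | hle0
        · exact absurd (h0.trans (le_zero_iff.1 hle0).symm) hne
        · exact le_zero_iff.1 hle0
      rw [h0, ENNReal.toReal_zero, ← hu₁]
      exact hF.new.peak_mem
    · have htop := ne_top_of_le_ne_top ENNReal.ofReal_ne_top (hle τ hτ)
      exact hF.mem_new (ENNReal.toReal_pos h0 htop)
        (ENNReal.toReal_le_of_le_ofReal hF.u₀_pos.le (hle τ hτ))
  have hlt : ∀ τ, 0 ≤ τ → X τ ≠ m.reward τ →
      rewardValue F₁ (m.reward τ) < rewardValue F₁ (X τ) := fun τ hτ hne =>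
    hF.new.rewardValue_lt_of_mem_uIcc (hmem τ hτ hne) (h τ hτ) hne
  have hpayoff : (m.withReward X).payoffAt F₀ F₁ r τ = m.payoffAt F₀ F₁ r τ := by
    refine hm.payoffAt_eq hX (fun τ' hτ' =>
      payoffAt_mono hr hτ' (ae_of_all _ fun _ => le_rfl) ?_) hτ
    rcases eq_or_ne (X τ') (m.reward τ') with heq | hne
    exacts [(congrArg _ heq).ge, (hlt τ' hτ' hne).le]
  by_contra hne
  rw [Mechanism.payoffAt_eq hr _ _ _ hτ, Mechanism.payoffAt_eq hr _ _ _ hτ,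
    show (m.withReward X).flow = m.flow from rfl, eintegral_feasibleFlow hF.old hx τ] at hpayoff
  exact (hlt τ hτ hne).ne' (coe_add_coe_mul_right_injective
    (measureReal_Ioi_pos (μ := expMeasure r) τ) hpayoff)

theorem Undominated.reward_le (hr : 0 < r) (hF : IsTechnology F₀ F₁ u₀ u₁ us)
    (hm : m.Undominated F₀ F₁ r) (hx : FeasibleFlow F₀ r u₀ m.flow) (hτ : 0 ≤ τ) :
    m.reward τ ≤ ENNReal.ofReal u₀ := by
  have hcap := hm.reward_eq_of_mem_uIcc hr hF hx (hm.1.withReward_min (mechanism_const_ic hr hx))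
    (fun τ _ => ⟨le_min inf_le_left (inf_le_right.trans (ENNReal.ofReal_le_ofReal hF.conflict.le)),
      (min_le_left _ _).trans le_sup_left⟩) (fun τ _ => min_le_right _ _) hτ
  exact min_eq_left_iff.1 hcap

theorem Optimal.exists_mechanism (hr : 0 < r) (hF : IsTechnology F₀ F₁ u₀ u₁ us) (hG : IsTimeLaw G)
    (hsupp : ¬BddAbove G.support) (hm : m.Optimal F₀ F₁ r G) :
    ∃ x R, ∃ hx : FeasibleFlow F₀ r u₀ x,
      m.flow =ᵐ[expMeasure r] x ∧ (∀ t, 0 ≤ t → R t ∈ Icc 0 u₀) ∧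
      (hx.mechanism R).Optimal F₀ F₁ r G ∧ ∃ᶠ τ in atTop, F₁ (R τ) ≠ ⊥ := by
  have hfreq := frequently_payoffAt_ne_bot hsupp (hm.payoff_ne_bot hr hF hG)
  obtain ⟨x, hx, hmx⟩ := hm.2.2.exists_feasibleFlow hr hF hfreq
  let n : Mechanism := ⟨x, m.reward, fun t _ => hx.nonneg t, hx.measurable.aemeasurable⟩
  have hn : n.Optimal F₀ F₁ r G := hm.congr hr hG hmx fun _ _ => rfl
  have hle : ∀ t, 0 ≤ t → m.reward t ≤ ENNReal.ofReal u₀ := fun t =>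
    Undominated.reward_le (m := n) hr hF hn.2.2 hx
  have hfin : ∀ t, 0 ≤ t → m.reward t ≠ ∞ := fun t ht =>
    ne_top_of_le_ne_top ENNReal.ofReal_ne_top (hle t ht)
  refine ⟨x, fun t => (m.reward t).toReal, hx, hmx, fun t ht => ⟨ENNReal.toReal_nonneg,
    ENNReal.toReal_le_of_le_ofReal hF.u₀_pos.le (hle t ht)⟩, hm.congr hr hG hmx fun t ht =>
      (ENNReal.ofReal_toReal (hfin t ht)).symm, ?_⟩
  refine (hfreq.and_eventually (eventually_ge_atTop 0)).mono ?_
  rintro τ ⟨hbot, hτ⟩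
  simpa only [rewardValue, if_neg (hfin τ hτ)] using rewardValue_ne_bot hr hτ hbot

end Mechanism

/-- A nonnegative decreasing function `D` on `[0, ∞)` is rigid towards `c` if no other such function
lies everywhere between `D` and `c`. In an undominated mechanism the discounted rent is rigid
towards the rent of a reward constantly equal to the peak of `F₁`. -/
structure IsRigidTowards (D c : ℝ → ℝ) : Prop where
  antitoneOn : AntitoneOn D (Ici 0)
  nonneg : ∀ t, 0 ≤ t → 0 ≤ D t
  eq_of_mem_uIcc : ∀ E : ℝ → ℝ, AntitoneOn E (Ici 0) → (∀ t, 0 ≤ t → 0 ≤ E t) →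
    (∀ t, 0 ≤ t → E t ∈ uIcc (D t) (c t)) → ∀ t, 0 ≤ t → E t = D t

namespace IsRigidTowards

variable {D c : ℝ → ℝ} {a b l B : ℝ}

theorem exists_ge_lt (h : IsRigidTowards D c) (ha : 0 ≤ a) (hl : 0 ≤ l) (hla : l < D a) :
    ∃ s, a ≤ s ∧ l < D s ∧ l < c s := by
  by_contra! hc
  have heq := h.eq_of_mem_uIcc (fun t => if t < a then D t else min (D t) l) ?_ ?_ ?_ a ha
  · rw [if_neg (lt_irrefl a), min_eq_right hla.le] at heq
    exact hla.ne heq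
  · intro s hs t ht hst
    have hD := h.antitoneOn hs ht hst
    dsimp only
    split_ifs with hta hsa hsa
    · exact hD
    · exact absurd (hst.trans_lt hta) hsa
    · exact (min_le_left _ _).trans hD
    · exact min_le_min hD le_rfl
  · intro t ht
    split_ifs
    exacts [h.nonneg t ht, le_min (h.nonneg t ht) hl]
  · intro t _
    split_ifs with hta
    · exact left_mem_uIcc
    rcases le_or_gt (D t) l with hDl | hDl
    · rw [min_eq_left hDl]
      exact left_mem_uIcc
    · rw [min_eq_right hDl.le]
      exact mem_uIcc_of_ge (hc t (not_lt.1 hta) hDl) hDl.le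

theorem exists_le_lt (h : IsRigidTowards D c) (hb : 0 ≤ b) (hlb : D b < l) :
    ∃ s, 0 ≤ s ∧ s ≤ b ∧ D s < l ∧ c s < l := by
  by_contra! hc
  have heq := h.eq_of_mem_uIcc (fun t => if t ≤ b then max (D t) l else D t) ?_ ?_ ?_ b hb
  · rw [if_pos le_rfl, max_eq_right hlb.le] at heq
    exact hlb.ne' heq
  · intro s hs t ht hst
    have hD := h.antitoneOn hs ht hst
    dsimp only
    split_ifs with htb hsb hsb
    · exact max_le_max hD le_rfl
    · exact absurd (hst.trans htb) hsb
    · exact hD.trans (le_max_left _ _)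
    · exact hD
  · intro t ht
    split_ifs
    exacts [(h.nonneg t ht).trans (le_max_left _ _), h.nonneg t ht]
  · intro t ht
    split_ifs with htb
    · rcases lt_or_ge (D t) l with hDl | hDl
      · rw [max_eq_right hDl.le]
        exact mem_uIcc_of_le hDl.le (hc t ht htb hDl)
      · rw [max_eq_left hDl]
        exact left_mem_uIcc
    · exact left_mem_uIcc

theorem sub_le (h : IsRigidTowards D c) (ha : 0 ≤ a) (hab : a ≤ b) (hB : 0 ≤ B)
    (hc : ∀ s s', a ≤ s → s ≤ s' → s' ≤ b → c s - c s' ≤ B) : D a - D b ≤ B := by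
  refine le_of_forall_pos_le_add fun ε hε => ?_
  by_contra! hlt
  have hDb := h.nonneg b (ha.trans hab)
  obtain ⟨s, has, hDs, hcs⟩ := h.exists_ge_lt (l := D a - ε / 2) ha (by linarith) (by linarith)
  obtain ⟨s', hs'0, hs'b, hDs', hcs'⟩ :=
    h.exists_le_lt (l := D b + ε / 2) (ha.trans hab) (by linarith)
  have hss' : s ≤ s' := by
    by_contra! hs's
    have := h.antitoneOn hs'0 (ha.trans has) hs's.le
    linarith
  linarith [hc s s' has hss' hs'b]

end IsRigidTowards

theorem IsRigidTowards.sub_le_setIntegral {μ : Measure ℝ} {D c h : ℝ → ℝ} {a b : ℝ}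
    (hD : IsRigidTowards D c) (hh : Integrable h μ) (hh0 : ∀ t, 0 ≤ h t)
    (hc : ∀ s s', 0 ≤ s → s ≤ s' → c s - c s' ≤ ∫ t in Ioc s s', h t ∂μ)
    (ha : 0 ≤ a) (hab : a ≤ b) : D a - D b ≤ ∫ t in Ioc a b, h t ∂μ :=
  hD.sub_le ha hab (integral_nonneg hh0) fun s s' has hss' hs'b =>
    (hc s s' (ha.trans has) hss').trans (setIntegral_mono_set hh.integrableOn (ae_of_all _ hh0)
      (Ioc_subset_Ioc has hs'b).eventuallyLE)

section Density

variable {μ : Measure ℝ} [IsDiscountMeasure μ] {h : ℝ → ℝ}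

theorem stieltjes_measure_le_withDensity (S : StieltjesFunction ℝ) (hh : Integrable h μ)
    (hh0 : ∀ t, 0 ≤ h t) (hle : ∀ a b, a ≤ b → S b - S a ≤ ∫ t in Ioc a b, h t ∂μ) :
    S.measure ≤ μ.withDensity fun t => ENNReal.ofReal (h t) := by
  let K : StieltjesFunction ℝ :=
    { toFun := fun t => -tailValue μ h t - S t
      mono' := fun a b hab => by
        have := hle a b hab
        rw [← tailValue_sub_tailValue hh hab] at this
        dsimp only
        linarith
      right_continuous' := fun t =>
        ((continuous_tailValue hh).neg.continuousWithinAt).sub (S.right_continuous t) }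
  have hfin : (∫⁻ t, ENNReal.ofReal (h t) ∂μ) ≠ ∞ := hh.lintegral_lt_top.ne
  have := isFiniteMeasure_withDensity hfin
  have heq : μ.withDensity (fun t => ENNReal.ofReal (h t)) = S.measure + K.measure := by
    refine Measure.ext_of_Ioc _ _ fun a b hab => ?_
    rw [Measure.add_apply, S.measure_Ioc, K.measure_Ioc, withDensity_apply _ measurableSet_Ioc,
      ← ofReal_integral_eq_lintegral_ofReal hh.integrableOn (ae_of_all _ hh0),
      ← ENNReal.ofReal_add (sub_nonneg.2 (S.mono hab.le)) (sub_nonneg.2 (K.mono hab.le)),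
      ← tailValue_sub_tailValue hh hab.le]
    congr 1
    change _ = S b - S a + ((-tailValue μ h b - S b) - (-tailValue μ h a - S a))
    ring
  rw [heq]
  exact Measure.le_add_right le_rfl

theorem exists_density_of_antitone {H : ℝ → ℝ} (hH : Antitone H) (hh : Integrable h μ)
    (hh0 : ∀ t, 0 ≤ h t) (hle : ∀ a b, a ≤ b → H a - H b ≤ ∫ t in Ioc a b, h t ∂μ) :
    ∃ g : ℝ → ℝ, Measurable g ∧ (∀ t, 0 ≤ g t) ∧ Integrable g μ ∧
      ∀ a b, a ≤ b → ∫ t in Ioc a b, g t ∂μ = H a - H b := by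
  have hright (t : ℝ) : ContinuousWithinAt H (Ici t) t := by
    have hlower : Tendsto (fun s => H t - (tailValue μ h t - tailValue μ h s)) (𝓝[Ici t] t)
        (𝓝 (H t)) := by
      have := continuous_tailValue hh
      have : ContinuousWithinAt (fun s => H t - (tailValue μ h t - tailValue μ h s)) (Ici t) t := by
        fun_prop
      simpa only [ContinuousWithinAt, sub_self, sub_zero] using this
    refine tendsto_of_tendsto_of_tendsto_of_le_of_le' hlower tendsto_const_nhds ?_ ?_
    · filter_upwards [self_mem_nhdsWithin] with s hs
      rw [tailValue_sub_tailValue hh hs]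
      exact sub_le_comm.1 (hle t s hs)
    · exact eventually_nhdsWithin_of_forall fun s hs => hH hs
  let S : StieltjesFunction ℝ :=
    { toFun := fun t => -H t
      mono' := fun a b hab => neg_le_neg (hH hab)
      right_continuous' := fun t => (hright t).neg }
  have hS (a b : ℝ) : S b - S a = H a - H b := neg_sub_neg (H b) (H a)
  have hSle := stieltjes_measure_le_withDensity S hh hh0 fun a b hab =>
    (hS a b).trans_le (hle a b hab)
  have hSμ : S.measure ≪ μ :=
    (Measure.absolutelyContinuous_of_le hSle).trans (withDensity_absolutelyContinuous _ _)
  have := isFiniteMeasure_withDensity hh.lintegral_lt_top.ne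
  have := isFiniteMeasure_of_le _ hSle
  refine ⟨fun t => (S.measure.rnDeriv μ t).toReal, (Measure.measurable_rnDeriv _ _).ennreal_toReal,
    fun t => ENNReal.toReal_nonneg, Measure.integrable_toReal_rnDeriv, fun a b hab => ?_⟩
  rw [Measure.setIntegral_toReal_rnDeriv hSμ, measureReal_def, S.measure_Ioc,
    ENNReal.toReal_ofReal (sub_nonneg.2 (S.mono hab)), hS]

theorem IsRigidTowards.exists_eq_tailValue {D c : ℝ → ℝ} (hD : IsRigidTowards D c)
    (hlim : Tendsto D atTop (𝓝 0)) (hhm : Measurable h) (hh : Integrable h μ) (hh0 : ∀ t, 0 ≤ h t)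
    (hc : ∀ s s', 0 ≤ s → s ≤ s' → c s - c s' ≤ ∫ t in Ioc s s', h t ∂μ) :
    ∃ k : ℝ → ℝ, Measurable k ∧ Integrable k μ ∧ (∀ t, k t ∈ Icc 0 (h t)) ∧
      ∀ t, 0 ≤ t → D t = tailValue μ k t := by
  have hDle {a b : ℝ} := hD.sub_le_setIntegral (a := a) (b := b) hh hh0 hc
  obtain ⟨g, hgm, hg0, hgi, hg⟩ := exists_density_of_antitone (H := fun t => D (max t 0))
    (fun a b hab => hD.antitoneOn (mem_Ici.2 (le_max_right _ _)) (mem_Ici.2 (le_max_right _ _))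
      (max_le_max_right 0 hab)) hh hh0 fun a b hab =>
    (hDle (le_max_right a 0) (max_le_max_right 0 hab)).trans
      (setIntegral_mono_set hh.integrableOn (ae_of_all _ hh0) (LE.le.eventuallyLE fun s hs =>
        ⟨(le_max_left a 0).trans_lt hs.1,
          (le_max_iff.1 hs.2).resolve_right ((le_max_right a 0).trans_lt hs.1).not_ge⟩))
  have hg_Ioc {a b : ℝ} (ha : 0 ≤ a) (hab : a ≤ b) : ∫ t in Ioc a b, g t ∂μ = D a - D b := by
    rw [hg a b hab, max_eq_left ha, max_eq_left (ha.trans hab)]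
  have hgh : ∀ᵐ t ∂μ, g t ≤ h t := by
    filter_upwards [ae_pos_of_isDiscountMeasure (μ := μ),
      ae_nonneg_of_setIntegral_Ioc_nonneg (hh.sub hgi) fun a b ha hab => by
        rw [integral_sub' hh.integrableOn hgi.integrableOn, hg_Ioc ha hab]
        exact sub_nonneg.2 (hDle ha hab)] with t ht hgt
    exact sub_nonneg.1 (hgt ht)
  have hkg : (fun t => min (g t) (h t)) =ᵐ[μ] g := hgh.mono fun t ht => min_eq_left ht
  have hki := hgi.congr hkg.symm
  refine ⟨fun t => min (g t) (h t), hgm.min hhm, hki,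
    fun t => ⟨le_min (hg0 t) (hh0 t), min_le_right _ _⟩, fun t ht => sub_eq_zero.1 ?_⟩
  have hdiff : Tendsto (fun s => D s - tailValue μ (fun t => min (g t) (h t)) s) atTop (𝓝 0) := by
    simpa only [sub_zero] using hlim.sub (tendsto_tailValue_atTop hki)
  refine tendsto_nhds_unique (tendsto_const_nhds.congr' ?_) hdiff
  filter_upwards [eventually_ge_atTop t] with s hts
  have htail := tailValue_sub_tailValue hki hts
  rw [integral_congr_ae (ae_restrict_of_ae hkg), hg_Ioc ht hts] at htail
  linarith

end Density

theorem Admissible.of_le {μ : Measure ℝ} [IsFiniteMeasure μ] {f₀ f₁ x y : ℝ → ℝ} {I₀ I₁ : Set ℝ}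
    {u₀ u₁ us : ℝ} (hF : IsFrontierPair f₀ f₁ I₀ I₁ u₀ u₁ us) (hx : Admissible μ f₀ I₀ u₀ x)
    (hym : Measurable y) (hxy : ∀ t, x t ≤ y t) (hy : ∀ t, y t ≤ u₀) : Admissible μ f₀ I₀ u₀ y := by
  refine hx.of_add_le (z := 0) hF hym (fun t => ⟨(hx.nonneg t).trans (hxy t), hy t⟩)
    (integrable_zero _ _ _) (hx.ae_mem.mono fun t ht => ?_)
  have hyt : y t ∈ I₀ := by
    rcases (hxy t).eq_or_lt with heq | hlt
    · exact heq ▸ ht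
    · exact hF.mem_old ((hx.nonneg t).trans_lt hlt) (hy t)
  exact ⟨hyt, (add_zero _).trans_le (hF.strictMonoOn_old.monotoneOn ht hyt (hxy t))⟩

theorem discountedRent_mem_uIcc_iff {μ : Measure ℝ} [IsDiscountMeasure μ] {x R S T : ℝ → ℝ}
    {t : ℝ} : discountedRent μ x T t ∈ uIcc (discountedRent μ x R t) (discountedRent μ x S t) ↔
      T t ∈ uIcc (R t) (S t) := by
  have hq : 0 < μ.real (Ioi t) := measureReal_Ioi_pos t
  simp only [mem_uIcc, discountedRent, sub_le_sub_iff_right, mul_le_mul_iff_right₀ hq]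

namespace Mechanism

variable {r u₀ u₁ us t : ℝ} {F₀ F₁ : ℝ → EReal} {x y R : ℝ → ℝ}

theorem Undominated.isRigidTowards_discountedRent (hr : 0 < r) (hF : IsTechnology F₀ F₁ u₀ u₁ us)
    (hx : FeasibleFlow F₀ r u₀ x) (hR : ∀ t, 0 ≤ t → R t ∈ Icc 0 u₀)
    (hm : (hx.mechanism R).Undominated F₀ F₁ r) :
    IsRigidTowards (discountedRent (expMeasure r) x R)
      (discountedRent (expMeasure r) x fun _ => u₁) := by
  have := isDiscountMeasure_expMeasure hr
  obtain ⟨hanti, hnonneg⟩ := (mechanism_ic_iff hr hx fun t ht => (hR t ht).1).1 hm.1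
  refine ⟨hanti, hnonneg, fun E hE hE0 hmem t ht => ?_⟩
  let S : ℝ → ℝ := fun t => (E t + tailValue (expMeasure r) x t) / (expMeasure r).real (Ioi t)
  have hrent : discountedRent (expMeasure r) x S = E := by
    funext t
    rw [discountedRent, mul_div_cancel₀ _ (measureReal_Ioi_pos t).ne', add_sub_cancel_right]
  have hS_uIcc : ∀ t, 0 ≤ t → S t ∈ uIcc (R t) u₁ := fun t ht =>
    discountedRent_mem_uIcc_iff.1 (hrent ▸ hmem t ht)
  have hS : ∀ t, 0 ≤ t → S t ∈ Icc 0 u₀ := fun t ht =>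
    ordConnected_Icc.uIcc_subset (hR t ht) ⟨hF.new.peak_nonneg, hF.conflict.le⟩ (hS_uIcc t ht)
  have hic : (hx.mechanism S).IC r := by
    rw [mechanism_ic_iff hr hx fun t ht => (hS t ht).1, hrent]
    exact ⟨hE, hE0⟩
  have hreward := hm.reward_eq_of_mem_uIcc (X := fun t => ENNReal.ofReal (S t)) hr hF hx hic
    (fun τ hτ => ENNReal.ofReal_mono.mapsTo_uIcc (hS_uIcc τ hτ))
    (fun τ hτ => ENNReal.ofReal_le_ofReal (hS τ hτ).2) ht
  have hSR : S t = R t := (ENNReal.ofReal_eq_ofReal_iff (hS t ht).1 (hR t ht).1).1 hreward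
  rw [← hrent, discountedRent, hSR, discountedRent]

theorem Undominated.exists_discountedRent_eq_tailValue (hr : 0 < r)
    (hF : IsTechnology F₀ F₁ u₀ u₁ us) (hx : FeasibleFlow F₀ r u₀ x)
    (hR : ∀ t, 0 ≤ t → R t ∈ Icc 0 u₀) (hm : (hx.mechanism R).Undominated F₀ F₁ r) :
    ∃ k : ℝ → ℝ, Measurable k ∧ Integrable k (expMeasure r) ∧
      (∀ t, k t ∈ Icc 0 (max (u₁ - x t) 0)) ∧
      ∀ t, 0 ≤ t → discountedRent (expMeasure r) x R t = tailValue (expMeasure r) k t := by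
  have := isDiscountMeasure_expMeasure hr
  have hD := hm.isRigidTowards_discountedRent hr hF hx hR
  have hgap : Integrable (fun t => u₁ - x t) (expMeasure r) :=
    (integrable_const u₁).sub hx.integrable
  refine hD.exists_eq_tailValue ?_ ((measurable_const.sub hx.measurable).max measurable_const)
    (hgap.sup (integrable_zero _ _ _)) (fun _ => le_max_right _ _) fun s s' _ hss' => ?_
  · have hbound : Tendsto (fun t => (expMeasure r).real (Ioi t) * u₀) atTop (𝓝 0) := by
      simpa only [zero_mul] using tendsto_measureReal_Ioi_atTop.mul_const u₀
    refine squeeze_zero' ((eventually_ge_atTop 0).mono hD.nonneg)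
      ((eventually_ge_atTop 0).mono fun t ht => ?_) hbound
    have htail : 0 ≤ tailValue (expMeasure r) x t := integral_nonneg hx.nonneg
    rw [discountedRent]
    exact (sub_le_self _ htail).trans
      (mul_le_mul_of_nonneg_left (hR t ht).2 measureReal_nonneg)
  · rw [discountedRent_const hx.integrable, tailValue_sub_tailValue hgap hss']
    exact integral_mono hgap.integrableOn (hgap.sup (integrable_zero _ _ _)).integrableOn
      fun t => le_max_left _ _

theorem Undominated.flow_ae_eq_of_le (hr : 0 < r) (hF : IsTechnology F₀ F₁ u₀ u₁ us)
    (hx : FeasibleFlow F₀ r u₀ x) (hR : ∀ t, 0 ≤ t → 0 ≤ R t)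
    (hm : (hx.mechanism R).Undominated F₀ F₁ r) (hfin : ∃ᶠ τ in atTop, F₁ (R τ) ≠ ⊥)
    (hy : FeasibleFlow F₀ r u₀ y) (hxy : ∀ t, x t ≤ y t) (hic : (hy.mechanism R).IC r) :
    x =ᵐ[expMeasure r] y := by
  have := isDiscountMeasure_expMeasure hr
  have hmono := hF.isFrontierPair.strictMonoOn_old
  have hflow : ∀ᵐ t ∂expMeasure r, realFrontier F₀ (x t) ≤ realFrontier F₀ (y t) := by
    filter_upwards [hx.ae_mem, hy.ae_mem] with t hxt hyt
    exact hmono.monotoneOn hxt hyt (hxy t)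
  have hpayoff : ∀ τ, 0 ≤ τ →
      (hy.mechanism R).payoffAt F₀ F₁ r τ = (hx.mechanism R).payoffAt F₀ F₁ r τ := fun τ hτ => by
    refine hm.payoffAt_eq hic (fun τ hτ => ?_) hτ
    rw [mechanism_payoffAt hr hF.old hx hτ (hR τ hτ), mechanism_payoffAt hr hF.old hy hτ (hR τ hτ)]
    exact add_le_add_left (EReal.coe_le_coe (integral_mono_ae (hx.integrableOn τ)
      (hy.integrableOn τ) (ae_restrict_of_ae hflow))) _
  refine ae_of_frequently_ae_le ((hfin.and_eventually (eventually_ge_atTop 0)).mono ?_)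
  rintro τ ⟨hbot, hτ⟩
  have hcancel := hpayoff τ hτ
  rw [mechanism_payoffAt hr hF.old hx hτ (hR τ hτ), mechanism_payoffAt hr hF.old hy hτ (hR τ hτ),
    ← hF.new.coe_realFrontier ⟨hR τ hτ, hbot⟩, ← EReal.coe_mul, ← EReal.coe_add, ← EReal.coe_add,
    EReal.coe_eq_coe_iff, add_left_inj] at hcancel
  have heq := (integral_eq_iff_of_ae_le (hx.integrableOn τ) (hy.integrableOn τ)
    (ae_restrict_of_ae hflow)).1 hcancel.symm
  filter_upwards [(ae_restrict_iff' measurableSet_Iic).1 heq, hx.ae_mem, hy.ae_mem]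
    with t ht hxt hyt htτ
  exact hmono.injOn hxt hyt (ht htτ)

/-- The rent is the value of an increment `k` to the flow, and paying it out would leave the agent
no rent while improving the payoff. -/
theorem Undominated.reward_eq_contValue (hr : 0 < r) (hF : IsTechnology F₀ F₁ u₀ u₁ us)
    (hx : FeasibleFlow F₀ r u₀ x) (hR : ∀ t, 0 ≤ t → R t ∈ Icc 0 u₀)
    (hm : (hx.mechanism R).Undominated F₀ F₁ r) (hfin : ∃ᶠ τ in atTop, F₁ (R τ) ≠ ⊥)
    (ht : 0 ≤ t) : R t = contValue (expMeasure r) x t := by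
  have := isDiscountMeasure_expMeasure hr
  have hR0 : ∀ t, 0 ≤ t → 0 ≤ R t := fun t ht => (hR t ht).1
  obtain ⟨k, hkm, hki, hk, hrent⟩ := hm.exists_discountedRent_eq_tailValue hr hF hx hR
  have hle_add : ∀ t, x t ≤ x t + k t := fun t => le_add_of_nonneg_right (hk t).1
  have hy : FeasibleFlow F₀ r u₀ fun t => x t + k t := by
    refine hx.of_le hF.isFrontierPair (hx.measurable.add hkm) hle_add fun t => ?_
    rcases max_cases (u₁ - x t) 0 with h | h <;> linarith [(hk t).2, hx.le t, hF.conflict]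
  have hrent_add : ∀ t, 0 ≤ t → discountedRent (expMeasure r) (fun t => x t + k t) R t = 0 := by
    intro t ht
    rw [discountedRent, tailValue, integral_add hx.integrable.integrableOn hki.integrableOn]
    exact (sub_add_eq_sub_sub _ _ _).trans (sub_eq_zero.2 (hrent t ht))
  have hic : (hy.mechanism R).IC r := by
    rw [mechanism_ic_iff hr hy hR0]
    exact ⟨fun a ha b hb _ => ((hrent_add b hb).trans (hrent_add a ha).symm).le,
      fun t ht => (hrent_add t ht).ge⟩
  have hk0 : k =ᵐ[expMeasure r] 0 :=
    (hm.flow_ae_eq_of_le hr hF hx hR0 hfin hy hle_add hic).mono fun t => left_eq_add.1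
  have hzero : discountedRent (expMeasure r) x R t = 0 := by
    rw [hrent t ht, tailValue]
    exact integral_eq_zero_of_ae (ae_restrict_of_ae hk0)
  exact (contValue_eq_of_tailValue_eq (sub_eq_zero.1 hzero).symm).symm

end Mechanism

theorem IsFrontier.realFrontier_le_peak {F : ℝ → EReal} {p u : ℝ} (hF : IsFrontier F p)
    (hu : u ∈ effDomain F) : realFrontier F u ≤ realFrontier F p := by
  rw [← EReal.coe_le_coe_iff, hF.coe_realFrontier hu]
  exact hF.le_coe_realFrontier_peak hu.1

theorem measurable_setIntegral_Iic {μ : Measure ℝ} [IsFiniteMeasure μ] {φ : ℝ → ℝ} {C : ℝ}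
    (hφ : ∀ τ, IntegrableOn φ (Iic τ) μ) (hC : ∀ᵐ t ∂μ, φ t ≤ C) :
    Measurable fun τ => ∫ t in Iic τ, φ t ∂μ := by
  have hgap : Monotone fun τ => ∫ t in Iic τ, (C - φ t) ∂μ := fun a b hab =>
    setIntegral_mono_set ((integrable_const C).sub (hφ b))
      (ae_restrict_of_ae (hC.mono fun t ht => sub_nonneg.2 ht)) (Iic_subset_Iic.2 hab).eventuallyLE
  have hconst : Monotone fun τ => μ.real (Iic τ) := fun a b hab =>
    measureReal_mono (Iic_subset_Iic.2 hab)
  have heq : (fun τ => ∫ t in Iic τ, φ t ∂μ) =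
      fun τ => μ.real (Iic τ) * C - ∫ t in Iic τ, (C - φ t) ∂μ := by
    funext τ
    rw [integral_sub (integrable_const C) (hφ τ), setIntegral_const, smul_eq_mul, sub_sub_cancel]
  rw [heq]
  exact (hconst.measurable.mul_const C).sub hgap.measurable

section Disclosure

variable {r u₀ u₁ us : ℝ} {F₀ F₁ : ℝ → EReal} {x : ℝ → ℝ} {G : Measure ℝ}

theorem mechanism_contValue_ic (hr : 0 < r) (hx : FeasibleFlow F₀ r u₀ x) :
    (hx.mechanism (contValue (expMeasure r) x)).IC r := by
  have := isDiscountMeasure_expMeasure hr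
  have hrent : discountedRent (expMeasure r) x (contValue (expMeasure r) x) = 0 :=
    funext fun t => sub_eq_zero.2 (measureReal_Ioi_mul_contValue t)
  rw [mechanism_ic_iff hr hx fun t _ => (hx.contValue_mem_Icc t).1, hrent]
  exact ⟨antitoneOn_const, fun _ _ => le_rfl⟩

theorem mechanism_contValue_payoffAt (hr : 0 < r) (hF : IsTechnology F₀ F₁ u₀ u₁ us)
    (hx : FeasibleFlow F₀ r u₀ x) {τ : ℝ} (hτ : 0 ≤ τ) :
    (hx.mechanism (contValue (expMeasure r) x)).payoffAt F₀ F₁ r τ =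
      (disclosureValue (expMeasure r) (realFrontier F₀) (realFrontier F₁) x τ : ℝ) := by
  have := isDiscountMeasure_expMeasure hr
  rw [mechanism_payoffAt hr hF.old hx hτ (hx.contValue_mem_Icc τ).1,
    ← hF.new.coe_realFrontier (hx.contValue_mem_new hF.isFrontierPair τ).1, ← EReal.coe_mul,
    ← EReal.coe_add, disclosureValue]

theorem Mechanism.Undominated.efficient (hr : 0 < r) (hF : IsTechnology F₀ F₁ u₀ u₁ us)
    (hx : FeasibleFlow F₀ r u₀ x)
    (hm : (hx.mechanism (contValue (expMeasure r) x)).Undominated F₀ F₁ r) :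
    Efficient (expMeasure r) (realFrontier F₀) (realFrontier F₁) (effDomain F₀ ∩ Icc 0 u₀) u₀
      x where
  admissible := hx
  eq_of_le y hy hle τ hτ := by
    have heq := hm.payoffAt_eq (mechanism_contValue_ic hr hy) (fun τ hτ => by
      rw [mechanism_contValue_payoffAt hr hF hx hτ, mechanism_contValue_payoffAt hr hF hy hτ]
      exact EReal.coe_le_coe (hle τ hτ)) hτ
    rwa [mechanism_contValue_payoffAt hr hF hx hτ, mechanism_contValue_payoffAt hr hF hy hτ,
      EReal.coe_eq_coe_iff] at heq

theorem FeasibleFlow.ae_realFrontier_le {p : ℝ} (hF : IsFrontier F₀ p)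
    (hx : FeasibleFlow F₀ r u₀ x) : ∀ᵐ t ∂expMeasure r, realFrontier F₀ (x t) ≤ realFrontier F₀ p :=
  hx.ae_mem.mono fun _ ht => hF.realFrontier_le_peak ht.1

theorem measurable_disclosureValue (hr : 0 < r) (hF : IsTechnology F₀ F₁ u₀ u₁ us)
    (hx : FeasibleFlow F₀ r u₀ x) :
    Measurable (disclosureValue (expMeasure r) (realFrontier F₀) (realFrontier F₁) x) := by
  have := isDiscountMeasure_expMeasure hr
  exact (measurable_setIntegral_Iic hx.integrableOn (hx.ae_realFrontier_le hF.old)).add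
    (continuous_measureReal_Ioi.measurable.mul
      (hF.new.measurable_realFrontier.comp (continuous_contValue hx.integrable).measurable))

theorem disclosureValue_le (hr : 0 < r) (hF : IsTechnology F₀ F₁ u₀ u₁ us)
    (hx : FeasibleFlow F₀ r u₀ x) (τ : ℝ) :
    disclosureValue (expMeasure r) (realFrontier F₀) (realFrontier F₁) x τ ≤
      |realFrontier F₀ u₀| + |realFrontier F₁ u₁| := by
  have := isDiscountMeasure_expMeasure hr
  have hnew : realFrontier F₁ (contValue (expMeasure r) x τ) ≤ |realFrontier F₁ u₁| :=
    (hF.new.realFrontier_le_peak (hx.contValue_mem_new hF.isFrontierPair τ).1).trans (le_abs_self _)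
  have hold : ∀ᵐ t ∂expMeasure r, realFrontier F₀ (x t) ≤ |realFrontier F₀ u₀| :=
    (hx.ae_realFrontier_le hF.old).mono fun t ht => ht.trans (le_abs_self _)
  calc disclosureValue (expMeasure r) (realFrontier F₀) (realFrontier F₁) x τ
    _ ≤ (∫ _ in Iic τ, |realFrontier F₀ u₀| ∂expMeasure r) +
        (expMeasure r).real (Ioi τ) * |realFrontier F₁ u₁| :=
      add_le_add (integral_mono_ae (hx.integrableOn τ) (integrable_const _)
        (ae_restrict_of_ae hold)) (mul_le_mul_of_nonneg_left hnew measureReal_nonneg)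
    _ ≤ |realFrontier F₀ u₀| + |realFrontier F₁ u₁| := by
      rw [setIntegral_const, smul_eq_mul]
      exact add_le_add (mul_le_of_le_one_left (abs_nonneg _) measureReal_le_one)
        (mul_le_of_le_one_left (abs_nonneg _) measureReal_le_one)

theorem Mechanism.Optimal.meanEfficient (hr : 0 < r) (hF : IsTechnology F₀ F₁ u₀ u₁ us)
    (hG : IsTimeLaw G) (hx : FeasibleFlow F₀ r u₀ x)
    (hm : (hx.mechanism (contValue (expMeasure r) x)).Optimal F₀ F₁ r G) :
    MeanEfficient (expMeasure r) G (realFrontier F₀) (realFrontier F₁) (effDomain F₀ ∩ Icc 0 u₀)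
      u₀ x := by
  refine ⟨hx, fun y hy k hk hle => ?_⟩
  have := hG.prob
  let V := disclosureValue (expMeasure r) (realFrontier F₀) (realFrontier F₁) x
  have hpayoff : (hx.mechanism (contValue (expMeasure r) x)).payoff F₀ F₁ r G =
      eintegral G fun τ => (V τ : EReal) :=
    eintegral_congr_ae (hG.ae_nonneg.mono fun τ hτ => mechanism_contValue_payoffAt hr hF hx hτ)
  have hbot := hm.payoff_ne_bot hr hF hG
  rw [hpayoff] at hbot
  have hV : Integrable V G := by
    simpa only [EReal.toReal_coe] using integrable_toReal_of_eintegral_ne_bot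
      (measurable_disclosureValue hr hF hx).coe_real_ereal.aemeasurable
      (integrable_const (|realFrontier F₀ u₀| + |realFrontier F₁ u₁|))
      (ae_of_all _ fun τ => EReal.coe_le_coe (disclosureValue_le hr hF hx τ)) hbot
  have hle_payoff : ((∫ τ, (V τ + k τ) ∂G : ℝ) : EReal) ≤ ((∫ τ, V τ ∂G : ℝ) : EReal) := calc
    ((∫ τ, (V τ + k τ) ∂G : ℝ) : EReal)
      = eintegral G fun τ => ((V τ + k τ : ℝ) : EReal) := (eintegral_coe (hV.add hk)).symm
    _ ≤ (hy.mechanism (contValue (expMeasure r) y)).payoff F₀ F₁ r G := by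
      refine eintegral_mono_ae (hG.ae_nonneg.mono fun τ hτ => ?_)
      rw [mechanism_contValue_payoffAt hr hF hy hτ]
      exact EReal.coe_le_coe (hle τ hτ)
    _ ≤ (hx.mechanism (contValue (expMeasure r) x)).payoff F₀ F₁ r G :=
      hm.2.1 _ (mechanism_contValue_ic hr hy)
    _ = ((∫ τ, V τ ∂G : ℝ) : EReal) := hpayoff.trans (eintegral_coe hV)
  rw [EReal.coe_le_coe_iff, integral_add hV hk] at hle_payoff
  exact nonpos_of_add_le_right hle_payoff

end Disclosure

theorem Mechanism.Optimal.exists_contValue_mechanism {r u₀ u₁ us : ℝ} {F₀ F₁ : ℝ → EReal}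
    {G : Measure ℝ} {m : Mechanism} (hr : 0 < r) (hF : IsTechnology F₀ F₁ u₀ u₁ us)
    (hG : IsTimeLaw G) (hsupp : ¬BddAbove G.support) (hm : m.Optimal F₀ F₁ r G) :
    ∃ x, ∃ hx : FeasibleFlow F₀ r u₀ x, m.flow =ᵐ[expMeasure r] x ∧
      (hx.mechanism (contValue (expMeasure r) x)).Optimal F₀ F₁ r G := by
  obtain ⟨x, R, hx, hmx, hR, hopt, hfin⟩ := hm.exists_mechanism hr hF hG hsupp
  have hcont : ∀ t, 0 ≤ t → R t = contValue (expMeasure r) x t := fun t =>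
    hopt.2.2.reward_eq_contValue hr hF hx hR hfin
  exact ⟨x, hx, hmx, hopt.congr (m := hx.mechanism R) hr hG .rfl fun t ht =>
    congrArg ENNReal.ofReal (hcont t ht)⟩

theorem theorem3 (r : ℝ) (hr : 0 < r) (F₀ F₁ : ℝ → EReal) (u₀ u₁ us : ℝ)
    (hF : IsTechnology F₀ F₁ u₀ u₁ us)
    (G : Measure ℝ) (hG : IsTimeLaw G) (hG0 : ProbabilityTheory.cdf G 0 = 0)
    (hGsupp : ¬ BddAbove G.support)
    (m : Mechanism) (hm : m.Optimal F₀ F₁ r G) :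
    ∃ m' : Mechanism, m'.IsVersion m ∧ AntitoneOn m'.flow (Ici 0) ∧
      Tendsto m'.flow (𝓝[>] 0) (𝓝 u₀) ∧ Tendsto m'.flow atTop (𝓝 us) := by
  have := hG.prob
  have := isDiscountMeasure_expMeasure hr
  obtain ⟨x, hx, hmx, hopt⟩ := hm.exists_contValue_mechanism hr hF hG hGsupp
  have heff := hopt.2.2.efficient hr hF hx
  have hmean := hopt.meanEfficient hr hF hG hx
  have hlate (a : ℝ) : 0 < G.real (Ioi a) :=
    ENNReal.toReal_pos (measure_Ioi_pos hGsupp a).ne' (measure_ne_top _ _)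
  obtain ⟨z, hz, hzx, hzadm, hlim_zero, hlim_top⟩ :=
    heff.exists_antitone_tendsto hF.isFrontierPair hmean hG0 hlate
  exact ⟨⟨z, m.reward, fun t _ => hzadm.nonneg t, hz.measurable.aemeasurable⟩,
    ⟨(ae_expMeasure_iff hr).1 (hzx.trans hmx.symm), fun _ _ => rfl⟩, hz.antitoneOn _, hlim_zero,
    hlim_top⟩
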